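/- Theorem 1.3. Let $\Bbbk$ be an algebraically closed field of characteristic $p > 0$, and let $n, N, N' \ge 0$ be integers. A projective variety is an irreducible Zariski closed subset of the ambient projective variety, and $\mathbb{G}(n,\mathbb{P}^N)$ is the Grassmann variety of $n$-planes in $\mathbb{P}^N$. For an $n$-dimensional projective variety $X \subset \mathbb{P}^N$, the Gauss map $\gamma_X : X \dashrightarrow \mathbb{G}(n,\mathbb{P}^N)$ is the rational map that sends each smooth point $x \in X$ to the embedded tangent space $\mathbb{T}_xX \subset \mathbb{P}^N$. Let $Y \subset \mathbb{G}(n,\mathbb{P}^N)$ be a projective variety with $\dim Y \ge 1$, and let $\mathcal{F} \subset Y \times \mathbb{P}^{N'}$ be an $n$-dimensional projective variety such that the first projection $f : \mathcal{F} \to Y$ is surjective. Then there exist an $n$-dimensional projective variety $X \subset \mathbb{P}^N$ and a generically bijective rational map $h : X \dashrightarrow \mathcal{F}$ (that is, $h$ restricts to a bijection between nonempty open subsets of $X$ and of $\mathcal{F}$) such that $\gamma_X = f \circ h$ as rational maps. In particular, $\overline{\gamma_X(X)} = Y$. If moreover $n \ge N'$, then $X$ and $h$ can be taken such that, in addition,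 there is a nonempty open subset of $Y$ for every point $y$ of which the reduced closed fibre $\overline{\gamma_X^{-1}(y)}_{red} \subset \mathbb{P}^N$ (the closure of the set of smooth points $x \in X$ with $\mathbb{T}_xX = y$) is projectively equivalent to $F_y := f^{-1}(y)_{red} \subset \{y\} \times \mathbb{P}^{N'}$, that is, it is the image of $F_y$ under a linear embedding $\mathbb{P}^{N'} \hookrightarrow \mathbb{P}^N$. -/

import Mathlib

open scoped LinearAlgebra.Projectivization

noncomputable section

namespace GaussFamily

/-! Varieties over an algebraically closed field are treated classically, as sets of points
with the Zariski topology. -/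

/-- The projective space of dimension `N` over `k`: lines through the origin of `k^(N+1)`. -/
abbrev PSpace (k : Type*) [Field k] (N : ℕ) : Type _ := ℙ k (Fin (N + 1) → k)

/-- The Zariski topology on a projective space with homogeneous coordinates indexed by `ι`: a basis
is given by the sets on which a homogeneous polynomial does not vanish. -/
instance zariskiProjective {k : Type*} [Field k] {ι : Type*} :
    TopologicalSpace (ℙ k (ι → k)) :=
  TopologicalSpace.generateFrom
    {U | ∃ (d : ℕ) (f : MvPolynomial ι k), f.IsHomogeneous d ∧
      U = {x | MvPolynomial.eval x.rep f ≠ 0}}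

/-- The Grassmannian of `n`-planes in projective `N`-space, that is, of `(n+1)`-dimensional linear
subspaces of `k^(N+1)`. -/
@[ext]
structure Grassmannian (k : Type*) [Field k] (n N : ℕ) where
  toSubmodule : Submodule k (Fin (N + 1) → k)
  finrank_eq : Module.finrank k toSubmodule = n + 1

/-- A chosen basis of the linear subspace; its members are the rows of a matrix. -/
def Grassmannian.frame {k : Type*} [Field k] {n N : ℕ} (W : Grassmannian k n N) :
    Matrix (Fin (n + 1)) (Fin (N + 1)) k :=
  Matrix.of fun a => (Module.finBasisOfFinrankEq k W.toSubmodule W.finrank_eq a :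
    Fin (N + 1) → k)

/-- The maximal minors of the matrix of a basis, for all sequences `I` of `n+1` columns (so the
full skew-symmetric array of Plücker coordinates). Another basis changes them by a common nonzero
factor. -/
def Grassmannian.minors {k : Type*} [Field k] {n N : ℕ} (W : Grassmannian k n N) :
    (Fin (n + 1) → Fin (N + 1)) → k :=
  fun I => (W.frame.submatrix id I).det

theorem Grassmannian.minors_ne_zero {k : Type*} [Field k] {n N : ℕ} (W : Grassmannian k n N) :
    W.minors ≠ 0 := by
  classical
  intro h0
  have hli : LinearIndependent k W.frame.row := by
    have := (Module.finBasisOfFinrankEq k W.toSubmodule W.finrank_eq).linearIndependent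
    exact this.map' W.toSubmodule.subtype (Submodule.ker_subtype _)
  obtain ⟨g, hg⟩ := W.frame.vecMulLinear.exists_leftInverse_of_injective
    (LinearMap.ker_eq_bot.2 (Matrix.vecMul_injective_iff.2 hli))
  let B : Matrix (Fin (N + 1)) (Fin (n + 1)) k := Matrix.of fun j => g (Pi.single j 1)
  have hB : W.frame * B = 1 := by
    ext a b
    have h1 : g (W.frame a) = Pi.single a 1 := by
      have h2 := LinearMap.congr_fun hg (Pi.single a 1)
      have h3 : W.frame.vecMulLinear (Pi.single a 1) = W.frame a := by
        simp [Matrix.vecMulLinear, Matrix.row]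
      simpa [h3] using h2
    have h4 : W.frame a = ∑ j, W.frame a j • (Pi.single j 1 : Fin (N + 1) → k) := by
      ext c
      simp [Finset.sum_apply, Pi.single_apply]
    rw [h4, map_sum] at h1
    have h5 := congrFun h1 b
    simp only [map_smul, Finset.sum_apply, Pi.smul_apply, smul_eq_mul] at h5
    rw [Matrix.mul_apply, Matrix.one_apply]
    simpa [B, Pi.single_apply, eq_comm] using h5
  have hdet : (W.frame * B).transpose.det = 0 := by
    have hrow : (W.frame * B).transpose =
        fun b => ∑ j, B j b • W.frame.transpose j := by
      ext b a
      simp [Matrix.mul_apply, Finset.sum_apply, mul_comm]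
    rw [hrow]
    change Matrix.detRowAlternating.toMultilinearMap
      (fun b => ∑ j, B j b • W.frame.transpose j) = 0
    rw [MultilinearMap.map_sum]
    refine Finset.sum_eq_zero fun I _ => ?_
    rw [MultilinearMap.map_smul_univ]
    have hI : Matrix.detRowAlternating.toMultilinearMap (fun b => W.frame.transpose (I b)) =
        (W.frame.submatrix id I).det := by
      rw [← Matrix.det_transpose]
      rfl
    rw [hI]
    have h6 : (W.frame.submatrix id I).det = 0 := congrFun h0 I
    rw [h6, smul_zero]
  rw [hB, Matrix.transpose_one, Matrix.det_one] at hdet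
  exact one_ne_zero hdet

/-- The Plücker embedding. -/
def Grassmannian.plucker {k : Type*} [Field k] {n N : ℕ} (W : Grassmannian k n N) :
    ℙ k ((Fin (n + 1) → Fin (N + 1)) → k) :=
  Projectivization.mk k W.minors W.minors_ne_zero

/-- The Zariski topology of the Grassmannian, through the Plücker embedding. -/
instance zariskiGrassmannian {k : Type*} [Field k] {n N : ℕ} :
    TopologicalSpace (Grassmannian k n N) :=
  TopologicalSpace.induced Grassmannian.plucker zariskiProjective

/-- The product variety of the Grassmannian of `n`-planes in projective `N`-space and of projective
`N'`-space. -/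
@[ext]
structure GrassProd (k : Type*) [Field k] (n N N' : ℕ) where
  plane : Grassmannian k n N
  point : PSpace k N'

/-- The Zariski topology of the product variety (not the product of the topologies): a basis is
given by the sets on which a polynomial that is bihomogeneous in the Plücker coordinates of the
plane and the homogeneous coordinates of the point does not vanish. -/
instance zariskiGrassProd {k : Type*} [Field k] {n N N' : ℕ} :
    TopologicalSpace (GrassProd k n N N') :=
  TopologicalSpace.generateFrom
    {U | ∃ (d e : ℕ) (f : MvPolynomial ((Fin (n + 1) → Fin (N + 1)) ⊕ Fin (N' + 1)) k),
      f.IsWeightedHomogeneous (Sum.elim (fun _ => ((1, 0) : ℕ × ℕ)) (fun _ => (0, 1))) (d, e) ∧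
      U = {z | MvPolynomial.eval (Sum.elim z.plane.plucker.rep z.point.rep) f ≠ 0}}

/-- A (projective) variety in one of the spaces above: an irreducible Zariski closed subset. -/
structure IsVariety {T : Type*} [TopologicalSpace T] (X : Set T) : Prop where
  isClosed : IsClosed X
  isIrreducible : IsIrreducible X

/-- The linear subspace of `k^(N+1)` whose projectivization is the embedded tangent space to `X`
at `x`: the common kernel of the differentials at `x` of the homogeneous polynomials that vanish
on `X`. -/
def tangentSpace {k : Type*} [Field k] {N : ℕ} (X : Set (PSpace k N)) (x : PSpace k N) :
    Submodule k (Fin (N + 1) → k) where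
  carrier := {v | ∀ (d : ℕ) (f : MvPolynomial (Fin (N + 1)) k), f.IsHomogeneous d →
    (∀ z ∈ X, MvPolynomial.eval z.rep f = 0) →
      ∑ i, MvPolynomial.eval x.rep (MvPolynomial.pderiv i f) * v i = 0}
  zero_mem' := by
    intro d f _ _
    simp
  add_mem' := by
    intro v w hv hw d f hf hX
    simp [mul_add, Finset.sum_add_distrib, hv d f hf hX, hw d f hf hX]
  smul_mem' := by
    intro c v hv d f hf hX
    have h := congrArg (fun t => c * t) (hv d f hf hX)
    simp only [Finset.mul_sum, mul_zero] at h
    rw [← h]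
    refine Finset.sum_congr rfl fun i _ => ?_
    simp only [Pi.smul_apply, smul_eq_mul]
    ring

/-- The smooth points of a variety `X` of dimension `n` (Jacobian criterion). -/
def smoothLocus {k : Type*} [Field k] {N : ℕ} (n : ℕ) (X : Set (PSpace k N)) :
    Set (PSpace k N) :=
  {x | x ∈ X ∧ Module.finrank k (tangentSpace X x) = n + 1}

/-- The Gauss map of a variety `X` of dimension `n`, on the smooth points. -/
def gaussMap {k : Type*} [Field k] {N : ℕ} (n : ℕ) (X : Set (PSpace k N))
    (x : smoothLocus n X) : Grassmannian k n N :=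
  ⟨tangentSpace X x.1, x.2.2⟩

/-- The fibre of the Gauss map over `y`, as a set of points (reduced structure). -/
def gaussFibre {k : Type*} [Field k] {N : ℕ} (n : ℕ) (X : Set (PSpace k N))
    (y : Grassmannian k n N) : Set (PSpace k N) :=
  Subtype.val '' (gaussMap n X ⁻¹' {y})

/-- A map from a locally closed subset `A` of a projective space to a projective space is regular
if locally it is given by homogeneous polynomials of the same degree without common zero. -/
def IsRegularOn {k : Type*} [Field k] {N : ℕ} {ι : Type*} (A : Set (PSpace k N))
    (φ : PSpace k N → ℙ k (ι → k)) : Prop :=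
  ∀ x ∈ A, ∃ V : Set (PSpace k N), IsOpen V ∧ x ∈ V ∧
    ∃ (d : ℕ) (g : ι → MvPolynomial (Fin (N + 1)) k), (∀ i, (g i).IsHomogeneous d) ∧
      ∀ z ∈ A ∩ V, ∃ hz : (fun i => MvPolynomial.eval z.rep (g i)) ≠ 0,
        φ z = Projectivization.mk k (fun i => MvPolynomial.eval z.rep (g i)) hz

/-- A representative of a rational map from a variety `X` in projective `M`-space to a subvariety
`F` of the product of a Grassmannian and a projective space: a regular map to `F` on a nonempty
open subset `X ∩ dom` of `X`. The values outside `X ∩ dom` are irrelevant. -/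
structure RatMap {k : Type*} [Field k] {M n N N' : ℕ} (X : Set (PSpace k M))
    (F : Set (GrassProd k n N N')) where
  dom : Set (PSpace k M)
  isOpen_dom : IsOpen dom
  nonempty_dom : (X ∩ dom).Nonempty
  toFun : PSpace k M → GrassProd k n N N'
  mapsTo : Set.MapsTo toFun (X ∩ dom) F
  regular_plane : IsRegularOn (X ∩ dom) fun x => (toFun x).plane.plucker
  regular_point : IsRegularOn (X ∩ dom) fun x => (toFun x).point

/-- The rational map restricts to a bijection between nonempty open subsets. -/
def RatMap.GenericallyBijective {k : Type*} [Field k] {M n N N' : ℕ} {X : Set (PSpace k M)}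
    {F : Set (GrassProd k n N N')} (h : RatMap X F) : Prop :=
  ∃ (U : Set (PSpace k M)) (V : Set (GrassProd k n N N')), IsOpen U ∧ IsOpen V ∧ U ⊆ h.dom ∧
    (X ∩ U).Nonempty ∧ (F ∩ V).Nonempty ∧ Set.BijOn h.toFun (X ∩ U) (F ∩ V)

/-- The Gauss map of the `n`-dimensional variety `X` is, as a rational map, the composition of `h`
with the projection to the Grassmannian: they are defined and agree on a nonempty open subset. -/
def RatMap.GaussMapEqFstComp {k : Type*} [Field k] {n N N' : ℕ} {X : Set (PSpace k N)}
    {F : Set (GrassProd k n N N')} (h : RatMap X F) : Prop :=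
  ∃ U : Set (PSpace k N), IsOpen U ∧ U ⊆ h.dom ∧ (X ∩ U).Nonempty ∧
    ∀ x ∈ X ∩ U, ∃ hx : x ∈ smoothLocus n X, gaussMap n X ⟨x, hx⟩ = (h.toFun x).plane

/-- The fibre over `y` of the projection of `F` to the Grassmannian, as a set of points of
projective `N'`-space. -/
def fibre {k : Type*} [Field k] {n N N' : ℕ} (F : Set (GrassProd k n N N'))
    (y : Grassmannian k n N) : Set (PSpace k N') :=
  {q | (⟨y, q⟩ : GrassProd k n N N') ∈ F}

/-- Projective equivalence of a subset of projective `N'`-space and a subset of projective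
`N`-space with `N' ≤ N`: a linear embedding of projective spaces maps the first onto the second. -/
def ProjectivelyEquivalent {k : Type*} [Field k] {N' N : ℕ} (A : Set (PSpace k N'))
    (B : Set (PSpace k N)) : Prop :=
  ∃ (φ : (Fin (N' + 1) → k) →ₗ[k] (Fin (N + 1) → k)) (hφ : Function.Injective φ),
    Projectivization.map φ hφ '' A = B

end GaussFamily

end

/-!
Let `Γ` be the matrix whose rows span the general plane `y` of `Y`, normalized so that its columns
with indices in `I` form the unit matrix, and let `γ` be the matrix of the `p`-th roots of its
entries. The function field of `F`, with the `γ a c` adjoined, is a field `L` of transcendence degree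
`n` over `k`. For elements `a 1`, ..., `a n` of `L`, consider the point `v = Γ 0 + ∑ i, a i • Γ i` of
the general plane. The entries of `Γ` are `p`-th powers, so their differentials vanish and
`dv = ∑ i, d(a i) • Γ i`. Hence, if the differentials of the `a i` are linearly independent, then the
tangent space at `v` of the variety `X` that is swept out by these points contains all the rows of
`Γ`, and for reasons of dimension it is the plane `y`. Moreover the `a i` are coordinates of `v`, and
`L` is separable over the field they generate, so that the other coordinates of `v` satisfy separable
relations over the `a i`; the gradients of these relations are normal to the plane, so they express
the entries of `Γ` rationally in `v`. If the `a i` and the entries of `Γ` generate `L`, it follows that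
`v` determines the parameters, and that sending `v` to the point of `F` it comes from is a generically
bijective rational map. (It is not birational in general: taking `p`-th roots of coordinates is a
homeomorphism for the Zariski topology, `rootHomeomorph`, but not an isomorphism.) This construction
is the structure `TangentFamily`; the main points are `TangentFamily.adjoin_genVec`,
`TangentFamily.mem_tangentSpace_iff` and `TangentFamily.exists_ratMap`.

It remains to find coefficients `a i` that have independent differentials and that generate `L`
together with the entries of `Γ`.

* As `Y` is not a point, some `γ a c` is transcendental. It has an iterated `p`-th root `u` that is
  not a `p`-th power (`exists_pow_eq_of_transcendental`), and then `du ≠ 0`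
  (`D_ne_zero_of_forall_pow_ne`). So there are functions, one of them `u`, whose differentials form a
  basis. To get the `a i`, replace `u` by a primitive element of `L` over the field these functions
  generate. Nothing is lost, since `u` is separable over the field of the `a i`, and as an iterated
  `p`-th root of an entry of `Γ` it is then rational in the `a i` and this entry
  (`exists_coordinates_of_transcendental`).
* If `N' ≤ n`, the affine coordinates of the point of `F`, completed by zeros, will do after the
  addition of suitable `γ a c` to them (`exists_coordinates_add`). On a fibre over a fixed plane the
  `γ a c` are constants, so `v` is there the image of the point of the fibre under a linear embedding,
  `fibreEmbedding`.

In the second case the closure of the fibre of the Gauss map over a general `y` is to be compared with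
the whole image of the fibre of `F`, while the construction only describes open subsets of `X` and
`F`. On the one hand, the Gauss map is continuous on all smooth points (`continuous_gaussGraph`) and
`F` is closed, so that every smooth point with tangent space `y` lies in that image
(`gaussFibre_subset`). On the other hand, an open subset of `F` is dense in the general fibres
(`exists_open_subset_closure`): a function that does not vanish on `F` is a nonzerodivisor on the
general fibres, which is proved by division with respect to a monomial order, with the leading
coefficients inverted (`exists_generic_division`, `exists_generic_nonzerodivisor`).

Dimensions are computed as transcendence degrees by way of a generic point with coordinates in the
function field (`IsGeneric`, `IsGeneric.topologicalKrullDim_eq`).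
-/

open scoped LinearAlgebra.Projectivization

noncomputable section

namespace GaussFamily

universe u

/-! ### Krull dimension and transcendence degree -/

/-- Chains of prime ideals go up in an integral extension, and contraction is strictly monotone. -/
theorem ringKrullDim_eq_of_isIntegral {R S : Type*} [CommRing R] [CommRing S] [IsDomain S] [Algebra R S]
    [Algebra.IsIntegral R S] (hinj : Function.Injective (algebraMap R S)) :
    ringKrullDim R = ringKrullDim S := by
  apply le_antisymm
  · refine iSup_le fun l => ?_
    obtain ⟨P, hP, hover⟩ := Ideal.exists_ideal_over_prime_of_isIntegral_of_isDomain
      (S := S) (RelSeries.head l).asIdeal (by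
        rw [(RingHom.injective_iff_ker_eq_bot _).1 hinj]; exact bot_le)
    have : P.LiesOver (RelSeries.head l).asIdeal := ⟨hover.symm⟩
    obtain ⟨l', hl', -, -⟩ := Ideal.exists_ltSeries_of_hasGoingUp (S := S) l P
    rw [← hl']
    exact le_iSup (fun l : LTSeries (PrimeSpectrum S) => (l.length : WithBot ℕ∞)) l'
  · exact Order.krullDim_le_of_strictMono (PrimeSpectrum.comap (algebraMap R S))
      fun P Q h => Ideal.IsIntegral.comap_lt_comap (R := R) h

/-- By Noether normalization, the dimension and the transcendence degree of an affine domain are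
both equal to the number of variables of a polynomial ring over which it is integral. -/
theorem exists_ringKrullDim_eq_trdeg (k A : Type*) [Field k] [CommRing A] [IsDomain A]
    [Algebra k A] [Algebra.FiniteType k A] :
    ∃ s : ℕ, ringKrullDim A = s ∧ Algebra.trdeg k A = s := by
  obtain ⟨s, g, hg, hint⟩ := exists_integral_inj_algHom_of_fg k A
  refine ⟨s, ?_, ?_⟩
  · let _ := g.toRingHom.toAlgebra
    have : Algebra.IsIntegral (MvPolynomial (Fin s) k) A := ⟨hint⟩
    rw [← ringKrullDim_eq_of_isIntegral (R := MvPolynomial (Fin s) k) (S := A) hg]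
    rw [MvPolynomial.ringKrullDim_of_isNoetherianRing, ringKrullDim_eq_zero_of_field]
    simp
  · have h1 : AlgebraicIndependent k (fun i => g (MvPolynomial.X i)) := by
      rw [algebraicIndependent_iff_injective_aeval]
      have : (MvPolynomial.aeval fun i => g (MvPolynomial.X i)) = g := by
        ext i; simp
      rw [this]; exact hg
    have h2 : IsTranscendenceBasis k (fun i => g (MvPolynomial.X i)) := by
      rw [h1.isTranscendenceBasis_iff_isAlgebraic]
      have hr : (Algebra.adjoin k (Set.range fun i => g (MvPolynomial.X i))) = g.range := by
        rw [Algebra.adjoin_range_eq_range_aeval]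
        congr 1
        ext i; simp
      refine ⟨fun x => ?_⟩
      have hx : g.toRingHom.IsIntegralElem x := hint x
      obtain ⟨P, hP, hPx⟩ := hx
      apply IsIntegral.isAlgebraic
      let g' : MvPolynomial (Fin s) k →+*
          Algebra.adjoin k (Set.range fun i => g (MvPolynomial.X i)) :=
        (Subalgebra.inclusion hr.ge).toRingHom.comp g.rangeRestrict.toRingHom
      refine ⟨P.map g', hP.map _, ?_⟩
      rw [Polynomial.eval₂_map]
      exact hPx
    have h3 := h2.lift_cardinalMk_eq_trdeg
    simpa using h3.symm

/-! ### Kähler differentials and separable transcendence bases -/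

/-- The elements of a field killed by a derivation form a subfield. -/
theorem derivation_eq_zero_of_mem_adjoin {k L M : Type*} [Field k] [Field L] [Algebra k L]
    [AddCommGroup M] [Module L M] [Module k M] (D : Derivation k L M) {s : Set L}
    (h : ∀ x ∈ s, D x = 0) {x : L} (hx : x ∈ IntermediateField.adjoin k s) : D x = 0 := by
  induction hx using IntermediateField.adjoin_induction with
  | mem x hx => exact h x hx
  | algebraMap r => exact D.map_algebraMap r
  | add x y _ _ hx hy => rw [map_add, hx, hy, add_zero]
  | inv x _ hx => rw [D.leibniz_inv, hx, smul_zero]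
  | mul x y _ _ hx hy => rw [D.leibniz, hx, hy, smul_zero, smul_zero, add_zero]

open KaehlerDifferential in
theorem subsingleton_kaehler_of_forall_D_eq_zero {k L : Type*} [CommRing k] [CommRing L]
    [Algebra k L] (h : ∀ x : L, D k L x = 0) : Subsingleton (Ω[L⁄k]) := by
  have h1 := span_range_derivation k L
  have h2 : Set.range (D k L) ⊆ {0} := by
    rintro _ ⟨x, rfl⟩; exact h x
  have h3 : (⊤ : Submodule L (Ω[L⁄k])) ≤ ⊥ := by
    rw [← h1, ← Submodule.span_singleton_eq_bot.2 (rfl : (0 : Ω[L⁄k]) = 0)]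
    exact Submodule.span_mono h2
  exact (Submodule.subsingleton_iff L).1 (subsingleton_of_bot_eq_top (le_bot_iff.1 h3).symm)

open KaehlerDifferential in
/-- A finitely generated field extension is separable algebraic over the subfield generated by a
set exactly when the differentials of this set span the module of Kähler differentials. -/
theorem isSeparable_adjoin_iff_span_D_eq_top {k L : Type u} [Field k] [Field L] [Algebra k L]
    [Algebra.EssFiniteType k L] (s : Set L) :
    Algebra.IsSeparable (IntermediateField.adjoin k s) L ↔
      Submodule.span L (D k L '' s) = ⊤ := by
  have : Algebra.EssFiniteType (IntermediateField.adjoin k s) L :=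
    Algebra.EssFiniteType.of_comp k _ L
  rw [← Algebra.FormallyUnramified.iff_isSeparable]
  constructor
  · intro hu
    -- the universal derivation modulo the span of the differentials of `s` vanishes on the subfield,
    -- so it is linear over it, and zero as the extension is unramified
    let M := (Ω[L⁄k]) ⧸ Submodule.span L (D k L '' s)
    let δ : Derivation k L M := (Submodule.mkQ (Submodule.span L (D k L '' s))).compDer (D k L)
    have hδs : ∀ x ∈ IntermediateField.adjoin k s, δ x = 0 := fun x hx =>
      derivation_eq_zero_of_mem_adjoin δ (fun x hx => by
        change Submodule.mkQ _ (D k L x) = 0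
        rw [Submodule.mkQ_apply, Submodule.Quotient.mk_eq_zero]
        exact Submodule.subset_span ⟨x, hx, rfl⟩) hx
    let δ' : Derivation (IntermediateField.adjoin k s) L M :=
      { toFun := δ
        map_add' := map_add δ
        map_smul' := fun c x => by
          rw [Algebra.smul_def, RingHom.id_apply, δ.leibniz]
          rw [show δ (algebraMap _ L c) = 0 from hδs _ c.2, smul_zero, add_zero]
          rfl
        map_one_eq_zero' := δ.map_one_eq_zero
        leibniz' := δ.leibniz }
    have h0 : ∀ x, δ x = 0 := by
      intro x
      have h1 : δ' x = 0 := by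
        rw [← δ'.liftKaehlerDifferential_comp_D x, Subsingleton.elim (D _ L x) 0, map_zero]
      exact h1
    rw [eq_top_iff, ← span_range_derivation k L, Submodule.span_le]
    rintro _ ⟨x, rfl⟩
    have := h0 x
    change Submodule.mkQ _ (D k L x) = 0 at this
    rwa [Submodule.mkQ_apply, Submodule.Quotient.mk_eq_zero] at this
  · intro hs
    refine ⟨?_⟩
    apply subsingleton_kaehler_of_forall_D_eq_zero
    intro x
    have h1 : D k L x ∈ Submodule.span L (D k L '' s) := hs ▸ Submodule.mem_top
    have h2 : Submodule.span L (D k L '' s) ≤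
        LinearMap.ker (KaehlerDifferential.map k (IntermediateField.adjoin k s) L L) := by
      rw [Submodule.span_le]
      rintro _ ⟨y, hy, rfl⟩
      rw [SetLike.mem_coe, LinearMap.mem_ker, KaehlerDifferential.map_D]
      exact (D (IntermediateField.adjoin k s) L).map_algebraMap
        (⟨y, IntermediateField.subset_adjoin _ _ hy⟩ : IntermediateField.adjoin k s)
    have h3 := h2 h1
    rwa [LinearMap.mem_ker, KaehlerDifferential.map_D] at h3

open KaehlerDifferential

/-- If the differentials of the elements of `s` span, then `L` is algebraic over `k(s)`. -/
theorem trdeg_le_card_of_span_D_eq_top {k L : Type u} [Field k] [Field L] [Algebra k L]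
    [Algebra.EssFiniteType k L] (s : Set L) (h : Submodule.span L (D k L '' s) = ⊤) :
    Algebra.trdeg k L ≤ Cardinal.mk s := by
  have h1 := (isSeparable_adjoin_iff_span_D_eq_top (k := k) s).2 h
  have h2 : Algebra.IsAlgebraic (Algebra.adjoin k s) L := by
    rw [← IntermediateField.isAlgebraic_adjoin_iff_top]
    infer_instance
  exact Algebra.IsAlgebraic.trdeg_le_cardinalMk k s

/-- Over a perfect field, the rank of the module of Kähler differentials of a finitely generated
extension is its transcendence degree. -/
theorem finrank_kaehler_eq_trdeg {k L : Type u} [Field k] [PerfectField k] [Field L] [Algebra k L]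
    [Algebra.EssFiniteType k L] {n : ℕ} (hn : Algebra.trdeg k L = n) :
    Module.Finite L (Ω[L⁄k]) ∧ Module.finrank L (Ω[L⁄k]) = n := by
  classical
  obtain ⟨s, hs, hsep⟩ := exists_isTranscendenceBasis_and_isSeparable_of_perfectField k L
  have hspan := (isSeparable_adjoin_iff_span_D_eq_top (k := k) (s : Set L)).1 hsep
  have hcard : s.card = n := by
    have := hs.cardinalMk_eq_trdeg
    rw [hn] at this
    simpa using this
  have hfin : Module.Finite L (Ω[L⁄k]) := by
    refine ⟨⟨s.image (D k L), ?_⟩⟩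
    rw [Finset.coe_image, hspan]
  refine ⟨hfin, le_antisymm ?_ ?_⟩
  · have h1 := finrank_span_finset_le_card (R := L) (s.image (D k L))
    rw [Set.finrank, Finset.coe_image, hspan, finrank_top] at h1
    exact (h1.trans Finset.card_image_le).trans hcard.le
  · obtain ⟨b, hb, hbs, hbl⟩ := exists_linearIndependent L (Set.range (D k L))
    choose f hf using fun x : b => hb x.2
    have h2 : D k L '' Set.range f = b := by
      ext y
      constructor
      · rintro ⟨_, ⟨x, rfl⟩, rfl⟩; rw [hf]; exact x.2
      · intro hy; exact ⟨f ⟨y, hy⟩, ⟨_, rfl⟩, hf _⟩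
    have h3 := trdeg_le_card_of_span_D_eq_top (k := k) (Set.range f)
      (by rw [h2, hbs, span_range_derivation])
    rw [hn] at h3
    have h4 := h3.trans Cardinal.mk_range_le
    have := hbl.setFinite
    have := this.fintype
    rw [Cardinal.mk_fintype, Nat.cast_le] at h4
    exact h4.trans hbl.fintype_card_le_finrank

/-- The largest perfect subfield: the elements that have a `p^m`-th root for all `m`. -/
def perfectCore (k L : Type*) [Field k] [Field L] [Algebra k L] (p : ℕ) [ExpChar k p]
    [ExpChar L p] [PerfectRing k p] : IntermediateField k L where
  carrier := {x | ∀ m, ∃ y, y ^ p ^ m = x}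
  mul_mem' := fun {a b} ha hb m => by
    obtain ⟨x, rfl⟩ := ha m
    obtain ⟨y, rfl⟩ := hb m
    exact ⟨x * y, mul_pow _ _ _⟩
  add_mem' := fun {a b} ha hb m => by
    obtain ⟨x, rfl⟩ := ha m
    obtain ⟨y, rfl⟩ := hb m
    exact ⟨x + y, add_pow_expChar_pow _ _ _ _⟩
  algebraMap_mem' := fun r m => by
    obtain ⟨x, hx⟩ := (bijective_iterateFrobenius k p m).2 r
    refine ⟨algebraMap k L x, ?_⟩
    rw [← map_pow, ← hx, iterateFrobenius_def]
  inv_mem' := fun x hx m => by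
    obtain ⟨y, rfl⟩ := hx m
    exact ⟨y⁻¹, inv_pow _ _⟩

theorem D_eq_zero_of_eq_pow {k L : Type*} [Field k] [Field L] [Algebra k L] (p : ℕ) [CharP L p]
    (x : L) : D k L (x ^ p) = 0 := by
  rw [Derivation.leibniz_pow, ← Nat.cast_smul_eq_nsmul L, CharP.cast_eq_zero, zero_smul]

/-- In a finitely generated extension of a perfect field, a transcendental element does not have
`p^m`-th roots for all `m`. -/
theorem exists_pow_eq_of_transcendental {k L : Type u} [Field k] [Field L] [Algebra k L]
    [Algebra.EssFiniteType k L] (p : ℕ) [Fact p.Prime] [CharP k p] [PerfectRing k p]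
    {n : ℕ} (hn : Algebra.trdeg k L = n) {g : L} (hg : Transcendental k g) :
    ∃ (u : L) (m : ℕ), u ^ p ^ m = g ∧ ∀ v : L, v ^ p ≠ u := by
  have hcharL : CharP L p := charP_of_injective_algebraMap (algebraMap k L).injective p
  have hE : ExpChar L p := ExpChar.prime Fact.out
  let C := perfectCore k L p
  have hcharC : CharP C p := charP_of_injective_algebraMap (algebraMap k C).injective p
  have hEC : ExpChar C p := ExpChar.prime Fact.out
  have hpow : ∀ x : C, ∃ y : C, y ^ p = x := by
    intro x
    obtain ⟨y, hy⟩ := x.2 1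
    rw [pow_one] at hy
    refine ⟨⟨y, fun m => ?_⟩, Subtype.ext hy⟩
    obtain ⟨z, hz⟩ := x.2 (m + 1)
    refine ⟨z, ?_⟩
    rw [pow_succ, pow_mul, ← hy] at hz
    exact frobenius_inj L p hz
  have hperf : PerfectRing C p := by
    refine ⟨⟨frobenius_inj C p, fun x => ?_⟩⟩
    obtain ⟨y, hy⟩ := hpow x
    exact ⟨y, hy⟩
  have hPF : PerfectField C := PerfectRing.toPerfectField C p
  -- elements of `C` are `p`-th powers, so the differentials over `k` are already spanned by those of
  -- a separating transcendence basis of `L` over `C`; comparison of transcendence degrees shows that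
  -- `C` is algebraic over `k`
  have hkey : Algebra.IsAlgebraic k C := by
    have : Algebra.EssFiniteType C L := Algebra.EssFiniteType.of_comp k C L
    obtain ⟨s, hs, hsep⟩ := exists_isTranscendenceBasis_and_isSeparable_of_perfectField C L
    have hsep' : Algebra.IsSeparable (IntermediateField.adjoin k ((C : Set L) ∪ (s : Set L))) L := by
      have h1 : (IntermediateField.adjoin C (s : Set L)).restrictScalars k =
          IntermediateField.adjoin k ((C : Set L) ∪ (s : Set L)) :=
        IntermediateField.restrictScalars_adjoin k C _
      rw [← h1]
      exact hsep
    have h2 := (isSeparable_adjoin_iff_span_D_eq_top (k := k) _).1 hsep'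
    have h3 : Submodule.span L (D k L '' (s : Set L)) = ⊤ := by
      rw [eq_top_iff, ← h2, Submodule.span_le]
      rintro _ ⟨x, hx | hx, rfl⟩
      · obtain ⟨y, hy⟩ := hpow ⟨x, hx⟩
        have : x = (y : L) ^ p := (congrArg Subtype.val hy).symm
        rw [this, D_eq_zero_of_eq_pow p]
        exact zero_mem _
      · exact Submodule.subset_span ⟨x, hx, rfl⟩
    have h4 := trdeg_le_card_of_span_D_eq_top (k := k) _ h3
    have h5 := hs.cardinalMk_eq_trdeg
    have h6 := _root_.trdeg_add_eq k C (A := L)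
    have h7 : Cardinal.mk (s : Set L) = (s.card : Cardinal) := by simp
    have h8 : Algebra.trdeg C L = s.card := by rw [← h5]; simp
    rw [h8] at h6
    rw [hn, h7] at h4
    rw [hn] at h6
    rw [← trdeg_eq_zero_iff]
    obtain ⟨c, hc⟩ := Cardinal.lt_aleph0.1 ((self_le_add_right _ _).trans_eq h6 |>.trans_lt
      (Cardinal.natCast_lt_aleph0 (n := n)) : Algebra.trdeg k C < Cardinal.aleph0)
    rw [hc] at h6 ⊢
    norm_cast at h6 h4 ⊢
    omega
  have hgC : ¬ ∀ m, ∃ y, y ^ p ^ m = g := fun h => hg <| by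
    have : IsAlgebraic k (⟨g, h⟩ : C) := Algebra.IsAlgebraic.isAlgebraic _
    exact this.algebraMap (A := L)
  -- `u` is the last in a chain of iterated `p`-th roots of `g`
  classical
  push Not at hgC
  obtain ⟨m, hm⟩ : ∃ m, Nat.find hgC = m + 1 := by
    refine Nat.exists_eq_succ_of_ne_zero fun h0 => ?_
    have := Nat.find_spec hgC
    rw [h0] at this
    exact this g (by simp)
  have h1 := Nat.find_min hgC (m := m) (by omega)
  push Not at h1
  obtain ⟨u, hu⟩ := h1
  refine ⟨u, m, hu, fun v hv => ?_⟩
  have h2 := Nat.find_spec hgC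
  rw [hm] at h2
  refine h2 v ?_
  rw [pow_succ', pow_mul, hv, hu]

/-- A separable element that has a `p`-th power in the base field belongs to it. -/
theorem mem_of_pow_mem_of_isSeparable {k L : Type*} [Field k] [Field L] [Algebra k L] (p : ℕ)
    [ExpChar k p] (K : IntermediateField k L) [Algebra.IsSeparable K L] {x : L} {m : ℕ}
    (h : x ^ p ^ m ∈ K) : x ∈ K := by
  have : ExpChar K p := expChar_of_injective_algebraMap (algebraMap k K).injective p
  have h1 : x ∈ perfectClosure K L := (mem_perfectClosure_iff_pow_mem p).2 ⟨m, ⟨_, h⟩, rfl⟩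
  rw [perfectClosure.eq_bot_of_isSeparable, IntermediateField.mem_bot] at h1
  obtain ⟨y, rfl⟩ := h1
  exact y.2

/-- An element that is not a `p`-th power has nonzero differential. -/
theorem D_ne_zero_of_forall_pow_ne {k L : Type u} [Field k] [Field L] [Algebra k L]
    [Algebra.EssFiniteType k L] (p : ℕ) [Fact p.Prime] [CharP k p] [PerfectRing k p]
    {u : L} (hu : ∀ v : L, v ^ p ≠ u) : D k L u ≠ 0 := by
  have hcharL : CharP L p := charP_of_injective_algebraMap (algebraMap k L).injective p
  have hE : ExpChar L p := ExpChar.prime Fact.out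
  intro h0
  -- a maximal subfield that contains all `p`-th powers, but not `u`
  let S : Set (IntermediateField k L) := {K | (∀ x : L, x ^ p ∈ K) ∧ u ∉ K}
  let K₀ : IntermediateField k L :=
    { carrier := Set.range fun x : L => x ^ p
      mul_mem' := by
        rintro _ _ ⟨x, rfl⟩ ⟨y, rfl⟩
        exact ⟨x * y, mul_pow _ _ _⟩
      add_mem' := by
        rintro _ _ ⟨x, rfl⟩ ⟨y, rfl⟩
        exact ⟨x + y, add_pow_char _ _ _⟩
      algebraMap_mem' := fun r => by
        obtain ⟨x, hx⟩ := surjective_frobenius k p r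
        refine ⟨algebraMap k L x, ?_⟩
        rw [← hx, frobenius_def, map_pow]
      inv_mem' := by
        rintro _ ⟨x, rfl⟩
        exact ⟨x⁻¹, inv_pow _ _⟩ }
  have hK₀ : K₀ ∈ S := ⟨fun x => ⟨x, rfl⟩, fun ⟨v, hv⟩ => hu v hv⟩
  obtain ⟨K, -, hKmax⟩ := zorn_le_nonempty₀ S (fun c hcS hc K hK => by
    have : Nonempty c := ⟨⟨K, hK⟩⟩
    have hdir : Directed (· ≤ ·) (Subtype.val : c → IntermediateField k L) :=
      hc.directedOn.directed_val
    refine ⟨sSup c, ⟨fun x => (le_sSup hK : K ≤ sSup c) ((hcS hK).1 x), fun hmem => ?_⟩,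
      fun K' hK' => le_sSup hK'⟩
    rw [sSup_eq_iSup', ← SetLike.mem_coe, IntermediateField.coe_iSup_of_directed hdir] at hmem
    obtain ⟨K', hu'⟩ := Set.mem_iUnion.1 hmem
    exact (hcS K'.2).2 hu') K₀ hK₀
  have hKp := hKmax.prop.1
  have huK := hKmax.prop.2
  -- by maximality of `K`, the elements outside of `K` all generate the same extension, of degree `p`
  have hfin : ∀ y : L, y ∉ K → Module.finrank K (IntermediateField.adjoin K {y}) = p := by
    intro y hy
    have hirr : Irreducible (Polynomial.X ^ p - Polynomial.C (⟨y ^ p, hKp y⟩ : K)) := by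
      refine X_pow_sub_C_irreducible_of_prime Fact.out fun b hb => hy ?_
      have h1 : (b : L) ^ p = y ^ p := congrArg Subtype.val hb
      rw [← frobenius_inj L p h1]
      exact b.2
    have hmonic := Polynomial.monic_X_pow_sub_C (⟨y ^ p, hKp y⟩ : K) (Fact.out : p.Prime).ne_zero
    have hroot : Polynomial.aeval y
        (Polynomial.X ^ p - Polynomial.C (⟨y ^ p, hKp y⟩ : K)) = 0 := by simp
    have hmin := minpoly.eq_of_irreducible_of_monic hirr hroot hmonic
    have hint : IsIntegral K y := ⟨_, hmonic, hroot⟩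
    rw [IntermediateField.adjoin.finrank hint, ← hmin, Polynomial.natDegree_X_pow_sub_C]
  have htop : IntermediateField.adjoin K {u} = ⊤ := by
    rw [eq_top_iff]
    intro y _
    by_cases hy : y ∈ K
    · exact (IntermediateField.adjoin K {u}).algebraMap_mem ⟨y, hy⟩
    · have hmem : u ∈ IntermediateField.adjoin K {y} := by
        by_contra hcon
        have h1 : (IntermediateField.adjoin K {y}).restrictScalars k ≤ K :=
          hKmax.le_of_ge ⟨fun x => (IntermediateField.adjoin K {y}).algebraMap_mem ⟨_, hKp x⟩, hcon⟩
            (fun x hx => (IntermediateField.adjoin K {y}).algebraMap_mem ⟨x, hx⟩)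
        exact hy (h1 (IntermediateField.mem_adjoin_simple_self K y))
      have hle : IntermediateField.adjoin K {u} ≤ IntermediateField.adjoin K {y} :=
        IntermediateField.adjoin_simple_le_iff.2 hmem
      have : FiniteDimensional K (IntermediateField.adjoin K {y}) :=
        FiniteDimensional.of_finrank_pos (by rw [hfin y hy]; exact (Fact.out : p.Prime).pos)
      have heq := IntermediateField.eq_of_le_of_finrank_eq hle
        (by rw [hfin y hy, hfin u huK])
      rw [heq]
      exact IntermediateField.mem_adjoin_simple_self K y
  have : Algebra.EssFiniteType K L := Algebra.EssFiniteType.of_comp k K L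
  -- if `D u = 0`, then `K(u) = L` is unramified, hence separable, over `K`; but `u ^ p ∈ K`
  have hsep : Algebra.IsSeparable K L := by
    rw [← Algebra.FormallyUnramified.iff_isSeparable]
    refine ⟨subsingleton_kaehler_of_forall_D_eq_zero fun x => ?_⟩
    refine derivation_eq_zero_of_mem_adjoin (D K L) (s := {u}) ?_ (x := x)
      (by rw [htop]; exact IntermediateField.mem_top)
    intro y hy
    have h1 := KaehlerDifferential.map_D k K L L u
    rw [h0, map_zero] at h1
    rw [Set.mem_singleton_iff.1 hy]
    exact h1.symm
  exact huK (mem_of_pow_mem_of_isSeparable p K (m := 1) (by rw [pow_one]; exact hKp u))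

/-! ### Choice of generic coordinates -/

/-- Vectors `v i` can be corrected by members of a family `w` so as to become a basis, as soon as
the `v i` and the `w j` together span. -/
theorem exists_linearIndependent_add {K V ι J : Type*} [Field K] [AddCommGroup V] [Module K V]
    [Fintype ι] (v : ι → V) (w : J → V) (hspan : Submodule.span K (Set.range v ∪ Set.range w) = ⊤)
    (hcard : Module.finrank K V = Fintype.card ι) :
    ∃ b : ι → Option J, LinearIndependent K fun i => v i + (b i).elim 0 w := by
  classical
  -- the vectors are corrected one after the other, without changing the span together with `w`
  have key : ∀ S : Finset ι, ∃ b : ι → Option J, (∀ i ∉ S, b i = none) ∧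
      LinearIndepOn K (fun i => v i + (b i).elim 0 w) (S : Set ι) ∧
      Submodule.span K (Set.range (fun i => v i + (b i).elim 0 w) ∪ Set.range w) = ⊤ := by
    intro S
    induction S using Finset.induction_on with
    | empty => exact ⟨fun _ => none, fun _ _ => rfl, by simp, by simpa using hspan⟩
    | insert i S hi ih =>
      obtain ⟨b, hb, hli, hsp⟩ := ih
      set u : ι → V := fun i => v i + (b i).elim 0 w with hu
      -- otherwise the whole space would be spanned by the vectors with index other than `i`
      obtain ⟨o, ho⟩ : ∃ o : Option J, v i + o.elim 0 w ∉ Submodule.span K (u '' (S : Set ι)) := by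
        by_contra! hcon
        have hvi : v i ∈ Submodule.span K (u '' (S : Set ι)) := by simpa using hcon none
        have hw : ∀ j, w j ∈ Submodule.span K (u '' (S : Set ι)) := fun j => by
          simpa using sub_mem (hcon (some j)) hvi
        have h1 : (⊤ : Submodule K V) ≤ Submodule.span K
            (((Finset.univ.erase i).image u : Finset V) : Set V) := by
          rw [← hsp, Submodule.span_le]
          have hS : Submodule.span K (u '' (S : Set ι)) ≤ Submodule.span K
              (((Finset.univ.erase i).image u : Finset V) : Set V) := by
            refine Submodule.span_mono ?_
            rintro _ ⟨j, hj, rfl⟩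
            rw [Finset.mem_coe, Finset.mem_image]
            refine ⟨j, Finset.mem_erase.2 ⟨?_, Finset.mem_univ _⟩, rfl⟩
            rintro rfl; exact hi hj
          rintro _ (⟨j, rfl⟩ | ⟨j, rfl⟩)
          · by_cases hj : j = i
            · subst hj
              have : u j = v j := by simp [hu, hb j hi]
              change u j ∈ _
              rw [this]
              exact hS hvi
            · refine Submodule.subset_span ?_
              rw [Finset.mem_coe, Finset.mem_image]
              exact ⟨j, Finset.mem_erase.2 ⟨hj, Finset.mem_univ _⟩, rfl⟩
          · exact hS (hw j)
        have h2 := finrank_span_finset_le_card (R := K) ((Finset.univ.erase i).image u)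
        rw [Set.finrank, top_le_iff.1 h1, finrank_top, hcard] at h2
        have h3 := h2.trans Finset.card_image_le
        rw [Finset.card_erase_of_mem (Finset.mem_univ i), Finset.card_univ] at h3
        have := Fintype.card_pos_iff.2 ⟨i⟩
        omega
      refine ⟨Function.update b i o, ?_, ?_, ?_⟩
      · intro j hj
        rw [Finset.mem_insert, not_or] at hj
        rw [Function.update_of_ne hj.1]
        exact hb j hj.2
      · have heq : Set.EqOn (fun j => v j + (Function.update b i o j).elim 0 w) u (S : Set ι) := by
          intro j hj
          have : j ≠ i := by rintro rfl; exact hi hj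
          simp [hu, Function.update_of_ne this]
        rw [Finset.coe_insert, linearIndepOn_insert (by simpa using hi)]
        refine ⟨(linearIndepOn_congr heq).2 hli, ?_⟩
        rw [heq.image_eq]
        simpa using ho
      · rw [eq_top_iff, ← hsp, Submodule.span_le]
        rintro _ (⟨j, rfl⟩ | ⟨j, rfl⟩)
        · by_cases hj : j = i
          · subst hj
            have h1 : v j + (o.elim 0 w) ∈ Submodule.span K
                (Set.range (fun i => v i + (Function.update b j o i).elim 0 w) ∪ Set.range w) :=
              Submodule.subset_span (Or.inl ⟨j, by simp⟩)
            have h2 : o.elim 0 w ∈ Submodule.span K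
                (Set.range (fun i => v i + (Function.update b j o i).elim 0 w) ∪ Set.range w) := by
              cases o with
              | none => exact zero_mem _
              | some j' => exact Submodule.subset_span (Or.inr ⟨j', rfl⟩)
            simpa [hu, hb j hi] using sub_mem h1 h2
          · exact Submodule.subset_span (Or.inl ⟨j, by simp [hu, Function.update_of_ne hj]⟩)
        · exact Submodule.subset_span (Or.inr ⟨j, rfl⟩)
  obtain ⟨b, -, hb, -⟩ := key Finset.univ
  refine ⟨b, ?_⟩
  rw [Finset.coe_univ, linearIndepOn_univ_iff] at hb
  exact hb

/-- Linearly independent differentials, as many as the rank, span. -/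
theorem span_D_range_eq_top {k L ι : Type*} [Field k] [Field L] [Algebra k L] [Fintype ι]
    [Module.Finite L (Ω[L⁄k])] (hcard : Module.finrank L (Ω[L⁄k]) = Fintype.card ι) {a : ι → L}
    (ha : LinearIndependent L fun i => D k L (a i)) :
    Submodule.span L (D k L '' Set.range a) = ⊤ := by
  rw [← Set.range_comp]
  exact ha.span_eq_top_of_card_eq_finrank' hcard.symm

/-- A field extension is separable over every intermediate field that contains elements whose
differentials span. -/
theorem isSeparable_of_span_D_eq_top {k L : Type u} [Field k] [Field L] [Algebra k L]
    [Algebra.EssFiniteType k L] {s : Set L} (h : Submodule.span L (D k L '' s) = ⊤)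
    (K : IntermediateField k L) (hK : s ⊆ K) : Algebra.IsSeparable K L := by
  have h1 : Submodule.span L (D k L '' (K : Set L)) = ⊤ :=
    top_le_iff.1 (h ▸ Submodule.span_mono (Set.image_mono hK))
  have h2 := (isSeparable_adjoin_iff_span_D_eq_top (k := k) (K : Set L)).2 h1
  rwa [IntermediateField.adjoin_self] at h2

/-- Generic coordinates of the first kind: together with the `p`-th powers of the `γ j`, at least
one of which is transcendental, they generate the field. -/
theorem exists_coordinates_of_transcendental {k L : Type u} [Field k] [Field L] [Algebra k L]
    [Algebra.EssFiniteType k L] (p : ℕ) [Fact p.Prime] [CharP k p] [PerfectField k]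
    {n : ℕ} (hn : Algebra.trdeg k L = n) {J : Type*} (γ : J → L)
    (hγ : ∃ j, Transcendental k (γ j)) :
    ∃ a : Fin n → L, LinearIndependent L (fun i => D k L (a i)) ∧
      ∀ K : IntermediateField k L, (∀ i, a i ∈ K) → (∀ j, γ j ^ p ∈ K) → K = ⊤ := by
  classical
  have : ExpChar k p := ExpChar.prime Fact.out
  obtain ⟨hfin, hrank⟩ := finrank_kaehler_eq_trdeg hn
  obtain ⟨j, hj⟩ := hγ
  obtain ⟨u, m, hum, hu⟩ := exists_pow_eq_of_transcendental p hn hj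
  have hdu := D_ne_zero_of_forall_pow_ne p hu (k := k)
  -- a basis of differentials of functions `t x` that contains the differential of `u = t x₀`
  obtain ⟨b, hbD, hub, hbspan, hbli⟩ := exists_linearIndepOn_id_extension
    (K := L) (s := {D k L u}) (t := Set.range (D k L))
    (LinearIndepOn.singleton (v := id) hdu) (by simp)
  have hbtop : Submodule.span L b = ⊤ := by
    rw [eq_top_iff, ← span_range_derivation k L]
    exact Submodule.span_le.2 hbspan
  have hbfin : Finite b := hbli.setFinite
  have := Fintype.ofFinite b
  have hub' : D k L u ∈ b := hub rfl
  let B : Module.Basis b L (Ω[L⁄k]) := Module.Basis.mk (v := Subtype.val) hbli (by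
    rw [Subtype.range_coe, hbtop])
  have hB : ∀ x : b, B x = x := fun x => Module.Basis.mk_apply _ _ x
  have hcard : Fintype.card b = n := by rw [← hrank, Module.finrank_eq_card_basis B]
  let x₀ : b := ⟨D k L u, hub'⟩
  obtain ⟨t, ht, htu⟩ : ∃ t : b → L, (∀ x, D k L (t x) = x) ∧ t x₀ = u := by
    choose f hf using fun x : b => hbD x.2
    refine ⟨Function.update f x₀ u, fun x => ?_, by simp⟩
    by_cases hx : x = x₀
    · subst hx; simp [x₀]
    · rw [Function.update_of_ne hx, hf]
  have htspan : Submodule.span L (D k L '' Set.range t) = ⊤ := by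
    rw [← Set.range_comp, ← hbtop]
    congr 1
    ext y
    constructor
    · rintro ⟨x, rfl⟩; simp [ht]
    · intro hy; exact ⟨⟨y, hy⟩, ht _⟩
  let E := IntermediateField.adjoin k (Set.range t)
  have hEsep : Algebra.IsSeparable E L := (isSeparable_adjoin_iff_span_D_eq_top _).2 htspan
  have hEess : Algebra.EssFiniteType E L := Algebra.EssFiniteType.of_comp k E L
  have hEunr : Algebra.FormallyUnramified E L :=
    (Algebra.FormallyUnramified.iff_isSeparable E L).2 hEsep
  have hEfin : Module.Finite E L := Algebra.FormallyUnramified.finite_of_free E L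
  obtain ⟨w', hw'⟩ := Field.exists_primitive_element E L
  -- one of `w'` and `w' + u` can replace `u` in the basis of differentials
  obtain ⟨w, hw, hwB⟩ : ∃ w : L, (w = w' ∨ w = w' + u) ∧ B.repr (D k L w) x₀ ≠ 0 := by
    by_cases h0 : B.repr (D k L w') x₀ = 0
    · refine ⟨w' + u, Or.inr rfl, ?_⟩
      have h1 : D k L u = B x₀ := (hB x₀).symm
      rw [map_add, map_add, Finsupp.add_apply, h0, h1, B.repr_self]
      simp
    · exact ⟨w', Or.inl rfl, h0⟩
  let a : b → L := Function.update t x₀ w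
  have ha₀ : a x₀ = w := Function.update_self _ _ _
  have ha : ∀ x, x ≠ x₀ → a x = t x := fun x hx => Function.update_of_ne hx _ _
  have haspan : ⊤ ≤ Submodule.span L (Set.range fun x => D k L (a x)) := by
    set W := Submodule.span L (Set.range fun x => D k L (a x)) with hW
    have hmem : ∀ x, x ≠ x₀ → B x ∈ W := fun x hx =>
      Submodule.subset_span ⟨x, by simp only []; rw [ha x hx, ht, hB]⟩
    have h0 : B x₀ ∈ W := by
      have h1 : D k L w ∈ W := Submodule.subset_span ⟨x₀, by simp only []; rw [ha₀]⟩
      rw [← B.sum_repr (D k L w), ← Finset.add_sum_erase _ _ (Finset.mem_univ x₀)] at h1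
      have h2 := (Submodule.add_mem_iff_left W (sum_mem fun x hx =>
        W.smul_mem _ (hmem x (Finset.ne_of_mem_erase hx)))).1 h1
      exact (Submodule.smul_mem_iff W hwB).1 h2
    rw [← B.span_eq, Submodule.span_le]
    rintro _ ⟨x, rfl⟩
    by_cases hx : x = x₀
    · rw [hx]; exact h0
    · exact hmem x hx
  have hali : LinearIndependent L fun x => D k L (a x) :=
    linearIndependent_of_top_le_span_of_card_eq_finrank haspan (by rw [hcard, hrank])
  let e : Fin n ≃ b := (Fintype.equivFinOfCardEq hcard).symm
  refine ⟨a ∘ e, hali.comp e e.injective, fun K hK hγK => ?_⟩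
  have hK' : ∀ x, a x ∈ K := fun x => by simpa using hK (e.symm x)
  -- `u` is an iterated `p`-th root of the element `γ j ^ p` of `K`, and `L` is separable over `K`
  have hsep : Algebra.IsSeparable K L := isSeparable_of_span_D_eq_top
    (s := Set.range a) (by rw [← Set.range_comp]; exact top_le_iff.1 haspan) K
    (by rintro _ ⟨x, rfl⟩; exact hK' x)
  have huK : u ∈ K := mem_of_pow_mem_of_isSeparable p K (m := m + 1) (by
    rw [pow_succ, pow_mul, hum]; exact hγK j)
  have hwK : w' ∈ K := by
    have h1 : w ∈ K := ha₀ ▸ hK' x₀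
    rcases hw with rfl | rfl
    · exact h1
    · simpa using sub_mem h1 huK
  have hEK : E ≤ K := IntermediateField.adjoin_le_iff.2 (by
    rintro _ ⟨x, rfl⟩
    by_cases hx : x = x₀
    · rw [hx, htu]; exact huK
    · rw [← ha x hx]; exact hK' x)
  have h1 : (IntermediateField.adjoin E {w'}).restrictScalars k ≤ K := by
    rw [IntermediateField.restrictScalars_adjoin, IntermediateField.adjoin_le_iff]
    rintro x (hx | hx)
    · exact hEK hx
    · rw [Set.mem_singleton_iff.1 hx]; exact hwK
  rw [hw', IntermediateField.restrictScalars_top] at h1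
  exact top_le_iff.1 h1

/-- Generic coordinates of the second kind: given elements `s i`, to each of which at most one of
the `γ j` is added. -/
theorem exists_coordinates_add {k L : Type u} [Field k] [Field L] [Algebra k L]
    [Algebra.EssFiniteType k L] (p : ℕ) [Fact p.Prime] [CharP k p] [PerfectField k]
    {n : ℕ} (hn : Algebra.trdeg k L = n) {J : Type*} (γ : J → L) (s : Fin n → L)
    (hgen : IntermediateField.adjoin k (Set.range s ∪ Set.range γ) = ⊤) :
    ∃ b : Fin n → Option J, LinearIndependent L (fun i => D k L (s i + (b i).elim 0 γ)) ∧
      ∀ K : IntermediateField k L, (∀ i, s i + (b i).elim 0 γ ∈ K) →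
        (∀ j, γ j ^ p ∈ K) → K = ⊤ := by
  have : ExpChar k p := ExpChar.prime Fact.out
  have : CharP L p := charP_of_injective_algebraMap (algebraMap k L).injective p
  have : ExpChar L p := ExpChar.prime Fact.out
  obtain ⟨hfin, hrank⟩ := finrank_kaehler_eq_trdeg hn
  have hspan : Submodule.span L (Set.range (fun i => D k L (s i)) ∪
      Set.range (fun j => D k L (γ j))) = ⊤ := by
    have h1 := (isSeparable_adjoin_iff_span_D_eq_top (k := k)
      (Set.range s ∪ Set.range γ)).1 (by
        rw [hgen]
        exact ⟨fun x => isSeparable_algebraMap (K := L) (⟨x, trivial⟩ : (⊤ : IntermediateField k L))⟩)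
    rwa [Set.image_union, ← Set.range_comp, ← Set.range_comp] at h1
  obtain ⟨b, hb⟩ := exists_linearIndependent_add _ _ hspan (by rw [hrank, Fintype.card_fin])
  have hD : (fun i => D k L (s i + (b i).elim 0 γ)) =
      fun i => D k L (s i) + (b i).elim 0 (fun j => D k L (γ j)) := by
    ext i
    rw [map_add]
    cases b i <;> simp
  rw [← hD] at hb
  refine ⟨b, hb, fun K hs hγ => ?_⟩
  have hsep : Algebra.IsSeparable K L := isSeparable_of_span_D_eq_top
    (span_D_range_eq_top (by rw [hrank, Fintype.card_fin]) hb) K (by rintro _ ⟨i, rfl⟩; exact hs i)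
  rw [eq_top_iff, ← hgen, IntermediateField.adjoin_le_iff]
  have hγ' : ∀ j, γ j ∈ K := fun j =>
    mem_of_pow_mem_of_isSeparable p K (m := 1) (by rw [pow_one]; exact hγ j)
  rintro _ (⟨i, rfl⟩ | ⟨j, rfl⟩)
  · have h1 : (b i).elim 0 γ ∈ K := by
      cases b i with
      | none => exact zero_mem _
      | some j => exact hγ' j
    simpa using sub_mem (hs i) h1
  · exact hγ' j

/-! ### Clearing denominators -/

/-- Finitely many elements of the field generated by `z '' S` are fractions with a common
denominator of polynomials in the variables in `S`. -/
theorem exists_common_denominator {k L τ κ : Type*} [Field k] [Field L] [Algebra k L] [Fintype κ]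
    (z : τ → L) (S : Set τ) (e : κ → L)
    (he : ∀ i, e i ∈ IntermediateField.adjoin k (z '' S)) :
    ∃ v ∈ MvPolynomial.supported k S, MvPolynomial.aeval z v ≠ 0 ∧ ∀ i,
      ∃ q ∈ MvPolynomial.supported k S, MvPolynomial.aeval z q = MvPolynomial.aeval z v * e i := by
  classical
  have hmap : ∀ x ∈ Algebra.adjoin k (z '' S), ∃ q ∈ MvPolynomial.supported k S,
      MvPolynomial.aeval z q = x := by
    intro x hx
    have h1 : Algebra.adjoin k (z '' S) =
        (MvPolynomial.supported k S).map (MvPolynomial.aeval z) := by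
      rw [MvPolynomial.supported, AlgHom.map_adjoin, ← Set.image_comp]
      congr 1
      refine Set.image_congr fun i _ => ?_
      simp
    rw [h1] at hx
    exact hx
  have hfrac : ∀ i, ∃ q ∈ MvPolynomial.supported k S, ∃ w ∈ MvPolynomial.supported k S,
      MvPolynomial.aeval z w ≠ 0 ∧ MvPolynomial.aeval z q = MvPolynomial.aeval z w * e i := by
    intro i
    obtain ⟨x, hx, y, hy, hxy⟩ := IntermediateField.mem_adjoin_iff_div.1 (he i)
    obtain ⟨q, hq, rfl⟩ := hmap x hx
    obtain ⟨w, hw, rfl⟩ := hmap y hy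
    by_cases h0 : MvPolynomial.aeval z w = 0
    -- the quotient is zero by convention if its denominator vanishes
    · refine ⟨0, zero_mem _, 1, one_mem _, by simp, ?_⟩
      rw [hxy, h0, div_zero, mul_zero, map_zero]
    · exact ⟨q, hq, w, hw, h0, by rw [hxy]; field_simp⟩
  choose q hq w hw hw0 hqw using hfrac
  refine ⟨∏ i, w i, prod_mem fun i _ => hw i, ?_, fun i => ?_⟩
  · rw [map_prod]; exact Finset.prod_ne_zero_iff.2 fun i _ => hw0 i
  · refine ⟨q i * ∏ j ∈ Finset.univ.erase i, w j,
      mul_mem (hq i) (prod_mem fun j _ => hw j), ?_⟩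
    rw [map_mul, hqw, ← Finset.mul_prod_erase _ _ (Finset.mem_univ i), map_mul]
    ring

theorem pderiv_eq_zero_of_mem_supported {k τ : Type*} [Field k] {S : Set τ}
    {q : MvPolynomial τ k} (hq : q ∈ MvPolynomial.supported k S) {j : τ} (hj : j ∉ S) :
    MvPolynomial.pderiv j q = 0 :=
  MvPolynomial.pderiv_eq_zero_of_notMem_vars fun h => hj (MvPolynomial.mem_supported.1 hq h)

/-- A separable relation for the coordinate `c` over the coordinates in `S`. -/
theorem exists_separable_relation {k L τ : Type*} [Field k] [Field L] [Algebra k L]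
    (z : τ → L) (S : Set τ) [Algebra.IsSeparable (IntermediateField.adjoin k (z '' S)) L]
    (c : τ) (hc : c ∉ S) :
    ∃ Q : MvPolynomial τ k, MvPolynomial.aeval z Q = 0 ∧
      MvPolynomial.aeval z (MvPolynomial.pderiv c Q) ≠ 0 ∧
      ∀ j ∉ S, j ≠ c → MvPolynomial.pderiv j Q = 0 := by
  classical
  let E := IntermediateField.adjoin k (z '' S)
  have hsep : IsSeparable E (z c) := Algebra.IsSeparable.isSeparable E (z c)
  let m := minpoly E (z c)
  -- the relation is the minimal polynomial of `z c` with cleared denominators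
  obtain ⟨v, hv, hv0, h⟩ := exists_common_denominator z S
    (fun i : Fin (m.natDegree + 1) => (m.coeff i : L)) (fun i => (m.coeff i).2)
  choose q hq hqv using h
  refine ⟨∑ i : Fin (m.natDegree + 1), q i * MvPolynomial.X c ^ (i : ℕ), ?_, ?_, ?_⟩
  · have h1 : Polynomial.aeval (z c) m = 0 := minpoly.aeval _ _
    rw [Polynomial.aeval_eq_sum_range, ← Fin.sum_univ_eq_sum_range
      (fun i => m.coeff i • z c ^ i)] at h1
    rw [map_sum, ← mul_zero (MvPolynomial.aeval z v), ← h1, Finset.mul_sum]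
    refine Finset.sum_congr rfl fun i _ => ?_
    rw [map_mul, hqv, map_pow, MvPolynomial.aeval_X, mul_assoc]
    rfl
  · have h1 : Polynomial.aeval (z c) (Polynomial.derivative m) ≠ 0 :=
      Polynomial.Separable.aeval_derivative_ne_zero hsep (minpoly.aeval _ _)
    have h2 : MvPolynomial.aeval z (MvPolynomial.pderiv c
        (∑ i : Fin (m.natDegree + 1), q i * MvPolynomial.X c ^ (i : ℕ))) =
        MvPolynomial.aeval z v * Polynomial.aeval (z c) (Polynomial.derivative m) := by
      conv_rhs => rw [m.as_sum_range_C_mul_X_pow, map_sum, map_sum,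
        ← Fin.sum_univ_eq_sum_range (fun i => Polynomial.aeval (z c)
          (Polynomial.derivative (Polynomial.C (m.coeff i) * Polynomial.X ^ i))), Finset.mul_sum]
      rw [map_sum, map_sum]
      refine Finset.sum_congr rfl fun i _ => ?_
      rw [Derivation.leibniz, pderiv_eq_zero_of_mem_supported (hq i) hc, smul_zero, add_zero,
        Derivation.leibniz_pow, MvPolynomial.pderiv_X_self, Polynomial.derivative_C_mul_X_pow]
      simp only [smul_eq_mul, mul_one, nsmul_eq_mul, map_mul, map_natCast, map_pow,
        MvPolynomial.aeval_X, Polynomial.aeval_C, Polynomial.aeval_X, hqv]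
      have : algebraMap E L (m.coeff i) = (m.coeff i : L) := rfl
      rw [this]
      ring
    rw [h2]
    exact mul_ne_zero hv0 h1
  · intro j hj hjc
    rw [map_sum]
    refine Finset.sum_eq_zero fun i _ => ?_
    rw [Derivation.leibniz, pderiv_eq_zero_of_mem_supported (hq i) hj, smul_zero, add_zero,
      Derivation.leibniz_pow, MvPolynomial.pderiv_X_of_ne hjc.symm, smul_zero, smul_zero, smul_zero]

/-! ### Generic nonzerodivisors -/

open MonomialOrder in
/-- Division by an ideal `J` of polynomials over a domain, after multiplication by the leading
coefficients `b` of finitely many elements: the remainder involves only monomials that are not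
leading monomials of `J`, and if the dividend has coefficients in an ideal `𝔪` then the multiple
of `b ^ m` subtracted lies in `𝔪 J`. -/
theorem exists_generic_division {B : Type*} [CommRing B] [IsDomain B] {r : ℕ}
    (J : Ideal (MvPolynomial (Fin r) B)) :
    ∃ b : B, b ≠ 0 ∧ ∀ (𝔪 : Ideal B) (P : MvPolynomial (Fin r) B), P ∈ 𝔪.map MvPolynomial.C →
      ∃ (m : ℕ) (s : MvPolynomial (Fin r) B),
        MvPolynomial.C b ^ m * P - s ∈ 𝔪.map MvPolynomial.C * J ∧ (s ∈ J → s = 0) := by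
  classical
  let o : MonomialOrder (Fin r) := MonomialOrder.lex
  -- by Dickson's lemma the set `S` of leading monomials of `J` has finitely many minimal elements
  let S : Set (Fin r →₀ ℕ) := {d | ∃ f ∈ J, f ≠ 0 ∧ o.degree f = d}
  let M : Set (Fin r →₀ ℕ) := {d | Minimal (· ∈ S) d}
  have hMfin : M.Finite := by
    have h1 : IsAntichain (· ≤ ·) M := setOfPred_minimal_antichain _
    exact h1.finite_of_partiallyWellOrderedOn (Set.isPWO_of_wellQuasiOrderedLE M)
  have hM : ∀ d ∈ M, ∃ f ∈ J, f ≠ 0 ∧ o.degree f = d := fun d hd => hd.prop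
  choose! F hFJ hF0 hFd using hM
  let b : B := ∏ d ∈ hMfin.toFinset, o.leadingCoeff (F d)
  have hb : b ≠ 0 := Finset.prod_ne_zero_iff.2 fun d hd =>
    o.leadingCoeff_ne_zero_iff.2 (hF0 d (hMfin.mem_toFinset.1 hd))
  refine ⟨b, hb, fun 𝔪 => ?_⟩
  -- induction on the degree of the dividend
  suffices H : ∀ (x : o.syn) (P : MvPolynomial (Fin r) B), o.toSyn (o.degree P) = x →
      P ∈ 𝔪.map MvPolynomial.C → ∃ (m : ℕ) (s : MvPolynomial (Fin r) B),
        MvPolynomial.C b ^ m * P - s ∈ 𝔪.map MvPolynomial.C * J ∧ ∀ d ∈ s.support, d ∉ S by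
    intro P hP
    obtain ⟨m, s, h1, h2⟩ := H _ P rfl hP
    refine ⟨m, s, h1, fun hs => ?_⟩
    by_contra hs0
    exact h2 _ (o.degree_mem_support hs0) ⟨s, hs, hs0, rfl⟩
  intro x
  induction x using WellFoundedLT.induction with
  | _ x ih =>
  intro P hPx hP
  by_cases hP0 : P = 0
  · exact ⟨0, 0, by simp [hP0], by simp⟩
  have hlc : o.leadingCoeff P ∈ 𝔪 := MvPolynomial.mem_map_C_iff.1 hP _
  -- a polynomial of degree at most that of `P` whose coefficient there vanishes
  have hlt : ∀ P' : MvPolynomial (Fin r) B, o.toSyn (o.degree P') ≤ x →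
      P'.coeff (o.degree P) = 0 → P' ≠ 0 → o.toSyn (o.degree P') < x := by
    intro P' h1 h2 h3
    refine lt_of_le_of_ne h1 fun h4 => ?_
    rw [← hPx] at h4
    have h5 := o.toSyn.injective h4
    rw [← h5] at h2
    exact (o.coeff_degree_ne_zero_iff.2 h3) h2
  have step : ∀ P' : MvPolynomial (Fin r) B, o.toSyn (o.degree P') ≤ x →
      P'.coeff (o.degree P) = 0 → P' ∈ 𝔪.map MvPolynomial.C →
      ∃ (m : ℕ) (s : MvPolynomial (Fin r) B),
        MvPolynomial.C b ^ m * P' - s ∈ 𝔪.map MvPolynomial.C * J ∧ ∀ d ∈ s.support, d ∉ S := by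
    intro P' h1 h2 h3
    by_cases h4 : P' = 0
    · exact ⟨0, 0, by simp [h4], by simp⟩
    · exact ih _ (hlt P' h1 h2 h4) P' rfl h3
  by_cases hd : o.degree P ∈ S
  · obtain ⟨d, hdle, hdM⟩ := exists_minimal_le_of_wellFoundedLT (· ∈ S) (o.degree P) hd
    have hdM' : d ∈ M := hdM
    obtain ⟨c, hc⟩ := Finset.dvd_prod_of_mem (fun d => o.leadingCoeff (F d))
      (hMfin.mem_toFinset.2 hdM')
    have hbc : b = o.leadingCoeff (F d) * c := hc
    -- the multiple of `F d` that has the same leading term as `b * P`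
    let T : MvPolynomial (Fin r) B :=
      MvPolynomial.monomial (o.degree P - d) (c * o.leadingCoeff P) * F d
    have hT𝔪 : MvPolynomial.monomial (o.degree P - d) (c * o.leadingCoeff P) ∈
        𝔪.map (MvPolynomial.C (σ := Fin r)) := by
      rw [MvPolynomial.mem_map_C_iff]
      intro e
      rw [MvPolynomial.coeff_monomial]
      split_ifs
      · exact 𝔪.mul_mem_left _ hlc
      · exact zero_mem _
    have hTJ : T ∈ 𝔪.map MvPolynomial.C * J := Ideal.mul_mem_mul hT𝔪 (hFJ d hdM')
    have hTdeg : o.toSyn (o.degree T) ≤ x := by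
      refine (o.degree_mul_le).trans ?_
      rw [hFd d hdM', map_add]
      refine (add_le_add_left (o.degree_monomial_le _) _).trans ?_
      rw [← map_add, tsub_add_cancel_of_le hdle, hPx]
    have hTcoeff : T.coeff (o.degree P) = b * o.leadingCoeff P := by
      have h1 : o.degree P = (o.degree P - d) + d := (tsub_add_cancel_of_le hdle).symm
      conv_lhs => rw [h1]
      rw [MvPolynomial.coeff_monomial_mul, hbc]
      have : (F d).coeff d = o.leadingCoeff (F d) := by
        rw [leadingCoeff, hFd d hdM']
      rw [this]; ring
    obtain ⟨m, s, h1, h2⟩ := step (MvPolynomial.C b * P - T) (by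
        refine o.degree_sub_le.trans (max_le ?_ hTdeg)
        refine (o.degree_mul_le).trans ?_
        rw [o.degree_C, zero_add, hPx]) (by
        rw [MvPolynomial.coeff_sub, hTcoeff, MvPolynomial.coeff_C_mul]
        exact sub_self _) (sub_mem (Ideal.mul_mem_left _ _ hP) (Ideal.mul_mem_right _ _ hT𝔪))
    refine ⟨m + 1, s, ?_, h2⟩
    have : MvPolynomial.C b ^ (m + 1) * P - s =
        (MvPolynomial.C b ^ m * (MvPolynomial.C b * P - T) - s) + MvPolynomial.C b ^ m * T := by
      ring
    rw [this]
    exact add_mem h1 (Ideal.mul_mem_left _ _ hTJ)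
  · obtain ⟨m, s, h1, h2⟩ := step (P - o.leadingTerm P) (by
        rw [← hPx]; exact o.degree_sub_leadingTerm_le P) (by
        rw [MvPolynomial.coeff_sub, leadingTerm, MvPolynomial.coeff_monomial, if_pos rfl]
        exact sub_self _) (sub_mem hP (by
        rw [MvPolynomial.mem_map_C_iff]
        intro e
        rw [leadingTerm, MvPolynomial.coeff_monomial]
        split_ifs
        · exact hlc
        · exact zero_mem _))
    refine ⟨m, s + MvPolynomial.C b ^ m * o.leadingTerm P, ?_, fun d hds => ?_⟩
    · have : MvPolynomial.C b ^ m * P - (s + MvPolynomial.C b ^ m * o.leadingTerm P) =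
          MvPolynomial.C b ^ m * (P - o.leadingTerm P) - s := by ring
      rwa [this]
    · rcases Finset.mem_union.1 (MvPolynomial.support_add hds) with h3 | h3
      · exact h2 d h3
      · rw [leadingTerm, ← map_pow, MvPolynomial.C_mul_monomial] at h3
        rw [Finset.mem_singleton.1 (MvPolynomial.support_monomial_subset h3)]
        exact hd

/-- An element that does not lie in a prime ideal `I` of a polynomial ring over a domain is a
nonzerodivisor modulo the reduction of `I` at every point outside some hypersurface. -/
theorem exists_generic_nonzerodivisor {B k : Type*} [CommRing B] [IsDomain B] [Field k] {r : ℕ}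
    (I : Ideal (MvPolynomial (Fin r) B)) [I.IsPrime] {h : MvPolynomial (Fin r) B} (hI : h ∉ I) :
    ∃ b : B, b ≠ 0 ∧ ∀ y : B →+* k, Function.Surjective y → y b ≠ 0 →
      ∀ f : MvPolynomial (Fin r) k, MvPolynomial.map y h * f ∈ I.map (MvPolynomial.map y) →
        f ∈ I.map (MvPolynomial.map y) := by
  obtain ⟨b, hb, hdiv⟩ := exists_generic_division (I ⊔ Ideal.span {h})
  refine ⟨b, hb, fun y hy hyb f hf => ?_⟩
  have hsurj : Function.Surjective (MvPolynomial.map (σ := Fin r) y) :=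
    MvPolynomial.map_surjective y hy
  obtain ⟨g, hg, hgf⟩ := (Ideal.mem_map_iff_of_surjective _ hsurj).1 hf
  obtain ⟨f₀, rfl⟩ := hsurj f
  have hker : ∀ q : MvPolynomial (Fin r) B,
      q ∈ (RingHom.ker y).map MvPolynomial.C ↔ MvPolynomial.map y q = 0 := by
    intro q
    rw [MvPolynomial.mem_map_C_iff, MvPolynomial.ext_iff]
    simp only [MvPolynomial.coeff_map, RingHom.mem_ker, MvPolynomial.coeff_zero]
  have hE : h * f₀ - g ∈ (RingHom.ker y).map MvPolynomial.C := by
    rw [hker, map_sub, map_mul, hgf, sub_self]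
  -- `h f₀ - g` has coefficients in the kernel of `y` and lies in `I + (h)`, so, up to a power of `b`,
  -- it lies in the product of `ker y` and `I + (h)`: it is `i + h q` with `i ∈ I` and `q` in `ker y`
  have hEJ : h * f₀ - g ∈ I ⊔ Ideal.span {h} :=
    sub_mem (Ideal.mul_mem_right _ _ (Ideal.mem_sup_right (Ideal.mem_span_singleton_self h)))
      (Ideal.mem_sup_left hg)
  obtain ⟨m, s, hs, hs0⟩ := hdiv _ _ hE
  have hsJ : s ∈ I ⊔ Ideal.span {h} := by
    have h0 : MvPolynomial.C b ^ m * (h * f₀ - g) - s ∈ I ⊔ Ideal.span {h} := by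
      have hle : (RingHom.ker y).map MvPolynomial.C * (I ⊔ Ideal.span {h}) ≤ I ⊔ Ideal.span {h} :=
        Ideal.mul_le_right
      exact hle hs
    rw [← sub_sub_cancel (MvPolynomial.C b ^ m * (h * f₀ - g)) s]
    exact sub_mem (Ideal.mul_mem_left _ _ hEJ) h0
  rw [hs0 hsJ, sub_zero, Ideal.mul_sup] at hs
  obtain ⟨i, hi, q, hq, hiq⟩ := Submodule.mem_sup.1 hs
  rw [mul_comm, Ideal.mem_span_singleton_mul] at hq
  obtain ⟨q, hq, rfl⟩ := hq
  -- as `I` is prime, `b ^ m f₀ - q` is in `I`, and reduction by `y` kills `q` and makes `b` invertible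
  have h1 : h * (MvPolynomial.C b ^ m * f₀ - q) ∈ I := by
    have : h * (MvPolynomial.C b ^ m * f₀ - q) = MvPolynomial.C b ^ m * g + i := by
      linear_combination -hiq
    rw [this]
    exact add_mem (Ideal.mul_mem_left _ _ hg) (Ideal.mul_le_right hi)
  have h2 := Ideal.mem_map_of_mem (MvPolynomial.map y)
    ((Ideal.IsPrime.mem_or_mem inferInstance h1).resolve_left hI)
  rw [map_sub, (hker q).1 hq, sub_zero, map_mul, map_pow, MvPolynomial.map_C, ← map_pow] at h2
  have h3 := Ideal.mul_mem_left _ (MvPolynomial.C ((y b ^ m)⁻¹)) h2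
  rwa [← mul_assoc, ← map_mul, inv_mul_cancel₀ (pow_ne_zero _ hyb), map_one, one_mul] at h3

open MvPolynomial Topology TopologicalSpace

/-! ### The Zariski topology on affine space -/

section AffineSpace

/-- Affine space with coordinates indexed by `σ`, with the Zariski topology. -/
abbrev AffSpace (k : Type*) (σ : Type*) : Type _ := σ → k

/-- The topology is induced from the prime spectrum of the polynomial ring. -/
instance AffSpace.topology {k σ : Type*} [Field k] : TopologicalSpace (AffSpace k σ) :=
  TopologicalSpace.induced (fun x : σ → k => pointToPoint (k := k) x) inferInstance

variable {k σ T : Type*} [Field k] [TopologicalSpace T]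

theorem AffSpace.isTopologicalBasis :
    IsTopologicalBasis {U : Set (AffSpace k σ) | ∃ P : MvPolynomial σ k,
      U = {x : σ → k | eval x P ≠ 0}} := by
  have h := (PrimeSpectrum.isTopologicalBasis_basic_opens
    (R := MvPolynomial σ k)).isInducing (f := fun x : AffSpace k σ => pointToPoint (k := k) x) ⟨rfl⟩
  convert h using 1
  ext U
  simp only [Set.mem_ofPred_eq, Set.mem_image, Set.mem_range, exists_exists_eq_and]
  refine exists_congr fun P => ?_
  rw [@eq_comm _ U]
  suffices h : {x : σ → k | eval x P ≠ 0} = (fun x : AffSpace k σ => pointToPoint (k := k) x) ⁻¹'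
      (PrimeSpectrum.basicOpen P : Set (PrimeSpectrum (MvPolynomial σ k))) by rw [h]
  ext x
  simp only [Set.mem_preimage, SetLike.mem_coe, PrimeSpectrum.mem_basicOpen, pointToPoint,
    mem_vanishingIdeal_singleton_iff]
  exact Iff.rfl

theorem AffSpace.isOpen_ne (P : MvPolynomial σ k) :
    IsOpen {x : AffSpace k σ | eval (x : σ → k) P ≠ 0} :=
  AffSpace.isTopologicalBasis.isOpen ⟨P, rfl⟩

theorem AffSpace.isClosed_eq (P : MvPolynomial σ k) :
    IsClosed {x : AffSpace k σ | eval (x : σ → k) P = 0} := by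
  rw [← isOpen_compl_iff]
  exact AffSpace.isOpen_ne P

theorem AffSpace.continuous_iff {f : T → AffSpace k σ} :
    Continuous f ↔ ∀ P : MvPolynomial σ k, IsOpen {t | eval (f t : σ → k) P ≠ 0} := by
  rw [AffSpace.isTopologicalBasis.continuous_iff]
  exact ⟨fun h P => h _ ⟨P, rfl⟩, by rintro h _ ⟨P, rfl⟩; exact h P⟩

theorem AffSpace.exists_eval_ne_zero {U : Set (AffSpace k σ)} (hU : IsOpen U) {x : AffSpace k σ}
    (hx : x ∈ U) : ∃ P : MvPolynomial σ k, eval (x : σ → k) P ≠ 0 ∧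
      ∀ y : AffSpace k σ, eval (y : σ → k) P ≠ 0 → y ∈ U := by
  obtain ⟨_, ⟨P, rfl⟩, hxP, hPU⟩ := AffSpace.isTopologicalBasis.exists_subset_of_mem_open hx hU
  exact ⟨P, hxP, fun y hy => hPU hy⟩

/-- Points of a closed set are detected by the polynomials that vanish on the set. -/
theorem AffSpace.mem_of_isClosed {Z : Set (AffSpace k σ)} (hZ : IsClosed Z) {x : AffSpace k σ}
    (h : ∀ P : MvPolynomial σ k, (∀ z ∈ Z, eval (z : σ → k) P = 0) → eval (x : σ → k) P = 0) :
    x ∈ Z := by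
  by_contra hx
  obtain ⟨P, hP, hPU⟩ := AffSpace.exists_eval_ne_zero hZ.isOpen_compl hx
  refine hP (h P fun z hz => ?_)
  by_contra h0
  exact hPU z h0 hz

theorem AffSpace.continuous_polynomial {τ : Type*} (g : τ → MvPolynomial σ k) :
    Continuous (fun x : AffSpace k σ => (fun i => eval (x : σ → k) (g i) : AffSpace k τ)) := by
  rw [AffSpace.continuous_iff]
  intro P
  have := AffSpace.isOpen_ne (bind₁ g P)
  convert this using 3 with x
  simp only [← coe_aeval_eq_eval, RingHom.coe_coe]
  rw [aeval_bind₁]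

/-! ### Generic points -/

/-- `ξ` is a generic point of the irreducible set parametrized by `κ`: the polynomials that vanish
at `ξ` are those that vanish at all the points `κ t`. -/
def IsGeneric {T L : Type*} [Field L] [Algebra k L] (κ : T → σ → k) (ξ : σ → L) : Prop :=
  ∀ P : MvPolynomial σ k, aeval ξ P = 0 ↔ ∀ t, eval (κ t) P = 0

theorem IsGeneric.exists_eval_ne_zero {T L : Type*} [Field L] [Algebra k L] {κ : T → σ → k}
    {ξ : σ → L} (h : IsGeneric κ ξ) {P : MvPolynomial σ k} (hP : aeval ξ P ≠ 0) :
    ∃ t, eval (κ t) P ≠ 0 := by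
  by_contra! hcon
  exact hP ((h P).2 hcon)

theorem isPrime_vanishingIdeal_range [IrreducibleSpace T] {κ : T → AffSpace k σ}
    (hκ : Continuous κ) : (vanishingIdeal k (Set.range κ : Set (σ → k))).IsPrime := by
  refine ⟨?_, fun {P Q} hPQ => ?_⟩
  · rw [Ne, Ideal.eq_top_iff_one]
    intro h
    obtain ⟨t⟩ := (inferInstance : Nonempty T)
    have := h (κ t) ⟨t, rfl⟩
    rw [map_one] at this
    exact one_ne_zero this
  · by_contra! hcon
    simp only [mem_vanishingIdeal_iff, Set.forall_mem_range, not_forall] at hcon hPQ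
    obtain ⟨⟨t, ht⟩, ⟨s, hs⟩⟩ := hcon
    obtain ⟨w, -, hw1, hw2⟩ := (PreirreducibleSpace.isPreirreducible_univ (X := T))
      _ _ ((AffSpace.isOpen_ne P).preimage hκ) ((AffSpace.isOpen_ne Q).preimage hκ)
      ⟨t, trivial, ht⟩ ⟨s, trivial, hs⟩
    have := hPQ w
    rw [map_mul] at this
    exact (mul_ne_zero hw1 hw2) this

/-- Existence of a generic point, with coordinates that generate the field. -/
theorem exists_isGeneric {k : Type u} {σ : Type} {T : Type*} [Field k] [TopologicalSpace T]
    [IrreducibleSpace T] [Finite σ] {κ : T → AffSpace k σ} (hκ : Continuous κ) :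
    ∃ (L : Type u) (_ : Field L) (_ : Algebra k L) (ξ : σ → L), IsGeneric κ ξ ∧
      IntermediateField.adjoin k (Set.range ξ) = ⊤ ∧ Algebra.EssFiniteType k L := by
  have := isPrime_vanishingIdeal_range hκ
  let I := vanishingIdeal k (Set.range κ : Set (σ → k))
  let A := MvPolynomial σ k ⧸ I
  let L := FractionRing A
  let ξ : σ → L := fun i => algebraMap A L (Ideal.Quotient.mk I (X i))
  have hξ : ∀ P, aeval ξ P = algebraMap A L (Ideal.Quotient.mk I P) := by
    intro P
    have : aeval ξ = (IsScalarTower.toAlgHom k A L).comp (Ideal.Quotient.mkₐ k I) := by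
      ext i; simp [ξ]; rfl
    rw [this]; rfl
  have htop : IntermediateField.adjoin k (Set.range ξ) = ⊤ := by
    rw [eq_top_iff]
    intro x _
    obtain ⟨a, b, -, rfl⟩ := IsFractionRing.div_surjective (A := A) x
    obtain ⟨P, rfl⟩ := Ideal.Quotient.mk_surjective a
    obtain ⟨Q, rfl⟩ := Ideal.Quotient.mk_surjective b
    have hmem : ∀ P, aeval ξ P ∈ IntermediateField.adjoin k (Set.range ξ) := fun P => by
      refine IntermediateField.algebra_adjoin_le_adjoin k _ ?_
      rw [Algebra.adjoin_range_eq_range_aeval]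
      exact ⟨P, rfl⟩
    rw [← hξ, ← hξ]
    exact div_mem (hmem P) (hmem Q)
  refine ⟨L, inferInstance, inferInstance, ξ, fun P => ?_, htop, ?_⟩
  · rw [hξ, map_eq_zero_iff _ (IsFractionRing.injective A L), Ideal.Quotient.eq_zero_iff_mem,
      mem_vanishingIdeal_iff, Set.forall_mem_range]
    exact Iff.rfl
  · have : Algebra.EssFiniteType A L := Algebra.EssFiniteType.of_isLocalization L (nonZeroDivisors A)
    exact Algebra.EssFiniteType.comp k A L

/-! ### Dimension of affine varieties -/

/-- The dimension of an affine variety is the dimension of its coordinate ring. The points embed into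
the spectrum; conversely, by the Nullstellensatz, prime ideals have pairwise different zero loci. -/
theorem topologicalKrullDim_eq_ringKrullDim_quotient [IsAlgClosed k] [Finite σ]
    {κ : T → AffSpace k σ} (hκ : IsClosedEmbedding κ) :
    topologicalKrullDim T =
      ringKrullDim (MvPolynomial σ k ⧸ vanishingIdeal k (Set.range κ : Set (σ → k))) := by
  let I := vanishingIdeal k (Set.range κ : Set (σ → k))
  apply le_antisymm
  · have hle : ∀ t, I ≤ (pointToPoint (k := k) (κ t : σ → k)).asIdeal := fun t =>
      vanishingIdeal_anti_mono (Set.singleton_subset_iff.2 ⟨t, rfl⟩)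
    have hemb := PrimeSpectrum.isClosedEmbedding_comap_of_surjective _ (Ideal.Quotient.mk I)
      Ideal.Quotient.mk_surjective
    have hex : ∀ t, ∃ q : PrimeSpectrum (MvPolynomial σ k ⧸ I),
        PrimeSpectrum.comap (Ideal.Quotient.mk I) q = pointToPoint (k := k) (κ t : σ → k) := by
      intro t
      have : pointToPoint (k := k) (κ t : σ → k) ∈
          Set.range (PrimeSpectrum.comap (Ideal.Quotient.mk I)) := by
        rw [range_comap_of_surjective _ _ Ideal.Quotient.mk_surjective,
          Ideal.mk_ker, PrimeSpectrum.mem_zeroLocus]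
        exact hle t
      exact this
    choose g hg using hex
    have hcomp : PrimeSpectrum.comap (Ideal.Quotient.mk I) ∘ g =
        fun t => pointToPoint (k := k) (κ t : σ → k) := funext hg
    have hind : IsInducing g := by
      rw [← hemb.isInducing.of_comp_iff, hcomp]
      exact IsInducing.comp (g := fun x : AffSpace k σ => pointToPoint (k := k) x) ⟨rfl⟩
        hκ.isInducing
    rw [← PrimeSpectrum.topologicalKrullDim_eq_ringKrullDim]
    exact hind.topologicalKrullDim_le
  · rw [ringKrullDim, ← Order.krullDim_orderDual]
    have hmem : ∀ (P : Ideal (MvPolynomial σ k)), I ≤ P → ∀ x ∈ zeroLocus k P,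
        ∃ t, κ t = (x : σ → k) := fun P hP x hx =>
      AffSpace.mem_of_isClosed hκ.isClosed_range fun Q hQ => hx Q (hP hQ)
    have hI : ∀ q : PrimeSpectrum (MvPolynomial σ k ⧸ I),
        I ≤ q.asIdeal.comap (Ideal.Quotient.mk I) := fun q x hx => by
      rw [Ideal.mem_comap, Ideal.Quotient.eq_zero_iff_mem.2 hx]; exact zero_mem _
    -- the zero locus of a prime ideal, as an irreducible closed subset of `T`
    let Z : (PrimeSpectrum (MvPolynomial σ k ⧸ I))ᵒᵈ → IrreducibleCloseds T := fun q =>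
      { carrier := {t | ∀ f ∈ (OrderDual.ofDual q).asIdeal.comap (Ideal.Quotient.mk I),
          eval (κ t : σ → k) f = 0}
        isIrreducible' := by
          set P := (OrderDual.ofDual q).asIdeal.comap (Ideal.Quotient.mk I) with hP
          have hPprime : P.IsPrime := Ideal.comap_isPrime _ _
          have hpt : ∀ f ∉ P, ∃ t, (∀ g ∈ P, eval (κ t : σ → k) g = 0) ∧
              eval (κ t : σ → k) f ≠ 0 := by
            intro f hf
            rw [← IsPrime.vanishingIdeal_zeroLocus (K := k) P, mem_vanishingIdeal_iff] at hf
            push Not at hf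
            obtain ⟨x, hx, hfx⟩ := hf
            obtain ⟨t, rfl⟩ := hmem P (hI _) x hx
            exact ⟨t, hx, hfx⟩
          refine ⟨?_, ?_⟩
          · obtain ⟨t, ht, -⟩ := hpt 1 ((Ideal.ne_top_iff_one _).1 hPprime.ne_top)
            exact ⟨t, ht⟩
          · rintro U V hU hV ⟨s, hs, hsU⟩ ⟨t, ht, htV⟩
            obtain ⟨U', hU', rfl⟩ := hκ.isInducing.isOpen_iff.1 hU
            obtain ⟨V', hV', rfl⟩ := hκ.isInducing.isOpen_iff.1 hV
            obtain ⟨f, hf, hfU⟩ := AffSpace.exists_eval_ne_zero hU' hsU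
            obtain ⟨g, hg, hgV⟩ := AffSpace.exists_eval_ne_zero hV' htV
            have hfg : f * g ∉ P := fun h => (hPprime.mem_or_mem h).elim
              (fun h => hf (hs f h)) (fun h => hg (ht g h))
            obtain ⟨w, hw, hwfg⟩ := hpt _ hfg
            rw [map_mul] at hwfg
            exact ⟨w, hw, hfU _ (left_ne_zero_of_mul hwfg), hgV _ (right_ne_zero_of_mul hwfg)⟩
        isClosed' := by
          have : {t | ∀ f ∈ (OrderDual.ofDual q).asIdeal.comap (Ideal.Quotient.mk I),
              eval (κ t : σ → k) f = 0} =
              ⋂ f ∈ (OrderDual.ofDual q).asIdeal.comap (Ideal.Quotient.mk I),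
                κ ⁻¹' {x : AffSpace k σ | eval (x : σ → k) f = 0} := by
            ext t; simp
          rw [this]
          exact isClosed_biInter fun f _ => (AffSpace.isClosed_eq f).preimage hκ.continuous }
    refine Order.krullDim_le_of_strictMono Z fun q q' hqq' => ?_
    have hlt : OrderDual.ofDual q' < OrderDual.ofDual q := hqq'
    refine lt_of_le_not_ge (fun t ht f hf => ht f (hlt.le hf)) fun hle => ?_
    refine hlt.not_ge fun x hx => ?_
    obtain ⟨f, rfl⟩ := Ideal.Quotient.mk_surjective x
    have hPprime : ((OrderDual.ofDual q').asIdeal.comap (Ideal.Quotient.mk I)).IsPrime :=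
      Ideal.comap_isPrime _ _
    change f ∈ (OrderDual.ofDual q').asIdeal.comap (Ideal.Quotient.mk I)
    rw [← IsPrime.vanishingIdeal_zeroLocus (K := k)
      ((OrderDual.ofDual q').asIdeal.comap (Ideal.Quotient.mk I))]
    intro y hy
    obtain ⟨t, rfl⟩ := hmem _ (hI _) y hy
    exact hle (show t ∈ Z q' from hy) f hx

/-- The dimension of an affine variety is the transcendence degree of its function field. -/
theorem IsGeneric.topologicalKrullDim_eq {k L : Type u} [Field k] [IsAlgClosed k] [Field L]
    [Algebra k L] [Finite σ] {κ : T → AffSpace k σ} (hκ : IsClosedEmbedding κ) {ξ : σ → L}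
    (hξ : IsGeneric κ ξ) (htop : IntermediateField.adjoin k (Set.range ξ) = ⊤) :
    ∃ s : ℕ, topologicalKrullDim T = s ∧ Algebra.trdeg k L = s := by
  let A := (aeval (R := k) ξ).range
  -- the coordinate ring of `T` is the algebra `A` generated by the coordinates of `ξ`
  have hker : RingHom.ker (aeval (R := k) ξ) = vanishingIdeal k (Set.range κ : Set (σ → k)) := by
    ext P
    rw [RingHom.mem_ker, mem_vanishingIdeal_iff, Set.forall_mem_range]
    exact hξ P
  let e := Ideal.quotientKerAlgEquivOfSurjective
    (f := (aeval (R := k) ξ).rangeRestrict) (AlgHom.rangeRestrict_surjective _)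
  have hdim : topologicalKrullDim T = ringKrullDim A := by
    rw [topologicalKrullDim_eq_ringKrullDim_quotient hκ, ← ringKrullDim_eq_of_ringEquiv e.toRingEquiv,
      ← hker, AlgHom.ker_rangeRestrict]
  have hft : Algebra.FiniteType k A :=
    Algebra.FiniteType.of_surjective (aeval (R := k) ξ).rangeRestrict
      (AlgHom.rangeRestrict_surjective _)
  obtain ⟨s, hs1, hs2⟩ := exists_ringKrullDim_eq_trdeg k A
  refine ⟨s, hdim.trans hs1, ?_⟩
  have halg : Algebra.IsAlgebraic A L := by
    have hA : A = Algebra.adjoin k (Set.range ξ) := (Algebra.adjoin_range_eq_range_aeval k ξ).symm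
    rw [hA, ← IntermediateField.isAlgebraic_adjoin_iff_top, htop]
    exact ⟨fun x => isAlgebraic_algebraMap (A := L) (⟨x, trivial⟩ : (⊤ : IntermediateField k L))⟩
  rw [← trdeg_add_eq k A (A := L), hs2, trdeg_eq_zero (R := A), add_zero]

end AffineSpace

/-! ### Homogenization -/

/-- A polynomial in fractions `num i / w` becomes a polynomial after multiplication by a power of
the denominator, uniformly for points with values in extension fields. -/
theorem exists_clear_denominators {k : Type u} [Field k] {σ τ : Type*} (w : MvPolynomial σ k)
    (num : τ → MvPolynomial σ k) (P : MvPolynomial τ k) :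
    ∃ (d : ℕ) (Q : MvPolynomial σ k), ∀ (K : Type u) [Field K] [Algebra k K] (x : σ → K),
      aeval x w ≠ 0 → aeval x Q = aeval x w ^ d * aeval (fun i => aeval x (num i) / aeval x w) P := by
  induction P using MvPolynomial.induction_on with
  | C a => exact ⟨0, C a, fun K _ _ x hx => by simp⟩
  | add P P' h h' =>
    obtain ⟨d, Q, hQ⟩ := h
    obtain ⟨d', Q', hQ'⟩ := h'
    refine ⟨d + d', w ^ d' * Q + w ^ d * Q', fun K _ _ x hx => ?_⟩
    simp only [map_add, map_mul, map_pow, hQ K x hx, hQ' K x hx]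
    ring
  | mul_X P i h =>
    obtain ⟨d, Q, hQ⟩ := h
    refine ⟨d + 1, Q * num i, fun K _ _ x hx => ?_⟩
    simp only [map_mul, hQ K x hx, aeval_X]
    field_simp
    ring

/-- Homogenization of a polynomial to degree `d` by means of the variable `i₀`, on which the
polynomial may itself depend. It makes sense if `d` is at least the total degree. -/
def homogenizeAt {k ι : Type*} [Field k] (i₀ : ι) (d : ℕ) (P : MvPolynomial ι k) :
    MvPolynomial ι k :=
  ∑ m ∈ P.support, monomial (m + Finsupp.single i₀ (d - m.degree)) (P.coeff m)

theorem homogenizeAt_isHomogeneous {k ι : Type*} [Field k] (i₀ : ι) {d : ℕ}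
    {P : MvPolynomial ι k} (hd : P.totalDegree ≤ d) : (homogenizeAt i₀ d P).IsHomogeneous d := by
  refine IsHomogeneous.sum _ _ _ fun m hm => isHomogeneous_monomial _ ?_
  have h1 : m.degree ≤ d := by
    refine le_trans ?_ hd
    exact le_totalDegree hm
  rw [map_add, Finsupp.degree_single]
  omega

theorem aeval_homogenizeAt_of_eq_one {k ι K : Type*} [Field k] [Field K] [Algebra k K] (i₀ : ι)
    (d : ℕ) (P : MvPolynomial ι k) {z : ι → K} (hz : z i₀ = 1) :
    aeval z (homogenizeAt i₀ d P) = aeval z P := by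
  conv_rhs => rw [P.as_sum]
  rw [homogenizeAt, map_sum, map_sum]
  refine Finset.sum_congr rfl fun m _ => ?_
  rw [aeval_monomial, aeval_monomial, Finsupp.prod_add_index' (by simp) (by intros; rw [pow_add]),
    Finsupp.prod_single_index (by simp), hz, one_pow, mul_one]

theorem aeval_smul_of_isHomogeneous {k ι K : Type*} [Field k] [Field K] [Algebra k K]
    {d : ℕ} {P : MvPolynomial ι k} (hP : P.IsHomogeneous d) (c : K) (z : ι → K) :
    aeval (fun i => c * z i) P = c ^ d * aeval z P := by
  rw [P.as_sum, map_sum, map_sum, Finset.mul_sum]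
  refine Finset.sum_congr rfl fun m hm => ?_
  rw [aeval_monomial, aeval_monomial]
  have h1 : m.degree = d := by
    rw [Finsupp.degree_eq_weight_one]
    exact hP (mem_support_iff.1 hm)
  simp only [mul_pow]
  have h2 : (m.prod fun _ e => c ^ e) = c ^ d := by
    rw [← h1, Finsupp.degree_apply, ← Finset.prod_pow_eq_pow_sum, Finsupp.prod]
  rw [Finsupp.prod_mul, h2]
  ring

theorem eval_smul_of_isHomogeneous {k ι : Type*} [Field k] {d : ℕ} {P : MvPolynomial ι k}
    (hP : P.IsHomogeneous d) (c : k) (z : ι → k) :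
    eval (c • z) P = c ^ d * eval z P :=
  aeval_smul_of_isHomogeneous hP c z

theorem aeval_homogenizeAt {k ι K : Type*} [Field k] [Field K] [Algebra k K] (i₀ : ι)
    {d : ℕ} {P : MvPolynomial ι k} (hd : P.totalDegree ≤ d) {z : ι → K} (hz : z i₀ ≠ 0) :
    aeval z (homogenizeAt i₀ d P) = z i₀ ^ d * aeval (fun i => z i / z i₀) P := by
  rw [← aeval_homogenizeAt_of_eq_one i₀ d P (z := fun i => z i / z i₀) (div_self hz),
    ← aeval_smul_of_isHomogeneous (homogenizeAt_isHomogeneous i₀ hd)]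
  simp only [mul_div_cancel₀ _ hz]

/-- Homogenization changes the partial derivatives only in the direction of the variable `i₀`. -/
theorem aeval_pderiv_homogenizeAt {k ι K : Type*} [Field k] [Field K] [Algebra k K] (i₀ : ι)
    (d : ℕ) (P : MvPolynomial ι k) {z : ι → K} (hz : z i₀ = 1) {j : ι} (hj : j ≠ i₀) :
    aeval z (pderiv j (homogenizeAt i₀ d P)) = aeval z (pderiv j P) := by
  classical
  conv_rhs => rw [P.as_sum]
  rw [homogenizeAt, map_sum, map_sum, map_sum, map_sum]
  refine Finset.sum_congr rfl fun m _ => ?_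
  rw [pderiv_monomial, pderiv_monomial, aeval_monomial, aeval_monomial]
  have h1 : (m + Finsupp.single i₀ (d - m.degree)) j = m j := by
    rw [Finsupp.add_apply, Finsupp.single_eq_of_ne hj, add_zero]
  have h2 : m + Finsupp.single i₀ (d - m.degree) - Finsupp.single j 1 =
      (m - Finsupp.single j 1) + Finsupp.single i₀ (d - m.degree) := by
    ext i
    simp only [Finsupp.tsub_apply, Finsupp.add_apply]
    by_cases hi : i = j
    · subst hi; simp [Finsupp.single_eq_of_ne hj]
    · simp [Finsupp.single_eq_of_ne hi]
  rw [h1, h2, Finsupp.prod_add_index' (by simp) (by intros; rw [pow_add]),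
    Finsupp.prod_single_index (by simp), hz, one_pow, mul_one]

/-! ### Dimension of open subsets -/

/-- A principal open subset of an affine variety is again an affine variety: the inverse of the
equation of the complement is an additional coordinate, with index `none`. -/
theorem isClosedEmbedding_principalOpen {T : Type*} [TopologicalSpace T] {k : Type u} [Field k]
    {σ : Type*} {κ : T → AffSpace k σ} (hκ : IsClosedEmbedding κ) (f : MvPolynomial σ k) :
    IsClosedEmbedding (fun t : {t // eval (κ t) f ≠ 0} =>
      (fun i => i.elim (eval (κ t) f)⁻¹ (κ t) : AffSpace k (Option σ))) := by
  have hcont : Continuous (fun t : {t // eval (κ t) f ≠ 0} =>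
      (fun i => i.elim (eval (κ t) f)⁻¹ (κ t) : AffSpace k (Option σ))) := by
    rw [AffSpace.continuous_iff]
    intro P
    obtain ⟨d, Q, hQ⟩ := exists_clear_denominators f (fun i : Option σ => i.elim 1 (fun j => X j * f)) P
    have := ((AffSpace.isOpen_ne Q).preimage hκ.continuous).preimage
      (continuous_subtype_val (p := fun t => eval (κ t) f ≠ 0))
    convert this using 1
    ext t
    have h1 : eval (κ t) Q = eval (κ t) f ^ d * eval (fun i : Option σ =>
        eval (κ t) (i.elim 1 (fun j => X j * f)) / eval (κ t) f) P := hQ k (κ t) t.2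
    have h2 : (fun i : Option σ => eval (κ t) (i.elim 1 (fun j => X j * f)) / eval (κ t) f) =
        fun i => i.elim (eval (κ t) f)⁻¹ (κ t) := by
      funext i
      cases i with
      | none => simp
      | some j => simp [t.2]
    rw [h2] at h1
    change _ ≠ 0 ↔ eval (κ t) Q ≠ 0
    rw [h1, mul_ne_zero_iff, and_iff_right (pow_ne_zero _ t.2)]
  refine ⟨⟨?_, ?_⟩, ?_⟩
  · have hproj : Continuous (fun x : AffSpace k (Option σ) => (fun i => x (some i) : AffSpace k σ)) := by
      simpa using AffSpace.continuous_polynomial (k := k) (fun i : σ => X (some i : Option σ))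
    exact IsInducing.of_comp hcont hproj (hκ.isInducing.comp IsInducing.subtypeVal)
  · intro s t hst
    exact Subtype.ext (hκ.injective (funext fun i => congrFun hst (some i)))
  · have : Set.range (fun t : {t // eval (κ t) f ≠ 0} =>
        (fun i => i.elim (eval (κ t) f)⁻¹ (κ t) : AffSpace k (Option σ))) =
        (fun x : AffSpace k (Option σ) => (fun i => x (some i) : AffSpace k σ)) ⁻¹' Set.range κ ∩
          {x | eval x (X none * rename some f - 1) = 0} := by
      ext x
      constructor
      · rintro ⟨t, rfl⟩
        refine ⟨⟨t, rfl⟩, ?_⟩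
        have : (fun i : Option σ => i.elim (eval (κ t) f)⁻¹ (κ t)) ∘ some = κ t := rfl
        simp [eval_rename, this, t.2]
      · rintro ⟨⟨t, ht⟩, hx⟩
        have h1 : x ∘ some = κ t := ht.symm
        simp only [Set.mem_ofPred_eq, map_sub, map_mul, eval_X, eval_rename, map_one, h1,
          sub_eq_zero] at hx
        refine ⟨⟨t, right_ne_zero_of_mul_eq_one hx⟩, funext fun i => ?_⟩
        cases i with
        | none => exact (eq_inv_of_mul_eq_one_left hx).symm
        | some j => exact congrFun ht j
    rw [this]
    refine (hκ.isClosed_range.preimage ?_).inter (AffSpace.isClosed_eq _)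
    simpa using AffSpace.continuous_polynomial (k := k) (fun i : σ => X (some i : Option σ))

/-- The generic point of a principal open subset. -/
theorem IsGeneric.principalOpen {T : Type*} {k L : Type u} [Field k] [Field L] [Algebra k L] {σ : Type*}
    {κ : T → AffSpace k σ} {ξ : σ → L} (hξ : IsGeneric κ ξ) {f : MvPolynomial σ k}
    (hf : aeval ξ f ≠ 0) :
    IsGeneric (fun t : {t // eval (κ t) f ≠ 0} => fun i : Option σ => i.elim (eval (κ t) f)⁻¹ (κ t))
      (fun i : Option σ => i.elim (aeval ξ f)⁻¹ ξ) := by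
  intro P
  obtain ⟨d, Q, hQ⟩ := exists_clear_denominators f (fun i : Option σ => i.elim 1 (fun j => X j * f)) P
  have key : ∀ (K : Type u) [Field K] [Algebra k K] (x : σ → K), aeval x f ≠ 0 →
      (aeval (fun i : Option σ => i.elim (aeval x f)⁻¹ x) P = 0 ↔ aeval x Q = 0) := by
    intro K _ _ x hx
    have h2 : (fun i : Option σ => aeval x (i.elim 1 (fun j => X j * f) : MvPolynomial σ k) /
        aeval x f) = fun i => i.elim (aeval x f)⁻¹ x := by
      funext i
      cases i with
      | none => simp
      | some j => simp [hx]
    rw [hQ K x hx, h2, mul_eq_zero, or_iff_right (pow_ne_zero _ hx)]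
  rw [key L ξ hf]
  have hk : ∀ t : {t // eval (κ t) f ≠ 0},
      eval (fun i : Option σ => i.elim (eval (κ t) f)⁻¹ (κ t)) P = 0 ↔ eval (κ t) Q = 0 :=
    fun t => key k (κ t) t.2
  simp only [hk]
  constructor
  · exact fun h t => (hξ Q).1 h t
  · intro h
    have h1 : aeval ξ (Q * f) = 0 := (hξ _).2 fun t => by
      rw [map_mul]
      by_cases h0 : eval (κ t) f = 0
      · rw [h0, mul_zero]
      · rw [h ⟨t, h0⟩, zero_mul]
    rw [map_mul] at h1
    exact (mul_eq_zero.1 h1).resolve_right hf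

theorem topologicalKrullDim_principalOpen {T : Type*} [TopologicalSpace T] {k : Type u} [Field k]
    [IsAlgClosed k] [IrreducibleSpace T]
    {σ : Type} [Finite σ] {κ : T → AffSpace k σ} (hκ : IsClosedEmbedding κ)
    (f : MvPolynomial σ k) (hf : ∃ t, eval (κ t) f ≠ 0) :
    topologicalKrullDim {t // eval (κ t) f ≠ 0} = topologicalKrullDim T := by
  obtain ⟨L, _, _, ξ, hξ, htop, -⟩ := exists_isGeneric hκ.continuous
  have hf' : aeval ξ f ≠ 0 := fun h => by
    obtain ⟨t, ht⟩ := hf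
    exact ht ((hξ f).1 h t)
  obtain ⟨s, hs, hs'⟩ := hξ.topologicalKrullDim_eq hκ htop
  obtain ⟨s', hs1, hs2⟩ := (hξ.principalOpen hf').topologicalKrullDim_eq
    (isClosedEmbedding_principalOpen hκ f) (by
      rw [eq_top_iff, ← htop]
      refine IntermediateField.adjoin.mono _ _ _ ?_
      rintro _ ⟨i, rfl⟩
      exact ⟨some i, rfl⟩)
  rw [hs, hs1]
  rw [hs'] at hs2
  rw [Nat.cast_injective hs2]

theorem topologicalKrullDim_of_isOpen {T : Type*} [TopologicalSpace T] {k : Type u} [Field k]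
    [IsAlgClosed k] [IrreducibleSpace T]
    {σ : Type} [Finite σ] {κ : T → AffSpace k σ} (hκ : IsClosedEmbedding κ)
    {W : Set T} (hW : IsOpen W) (hne : W.Nonempty) :
    topologicalKrullDim W = topologicalKrullDim T := by
  refine le_antisymm (topologicalKrullDim_subspace_le T W) ?_
  obtain ⟨t, ht⟩ := hne
  obtain ⟨W', hW', rfl⟩ := hκ.isInducing.isOpen_iff.1 hW
  obtain ⟨f, hft, hfW⟩ := AffSpace.exists_eval_ne_zero hW' ht
  rw [← topologicalKrullDim_principalOpen hκ f ⟨t, hft⟩]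
  exact (IsEmbedding.inclusion (s := {t | eval (κ t) f ≠ 0}) (t := κ ⁻¹' W')
    fun t ht => hfW _ ht).isInducing.topologicalKrullDim_le

/-- The dimension of an irreducible space that is covered by open affine varieties is the dimension
of any nonempty one of them. -/
theorem topologicalKrullDim_eq_of_charts {T : Type*} [TopologicalSpace T] {k : Type u} [Field k]
    [IsAlgClosed k] [IrreducibleSpace T] {ι : Type*} {U : ι → Set T} (hU : ∀ i, IsOpen (U i))
    (hcover : ⋃ i, U i = Set.univ) {σ : Type} [Finite σ] {κ : ∀ i, U i → AffSpace k σ}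
    (hκ : ∀ i, IsClosedEmbedding (κ i)) {i : ι} (hi : (U i).Nonempty) :
    topologicalKrullDim T = topologicalKrullDim (U i) := by
  have hirr : ∀ j, (U j).Nonempty → IrreducibleSpace (U j) := by
    intro j hj
    have : IsIrreducible (U j) :=
      ⟨hj, (PreirreducibleSpace.isPreirreducible_univ (X := T)).open_subset (hU j)
        (Set.subset_univ _)⟩
    exact Subtype.irreducibleSpace this
  have hinter : ∀ j, (U j).Nonempty → topologicalKrullDim (U j) ≤ topologicalKrullDim (U i) := by
    intro j hj
    obtain ⟨t, -, htj, hti⟩ := (PreirreducibleSpace.isPreirreducible_univ (X := T))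
      _ _ (hU j) (hU i) (by simpa using hj) (by simpa using hi)
    have := hirr j hj
    rw [← topologicalKrullDim_of_isOpen (hκ j) (W := Subtype.val ⁻¹' U i)
      ((hU i).preimage continuous_subtype_val) ⟨⟨t, htj⟩, hti⟩]
    let g : (Subtype.val ⁻¹' U i : Set (U j)) → U i := fun x => ⟨x.1.1, x.2⟩
    have hg' : IsInducing ((Subtype.val : U i → T) ∘ g) :=
      (IsInducing.subtypeVal (t := U j)).comp (IsInducing.subtypeVal (t := Subtype.val ⁻¹' U i))
    have hg : IsInducing g := IsInducing.subtypeVal.of_comp_iff.1 hg'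
    exact hg.topologicalKrullDim_le
  refine le_antisymm ?_ (topologicalKrullDim_subspace_le T (U i))
  -- chains above an irreducible closed set `Z` can be computed in any chart that `Z` meets
  rw [topologicalKrullDim, Order.krullDim_eq_iSup_coheight]
  refine iSup_le fun Z => ?_
  obtain ⟨t, ht⟩ := Z.isIrreducible.nonempty
  obtain ⟨j, hj⟩ := Set.mem_iUnion.1 (hcover.symm ▸ Set.mem_univ t : t ∈ ⋃ i, U i)
  have hemb : IsOpenEmbedding (Subtype.val : U j → T) := (hU j).isOpenEmbedding_subtypeVal
  let e := IrreducibleCloseds.orderIsoOfIsOpenEmbedding _ hemb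
  let Z' := e.symm ⟨Z, ⟨⟨t, hj⟩, ht⟩⟩
  have h1 : IrreducibleCloseds.map _ hemb.continuous Z' = Z :=
    congrArg Subtype.val (e.apply_symm_apply ⟨Z, ⟨⟨t, hj⟩, ht⟩⟩)
  rw [← h1, hemb.coheight_map]
  exact (Order.coheight_le_krullDim Z').trans (hinter j ⟨t, hj⟩)

/-! ### Affine charts of projective space -/

section Projective

variable {k ι T : Type*} [Field k] [TopologicalSpace T]

theorem eval_rep_mk_ne_zero_iff {d : ℕ} {f : MvPolynomial ι k} (hf : f.IsHomogeneous d)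
    {v : ι → k} (hv : v ≠ 0) : eval (Projectivization.mk k v hv).rep f ≠ 0 ↔ eval v f ≠ 0 := by
  obtain ⟨c, hc⟩ := Projectivization.exists_smul_eq_mk_rep k v hv
  rw [← hc, Units.smul_def, eval_smul_of_isHomogeneous hf, mul_ne_zero_iff,
    and_iff_right (pow_ne_zero _ c.ne_zero)]

theorem eval_rep_mk_eq_zero_iff {d : ℕ} {f : MvPolynomial ι k} (hf : f.IsHomogeneous d)
    {v : ι → k} (hv : v ≠ 0) : eval (Projectivization.mk k v hv).rep f = 0 ↔ eval v f = 0 :=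
  not_iff_not.1 (eval_rep_mk_ne_zero_iff hf hv)

theorem rep_mk_apply_ne_zero_iff {v : ι → k} (hv : v ≠ 0) (i : ι) :
    (Projectivization.mk k v hv).rep i ≠ 0 ↔ v i ≠ 0 := by
  simpa using eval_rep_mk_ne_zero_iff (isHomogeneous_X k i) hv

theorem isOpen_eval_rep_ne_zero {d : ℕ} {f : MvPolynomial ι k} (hf : f.IsHomogeneous d) :
    IsOpen {x : ℙ k (ι → k) | eval x.rep f ≠ 0} :=
  isOpen_generateFrom_of_mem ⟨d, f, hf, rfl⟩

theorem isOpen_rep_apply_ne_zero (i : ι) : IsOpen {x : ℙ k (ι → k) | x.rep i ≠ 0} := by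
  simpa using isOpen_eval_rep_ne_zero (isHomogeneous_X k i)

theorem continuous_projective_iff {φ : T → ℙ k (ι → k)} :
    Continuous φ ↔ ∀ (d : ℕ) (f : MvPolynomial ι k), f.IsHomogeneous d →
      IsOpen {t | eval (φ t).rep f ≠ 0} := by
  rw [continuous_generateFrom_iff]
  exact ⟨fun h d f hf => h _ ⟨d, f, hf, rfl⟩, by rintro h _ ⟨d, f, hf, rfl⟩; exact h d f hf⟩

theorem projective_isTopologicalBasis :
    IsTopologicalBasis {U : Set (ℙ k (ι → k)) | ∃ (d : ℕ) (f : MvPolynomial ι k),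
      f.IsHomogeneous d ∧ U = {x | eval x.rep f ≠ 0}} := by
  have := isTopologicalBasis_of_subbasis_of_inter (t := zariskiProjective (k := k) (ι := ι)) rfl ?_
  · rwa [Set.insert_eq_of_mem] at this
    exact ⟨0, 1, isHomogeneous_one _ _, by ext; simp⟩
  · rintro _ ⟨d, f, hf, rfl⟩ _ ⟨e, g, hg, rfl⟩
    refine ⟨d + e, f * g, hf.mul hg, ?_⟩
    ext x
    simp [not_or]

/-- The affine coordinates of a point of projective space in the chart where the homogeneous
coordinate with index `i₀` does not vanish. The coordinate with index `i₀`, which is `1`, is kept, so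
that these are also homogeneous coordinates. -/
def projChart (i₀ : ι) (x : ℙ k (ι → k)) : ι → k := fun i => x.rep i / x.rep i₀

theorem projChart_mk {v : ι → k} (hv : v ≠ 0) (i₀ : ι) :
    projChart i₀ (Projectivization.mk k v hv) = fun i => v i / v i₀ := by
  obtain ⟨c, hc⟩ := Projectivization.exists_smul_eq_mk_rep k v hv
  funext i
  rw [projChart, ← hc]
  simp only [Units.smul_def, Pi.smul_apply, smul_eq_mul]
  exact mul_div_mul_left _ _ c.ne_zero

theorem projChart_self {i₀ : ι} {x : ℙ k (ι → k)} (hx : x.rep i₀ ≠ 0) : projChart i₀ x i₀ = 1 :=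
  div_self hx

theorem projChart_ne_zero {i₀ : ι} {x : ℙ k (ι → k)} (hx : x.rep i₀ ≠ 0) : projChart i₀ x ≠ 0 :=
  fun h => by simpa [projChart_self hx] using congrFun h i₀

theorem mk_projChart {i₀ : ι} {x : ℙ k (ι → k)} (hx : x.rep i₀ ≠ 0) :
    Projectivization.mk k (projChart i₀ x) (projChart_ne_zero hx) = x := by
  conv_rhs => rw [← x.mk_rep]
  rw [Projectivization.mk_eq_mk_iff']
  refine ⟨(x.rep i₀)⁻¹, ?_⟩
  funext i
  simp [projChart, div_eq_inv_mul]

theorem eval_projChart {i₀ : ι} {x : ℙ k (ι → k)} (hx : x.rep i₀ ≠ 0) {d : ℕ}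
    {f : MvPolynomial ι k} (hf : f.IsHomogeneous d) :
    eval (projChart i₀ x) f ≠ 0 ↔ eval x.rep f ≠ 0 := by
  conv_rhs => rw [← mk_projChart hx]
  rw [eval_rep_mk_ne_zero_iff hf]

theorem isClosedEmbedding_projChart (i₀ : ι) :
    IsClosedEmbedding (fun x : {x : ℙ k (ι → k) | x.rep i₀ ≠ 0} =>
      (projChart i₀ x.1 : AffSpace k ι)) := by
  have hcont : Continuous (fun x : {x : ℙ k (ι → k) | x.rep i₀ ≠ 0} =>
      (projChart i₀ x.1 : AffSpace k ι)) := by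
    rw [AffSpace.continuous_iff]
    intro P
    have hset : {x : {x : ℙ k (ι → k) | x.rep i₀ ≠ 0} | eval (projChart i₀ x.1) P ≠ 0} =
        Subtype.val ⁻¹' {x | eval x.rep (homogenizeAt i₀ P.totalDegree P) ≠ 0} := by
      ext x
      change _ ↔ eval x.1.rep _ ≠ 0
      have h : eval x.1.rep (homogenizeAt i₀ P.totalDegree P) =
          x.1.rep i₀ ^ P.totalDegree * eval (projChart i₀ x.1) P :=
        aeval_homogenizeAt i₀ le_rfl x.2
      rw [h, mul_ne_zero_iff, and_iff_right (pow_ne_zero _ x.2)]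
      rfl
    exact hset ▸ (isOpen_eval_rep_ne_zero (homogenizeAt_isHomogeneous i₀
      (le_refl P.totalDegree))).preimage continuous_subtype_val
  refine ⟨⟨⟨le_antisymm hcont.le_induced ?_⟩, ?_⟩, ?_⟩
  · change _ ≤ induced Subtype.val (generateFrom _)
    rw [induced_generateFrom_eq]
    refine le_generateFrom ?_
    rintro _ ⟨_, ⟨d, f, hf, rfl⟩, rfl⟩
    refine isOpen_induced_iff.2 ⟨_, AffSpace.isOpen_ne f, ?_⟩
    ext x
    exact eval_projChart x.2 hf
  · intro x y hxy
    have h1 : projChart i₀ x.1 = projChart i₀ y.1 := hxy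
    refine Subtype.ext ?_
    rw [← mk_projChart x.2, ← mk_projChart y.2]
    congr 1
  · have : Set.range (fun x : {x : ℙ k (ι → k) | x.rep i₀ ≠ 0} =>
        (projChart i₀ x.1 : AffSpace k ι)) = {x | eval x (X i₀ - 1) = 0} := by
      ext z
      simp only [Set.mem_range, Set.mem_ofPred_eq, map_sub, eval_X, map_one, sub_eq_zero]
      constructor
      · rintro ⟨x, rfl⟩
        exact projChart_self x.2
      · intro hz
        have hz0 : z ≠ 0 := fun h => by simp [h] at hz
        refine ⟨⟨Projectivization.mk k z hz0, ?_⟩, ?_⟩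
        · rw [Set.mem_ofPred_eq, rep_mk_apply_ne_zero_iff, hz]; exact one_ne_zero
        · simp only [projChart_mk, hz, div_one]
    rw [this]
    exact AffSpace.isClosed_eq _

theorem continuous_projChart (i₀ : ι) :
    Continuous (fun x : {x : ℙ k (ι → k) | x.rep i₀ ≠ 0} => (projChart i₀ x.1 : AffSpace k ι)) :=
  (isClosedEmbedding_projChart i₀).continuous

/-- Maps to projective space that are given by polynomials in affine coordinates are continuous. -/
theorem continuous_projective_of_polynomial {σ : Type*} {κ : T → AffSpace k σ} (hκ : Continuous κ)
    (g : ι → MvPolynomial σ k) (φ : T → ℙ k (ι → k))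
    (hφ : ∀ t, ∃ h : (fun i => eval (κ t) (g i)) ≠ 0, φ t = Projectivization.mk k _ h) :
    Continuous φ := by
  rw [continuous_projective_iff]
  intro d f hf
  convert (AffSpace.isOpen_ne f).preimage ((AffSpace.continuous_polynomial g).comp hκ) using 1
  ext t
  obtain ⟨h, ht⟩ := hφ t
  rw [Set.mem_ofPred_eq, ht, eval_rep_mk_ne_zero_iff hf]
  rfl

theorem exists_rep_apply_ne_zero (x : ℙ k (ι → k)) : ∃ i, x.rep i ≠ 0 := by
  by_contra! h
  exact x.rep_nonzero (funext h)

end Projective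

/-- The restriction of a closed embedding of an open subset to a closed subset. -/
theorem isClosedEmbedding_restrict {Z A : Type*} [TopologicalSpace Z] [TopologicalSpace A]
    {C F : Set Z} {κ : C → A} (hκ : IsClosedEmbedding κ) (hF : IsClosed F) :
    IsClosedEmbedding (fun x : {x : F | x.1 ∈ C} => κ ⟨x.1.1, x.2⟩) := by
  let g : {x : F | x.1 ∈ C} → C := fun x => ⟨x.1.1, x.2⟩
  have hg' : IsInducing ((Subtype.val : C → Z) ∘ g) :=
    (IsInducing.subtypeVal (t := F)).comp (IsInducing.subtypeVal (t := {x : F | x.1 ∈ C}))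
  have hg : IsInducing g := IsInducing.subtypeVal.of_comp_iff.1 hg'
  have hinj : Function.Injective g := fun x y hxy =>
    Subtype.ext (Subtype.ext (congrArg (fun z : C => z.1) hxy))
  have hrange : Set.range g = Subtype.val ⁻¹' F := by
    ext x
    constructor
    · rintro ⟨y, rfl⟩; exact y.1.2
    · intro hx; exact ⟨⟨⟨x.1, hx⟩, x.2⟩, rfl⟩
  exact hκ.comp ⟨⟨hg, hinj⟩, hrange ▸ hF.preimage continuous_subtype_val⟩

/-! ### Graph matrices of points of the Grassmannian -/

section Graph

variable {k : Type*} [Field k] {n N : ℕ}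

/-- The matrix of the basis of the linear subspace whose columns with indices in `I` form the unit
matrix. It makes sense if the Plücker coordinate with index `I` does not vanish; otherwise it is
zero, the inverse of a singular matrix being zero by convention. -/
def Grassmannian.graph (W : Grassmannian k n N) (I : Fin (n + 1) → Fin (N + 1)) :
    Matrix (Fin (n + 1)) (Fin (N + 1)) k :=
  (W.frame.submatrix id I)⁻¹ * W.frame

variable {W : Grassmannian k n N} {I : Fin (n + 1) → Fin (N + 1)}

theorem Grassmannian.isUnit_det_frame (hI : W.minors I ≠ 0) :
    IsUnit (W.frame.submatrix id I).det := isUnit_iff_ne_zero.2 hI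

theorem Grassmannian.graph_submatrix (hI : W.minors I ≠ 0) :
    (W.graph I).submatrix id I = 1 :=
  Matrix.nonsing_inv_mul _ (isUnit_det_frame hI)

theorem Grassmannian.graph_apply_self (hI : W.minors I ≠ 0) (a b : Fin (n + 1)) :
    W.graph I a (I b) = if a = b then 1 else 0 := by
  rw [← Matrix.one_apply, ← graph_submatrix hI]
  rfl

theorem Grassmannian.det_graph (I J : Fin (n + 1) → Fin (N + 1)) :
    ((W.graph I).submatrix id J).det = W.minors J / W.minors I := by
  have : (W.graph I).submatrix id J = (W.frame.submatrix id I)⁻¹ * W.frame.submatrix id J := rfl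
  rw [this, Matrix.det_mul, Matrix.det_nonsing_inv, Ring.inverse_eq_inv', mul_comm, div_eq_mul_inv]
  rfl

/-- The entries of a matrix in graph form are among its maximal minors. -/
theorem det_submatrix_update {B : Matrix (Fin (n + 1)) (Fin (N + 1)) k}
    (hB : B.submatrix id I = 1) (a : Fin (n + 1)) (c : Fin (N + 1)) :
    (B.submatrix id (Function.update I a c)).det = B a c := by
  have h : B.submatrix id (Function.update I a c) =
      (1 : Matrix (Fin (n + 1)) (Fin (n + 1)) k).updateCol a (fun b => B b c) := by
    rw [← hB]
    ext b b'
    by_cases hb : b' = a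
    · subst hb; simp
    · simp [hb]
  rw [h, ← Matrix.cramer_apply, Matrix.cramer_one]
  rfl

theorem Grassmannian.graph_apply (hI : W.minors I ≠ 0) (a : Fin (n + 1)) (c : Fin (N + 1)) :
    W.graph I a c = W.minors (Function.update I a c) / W.minors I := by
  rw [← det_graph, det_submatrix_update (graph_submatrix hI)]

theorem Grassmannian.frame_mem (W : Grassmannian k n N) (a : Fin (n + 1)) :
    W.frame a ∈ W.toSubmodule :=
  (Module.finBasisOfFinrankEq k W.toSubmodule W.finrank_eq a).2

theorem Grassmannian.vecMul_mem (W : Grassmannian k n N)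
    {B : Matrix (Fin (n + 1)) (Fin (N + 1)) k}
    (hB : ∀ a, B a ∈ W.toSubmodule) (c : Fin (n + 1) → k) :
    Matrix.vecMul c B ∈ W.toSubmodule := by
  rw [Matrix.vecMul_eq_sum]
  exact Submodule.sum_mem _ fun a _ => Submodule.smul_mem _ _ (hB a)

theorem Grassmannian.exists_eq_vecMul_frame {w : Fin (N + 1) → k} (hw : w ∈ W.toSubmodule) :
    ∃ c : Fin (n + 1) → k, w = Matrix.vecMul c W.frame := by
  have h := (Module.finBasisOfFinrankEq k W.toSubmodule W.finrank_eq).sum_repr ⟨w, hw⟩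
  refine ⟨(Module.finBasisOfFinrankEq k W.toSubmodule W.finrank_eq).repr ⟨w, hw⟩, ?_⟩
  rw [Matrix.vecMul_eq_sum]
  have h' := congrArg Subtype.val h
  rw [Submodule.coe_sum] at h'
  exact h'.symm

theorem Grassmannian.graph_mem (W : Grassmannian k n N) (I : Fin (n + 1) → Fin (N + 1))
    (a : Fin (n + 1)) : W.graph I a ∈ W.toSubmodule :=
  W.vecMul_mem W.frame_mem _

/-- The linear subspace is the graph of the linear map given by the columns of its graph matrix. -/
theorem Grassmannian.mem_iff (hI : W.minors I ≠ 0) (w : Fin (N + 1) → k) :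
    w ∈ W.toSubmodule ↔ w = Matrix.vecMul (w ∘ I) (W.graph I) := by
  constructor
  · intro hw
    obtain ⟨c, rfl⟩ := exists_eq_vecMul_frame hw
    have h : Matrix.vecMul c W.frame ∘ I = Matrix.vecMul c (W.frame.submatrix id I) := rfl
    rw [h, graph, Matrix.vecMul_vecMul, ← Matrix.mul_assoc,
      Matrix.mul_nonsing_inv _ (isUnit_det_frame hI), Matrix.one_mul]
  · intro h
    rw [h]
    exact W.vecMul_mem (W.graph_mem I) _

/-- The Plücker coordinates can be computed from any basis. -/
theorem Grassmannian.exists_minors_eq_smul {B : Matrix (Fin (n + 1)) (Fin (N + 1)) k}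
    (hB : ∀ a, B a ∈ W.toSubmodule) (hdet : (B.submatrix id I).det ≠ 0) :
    ∃ c : k, c ≠ 0 ∧ ∀ J, (B.submatrix id J).det = c * W.minors J := by
  choose C hC using fun a => exists_eq_vecMul_frame (hB a)
  have h : ∀ J : Fin (n + 1) → Fin (N + 1),
      B.submatrix id J = Matrix.of C * W.frame.submatrix id J := fun J => by
    ext a b
    exact congrFun (hC a) (J b)
  have h' : ∀ J, (B.submatrix id J).det = (Matrix.of C).det * W.minors J := fun J => by
    rw [h, Matrix.det_mul]
    rfl
  exact ⟨_, fun h0 => hdet (by rw [h', h0, zero_mul]), h'⟩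

theorem Grassmannian.plucker_eq {B : Matrix (Fin (n + 1)) (Fin (N + 1)) k}
    (hB : ∀ a, B a ∈ W.toSubmodule) (hdet : (B.submatrix id I).det ≠ 0) :
    ∃ h : (fun J => (B.submatrix id J).det) ≠ 0, W.plucker = Projectivization.mk k _ h := by
  obtain ⟨c, hc, h⟩ := exists_minors_eq_smul hB hdet
  refine ⟨fun h0 => hdet (congrFun h0 I), ?_⟩
  rw [plucker, Projectivization.mk_eq_mk_iff']
  refine ⟨c⁻¹, funext fun J => ?_⟩
  simp only [Pi.smul_apply, smul_eq_mul, h, inv_mul_cancel_left₀ hc]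

theorem Grassmannian.minors_ne_zero_of_mem {B : Matrix (Fin (n + 1)) (Fin (N + 1)) k}
    (hB : ∀ a, B a ∈ W.toSubmodule) (hdet : (B.submatrix id I).det ≠ 0) : W.minors I ≠ 0 := by
  obtain ⟨c, hc, h⟩ := exists_minors_eq_smul hB hdet
  rw [h] at hdet
  exact right_ne_zero_of_mul hdet

theorem Grassmannian.graph_eq_of_mem {B : Matrix (Fin (n + 1)) (Fin (N + 1)) k}
    (hB : ∀ a, B a ∈ W.toSubmodule) (h1 : B.submatrix id I = 1) : W.graph I = B := by
  have hdet : (B.submatrix id I).det ≠ 0 := by simp [h1]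
  have hI := minors_ne_zero_of_mem hB hdet
  obtain ⟨c, hc, h⟩ := exists_minors_eq_smul hB hdet
  ext a b
  rw [graph_apply hI, ← det_submatrix_update h1, h]
  have := h I
  rw [h1, Matrix.det_one] at this
  field_simp
  linear_combination W.minors (Function.update I a b) * this

/-- The point of the Grassmannian with a given graph matrix. -/
def Grassmannian.ofGraph (B : Matrix (Fin (n + 1)) (Fin (N + 1)) k)
    (h1 : B.submatrix id I = 1) : Grassmannian k n N where
  toSubmodule := Submodule.span k (Set.range B.row)
  finrank_eq := by
    rw [finrank_span_eq_card, Fintype.card_fin]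
    rw [← Matrix.vecMul_injective_iff]
    intro v w hvw
    have h := congrArg (fun u => u ∘ I) hvw
    have h2 : ∀ v, Matrix.vecMul v B ∘ I = v := fun v => by
      have : Matrix.vecMul v B ∘ I = Matrix.vecMul v (B.submatrix id I) := rfl
      rw [this, h1, Matrix.vecMul_one]
    simpa only [h2] using h

theorem Grassmannian.mem_ofGraph (B : Matrix (Fin (n + 1)) (Fin (N + 1)) k)
    (h1 : B.submatrix id I = 1) (a : Fin (n + 1)) : B a ∈ (ofGraph B h1).toSubmodule :=
  Submodule.subset_span ⟨a, rfl⟩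

theorem Grassmannian.graph_injective {W' : Grassmannian k n N} (hI : W.minors I ≠ 0)
    (hI' : W'.minors I ≠ 0) (h : W.graph I = W'.graph I) : W = W' := by
  ext w
  rw [mem_iff hI, mem_iff hI', h]

theorem Grassmannian.plucker_rep_ne_zero_iff : W.plucker.rep I ≠ 0 ↔ W.minors I ≠ 0 :=
  rep_mk_apply_ne_zero_iff _ _

theorem Grassmannian.exists_minors_apply_ne_zero (W : Grassmannian k n N) :
    ∃ I, W.minors I ≠ 0 := by
  by_contra! h
  exact W.minors_ne_zero (funext h)

theorem Grassmannian.graph_eq_projChart (hI : W.minors I ≠ 0) (a : Fin (n + 1))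
    (c : Fin (N + 1)) : W.graph I a c = projChart I W.plucker (Function.update I a c) := by
  rw [graph_apply hI, plucker, projChart_mk]

theorem Grassmannian.plucker_injective :
    Function.Injective (Grassmannian.plucker (k := k) (n := n) (N := N)) := by
  intro W W' h
  obtain ⟨I, hI⟩ := W.exists_minors_apply_ne_zero
  have hI' : W'.minors I ≠ 0 := by
    rwa [← plucker_rep_ne_zero_iff, ← h, plucker_rep_ne_zero_iff]
  refine graph_injective hI hI' ?_
  ext a c
  rw [graph_eq_projChart hI, graph_eq_projChart hI', h]

end Graph

/-! ### The topology of the Grassmannian -/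

section Topology

variable {k : Type*} [Field k] {n N : ℕ}

theorem isClosed_singleton_projective {ι : Type*} (x : ℙ k (ι → k)) : IsClosed {x} := by
  have h : {x} = ⋂ (i : ι) (j : ι), {y : ℙ k (ι → k) |
      eval y.rep (C (x.rep j) * X i - C (x.rep i) * X j) ≠ 0}ᶜ := by
    ext y
    simp only [Set.mem_singleton_iff, Set.mem_iInter, Set.mem_compl_iff, Set.mem_ofPred_eq, not_not,
      map_sub, map_mul, eval_C, eval_X, sub_eq_zero]
    constructor
    · rintro rfl i j; ring
    · intro h
      obtain ⟨i, hi⟩ := exists_rep_apply_ne_zero x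
      rw [← y.mk_rep, ← x.mk_rep, Projectivization.mk_eq_mk_iff']
      refine ⟨y.rep i / x.rep i, funext fun j => ?_⟩
      have := h i j
      simp only [Pi.smul_apply, smul_eq_mul]
      field_simp
      rw [← this, mul_comm]
  rw [h]
  refine isClosed_iInter fun i => isClosed_iInter fun j => ?_
  rw [isClosed_compl_iff]
  exact isOpen_eval_rep_ne_zero (((isHomogeneous_C_mul_X _ _)).sub (isHomogeneous_C_mul_X _ _))

theorem Grassmannian.continuous_plucker :
    Continuous (Grassmannian.plucker (k := k) (n := n) (N := N)) := continuous_induced_dom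

theorem Grassmannian.isClosed_singleton (y : Grassmannian k n N) : IsClosed {y} := by
  have : {y} = plucker ⁻¹' {y.plucker} := by
    ext z
    exact plucker_injective.eq_iff.symm
  rw [this]
  exact (isClosed_singleton_projective _).preimage continuous_plucker

theorem Grassmannian.isOpen_minors_ne_zero (I : Fin (n + 1) → Fin (N + 1)) :
    IsOpen {y : Grassmannian k n N | y.minors I ≠ 0} := by
  simp only [← plucker_rep_ne_zero_iff]
  exact (isOpen_rep_apply_ne_zero I).preimage continuous_plucker

/-- The entries of the graph matrix are affine coordinates on the Grassmannian. -/
theorem Grassmannian.continuous_graph (I : Fin (n + 1) → Fin (N + 1)) :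
    Continuous (fun y : {y : Grassmannian k n N | y.minors I ≠ 0} =>
      (fun ac => y.1.graph I ac.1 ac.2 : AffSpace k (Fin (n + 1) × Fin (N + 1)))) := by
  let φ : {y : Grassmannian k n N | y.minors I ≠ 0} →
      {x : ℙ k ((Fin (n + 1) → Fin (N + 1)) → k) | x.rep I ≠ 0} := fun y =>
    ⟨y.1.plucker, plucker_rep_ne_zero_iff.2 y.2⟩
  have hφ : Continuous φ := (continuous_plucker.comp continuous_subtype_val).subtype_mk _
  have h := (AffSpace.continuous_polynomial (k := k)
    (fun ac : Fin (n + 1) × Fin (N + 1) => (X (Function.update I ac.1 ac.2) :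
      MvPolynomial (Fin (n + 1) → Fin (N + 1)) k))).comp ((continuous_projChart I).comp hφ)
  convert h using 1
  funext y ac
  simp only [Function.comp, eval_X, φ]
  exact graph_eq_projChart y.2 _ _

theorem Grassmannian.isOpen_eval_graph_ne_zero (I : Fin (n + 1) → Fin (N + 1))
    (β : MvPolynomial (Fin (n + 1) × Fin (N + 1)) k) :
    IsOpen {y : Grassmannian k n N | y.minors I ≠ 0 ∧ eval (fun ac => y.graph I ac.1 ac.2) β ≠ 0} := by
  have h := (isOpen_minors_ne_zero I).isOpenMap_subtype_val _
    ((AffSpace.isOpen_ne β).preimage (continuous_graph (k := k) I))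
  convert h using 1
  ext y
  constructor
  · rintro ⟨h1, h2⟩; exact ⟨⟨y, h1⟩, h2, rfl⟩
  · rintro ⟨y, h2, rfl⟩; exact ⟨y.2, h2⟩

end Topology

/-! ### Affine charts of the product variety -/

section Bihomogeneous

variable {k ι ι' : Type*} [Field k]

/-- The weights that define bihomogeneous polynomials. -/
abbrev biweight (ι ι' : Type*) : ι ⊕ ι' → ℕ × ℕ := Sum.elim (fun _ => (1, 0)) (fun _ => (0, 1))

theorem eval_smul_of_isBihomogeneous {d e : ℕ} {f : MvPolynomial (ι ⊕ ι') k}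
    (hf : f.IsWeightedHomogeneous (biweight ι ι') (d, e)) (c c' : k) (u : ι → k) (v : ι' → k) :
    eval (Sum.elim (c • u) (c' • v)) f = c ^ d * c' ^ e * eval (Sum.elim u v) f := by
  rw [f.as_sum, map_sum, map_sum, Finset.mul_sum]
  refine Finset.sum_congr rfl fun m hm => ?_
  have h1 : Finsupp.weight (biweight ι ι') m = (d, e) := hf (mem_support_iff.1 hm)
  have h2 : ∀ m : ι ⊕ ι' →₀ ℕ, (m.prod fun i a => Sum.elim (c • u) (c' • v) i ^ a) =
      c ^ (Finsupp.weight (biweight ι ι') m).1 * c' ^ (Finsupp.weight (biweight ι ι') m).2 *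
        m.prod fun i a => Sum.elim u v i ^ a := by
    intro m
    induction m using Finsupp.induction_linear with
    | zero => simp
    | add m m' hm hm' =>
      rw [Finsupp.prod_add_index' (by simp) (by intros; rw [pow_add]),
        Finsupp.prod_add_index' (by simp) (by intros; rw [pow_add]), hm, hm', map_add,
        Prod.fst_add, Prod.snd_add, pow_add, pow_add]
      ring
    | single i a =>
      rw [Finsupp.prod_single_index (by simp), Finsupp.prod_single_index (by simp),
        Finsupp.weight_single]
      cases i <;> simp [mul_pow]
  rw [eval_monomial, eval_monomial, h2, h1]
  ring

theorem eval_rep_rep_ne_zero_iff {d e : ℕ} {f : MvPolynomial (ι ⊕ ι') k}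
    (hf : f.IsWeightedHomogeneous (biweight ι ι') (d, e)) {u : ι → k} {v : ι' → k} (hu : u ≠ 0)
    (hv : v ≠ 0) : eval (Sum.elim (Projectivization.mk k u hu).rep
      (Projectivization.mk k v hv).rep) f ≠ 0 ↔ eval (Sum.elim u v) f ≠ 0 := by
  obtain ⟨c, hc⟩ := Projectivization.exists_smul_eq_mk_rep k u hu
  obtain ⟨c', hc'⟩ := Projectivization.exists_smul_eq_mk_rep k v hv
  rw [← hc, ← hc', Units.smul_def, Units.smul_def, eval_smul_of_isBihomogeneous hf, mul_ne_zero_iff,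
    and_iff_right (mul_ne_zero (pow_ne_zero _ c.ne_zero) (pow_ne_zero _ c'.ne_zero))]

/-- Bihomogenization of a polynomial in ratios of coordinates. -/
theorem exists_isBihomogeneous {τ : Type*} (s : τ → ι) (i₀ : ι) (j₀ : ι')
    (P : MvPolynomial (τ ⊕ ι') k) : ∃ (d e : ℕ) (f : MvPolynomial (ι ⊕ ι') k),
      f.IsWeightedHomogeneous (biweight ι ι') (d, e) ∧ ∀ (u : ι → k) (v : ι' → k), u i₀ ≠ 0 →
        v j₀ ≠ 0 → eval (Sum.elim u v) f = u i₀ ^ d * v j₀ ^ e *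
          eval (Sum.elim (fun t => u (s t) / u i₀) (fun l => v l / v j₀)) P := by
  have hX : ∀ i, (X (Sum.inl i) : MvPolynomial (ι ⊕ ι') k).IsWeightedHomogeneous
      (biweight ι ι') (1, 0) := fun i => isWeightedHomogeneous_X _ _ _
  have hX' : ∀ i, (X (Sum.inr i) : MvPolynomial (ι ⊕ ι') k).IsWeightedHomogeneous
      (biweight ι ι') (0, 1) := fun i => isWeightedHomogeneous_X _ _ _
  induction P using MvPolynomial.induction_on with
  | C a => exact ⟨0, 0, C a, isWeightedHomogeneous_C _ _, fun u v _ _ => by simp⟩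
  | add P Q hP hQ =>
    obtain ⟨d, e, f, hf, h⟩ := hP
    obtain ⟨d', e', g, hg, h'⟩ := hQ
    refine ⟨d + d', e + e', f * (X (Sum.inl i₀) ^ d' * X (Sum.inr j₀) ^ e') +
      g * (X (Sum.inl i₀) ^ d * X (Sum.inr j₀) ^ e), ?_, fun u v hu hv => ?_⟩
    · refine IsWeightedHomogeneous.add ?_ ?_
      · convert hf.mul (((hX i₀).pow d').mul ((hX' j₀).pow e')) using 1
        simp
      · convert hg.mul (((hX i₀).pow d).mul ((hX' j₀).pow e)) using 1
        simp [add_comm]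
    · simp only [map_add, map_mul, map_pow, eval_X, Sum.elim_inl, Sum.elim_inr, h u v hu hv,
        h' u v hu hv]
      ring
  | mul_X P i hP =>
    obtain ⟨d, e, f, hf, h⟩ := hP
    cases i with
    | inl t =>
      refine ⟨d + 1, e, f * X (Sum.inl (s t)), by simpa using hf.mul (hX (s t)),
        fun u v hu hv => ?_⟩
      simp only [map_mul, eval_X, Sum.elim_inl, h u v hu hv]
      field_simp
      ring
    | inr l =>
      refine ⟨d, e + 1, f * X (Sum.inr l), by simpa using hf.mul (hX' l),
        fun u v hu hv => ?_⟩
      simp only [map_mul, eval_X, Sum.elim_inr, h u v hu hv]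
      field_simp
      ring

end Bihomogeneous

section Charts

variable {k : Type*} [Field k] {n N N' : ℕ}

/-- Index set of the affine coordinates on a chart of the product variety: the entries of the graph
matrix of the plane and the coordinates of the point. -/
abbrev ChartIndex (n N N' : ℕ) : Type := (Fin (n + 1) × Fin (N + 1)) ⊕ Fin (N' + 1)

/-- The chart of the product variety on which a Plücker coordinate of the plane and a homogeneous
coordinate of the point do not vanish. -/
def chart (I : Fin (n + 1) → Fin (N + 1)) (j : Fin (N' + 1)) : Set (GrassProd k n N N') :=
  {z | z.plane.minors I ≠ 0 ∧ z.point.rep j ≠ 0}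

/-- The affine coordinates on a chart of the product variety, including the constant ones. -/
def chartCoord (I : Fin (n + 1) → Fin (N + 1)) (j : Fin (N' + 1)) (z : GrassProd k n N N') :
    ChartIndex n N N' → k :=
  Sum.elim (fun ac => z.plane.graph I ac.1 ac.2) (projChart j z.point)

/-- The polynomial that computes a maximal minor of the graph matrix. -/
def minorPoly (J : Fin (n + 1) → Fin (N + 1)) : MvPolynomial (ChartIndex n N N') k :=
  (Matrix.of fun a b => X (Sum.inl (a, J b))).det

theorem eval_minorPoly (J : Fin (n + 1) → Fin (N + 1)) (x : ChartIndex n N N' → k) :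
    eval x (minorPoly J) = ((Matrix.of fun a c => x (Sum.inl (a, c))).submatrix id J).det := by
  rw [minorPoly, RingHom.map_det]
  congr 1
  ext a b
  simp

theorem plucker_eq_minorPoly {I : Fin (n + 1) → Fin (N + 1)} {j : Fin (N' + 1)}
    {z : GrassProd k n N N'} (hz : z ∈ chart I j) :
    ∃ h : (fun J => eval (chartCoord I j z) (minorPoly J)) ≠ 0,
      z.plane.plucker = Projectivization.mk k _ h := by
  have hdet : ((z.plane.graph I).submatrix id I).det ≠ 0 := by
    rw [Grassmannian.graph_submatrix hz.1, Matrix.det_one]; exact one_ne_zero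
  obtain ⟨h, hz⟩ := Grassmannian.plucker_eq (z.plane.graph_mem I) hdet
  have h1 : (fun J => eval (chartCoord I j z) (minorPoly J)) =
      fun J => ((z.plane.graph I).submatrix id J).det := by
    funext J
    rw [eval_minorPoly]
    rfl
  exact ⟨h1 ▸ h, hz.trans (by congr 1; exact h1.symm)⟩

theorem eval_bind₁_eq {σ τ : Type*} (g : τ → MvPolynomial σ k) (x : σ → k) (f : MvPolynomial τ k) :
    eval x (bind₁ g f) = eval (fun t => eval x (g t)) f := by
  simp only [← coe_aeval_eq_eval, RingHom.coe_coe]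
  rw [aeval_bind₁]

theorem continuous_grassProd_iff {T : Type*} [TopologicalSpace T] {φ : T → GrassProd k n N N'} :
    Continuous φ ↔ ∀ (d e : ℕ) (f : MvPolynomial ((Fin (n + 1) → Fin (N + 1)) ⊕ Fin (N' + 1)) k),
      f.IsWeightedHomogeneous (biweight _ _) (d, e) →
        IsOpen {t | eval (Sum.elim (φ t).plane.plucker.rep (φ t).point.rep) f ≠ 0} := by
  rw [continuous_generateFrom_iff]
  exact ⟨fun h d e f hf => h _ ⟨d, e, f, hf, rfl⟩,
    by rintro h _ ⟨d, e, f, hf, rfl⟩; exact h d e f hf⟩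

theorem isOpen_grassProd {d e : ℕ} {f : MvPolynomial ((Fin (n + 1) → Fin (N + 1)) ⊕ Fin (N' + 1)) k}
    (hf : f.IsWeightedHomogeneous (biweight _ _) (d, e)) :
    IsOpen {z : GrassProd k n N N' | eval (Sum.elim z.plane.plucker.rep z.point.rep) f ≠ 0} :=
  isOpen_generateFrom_of_mem ⟨d, e, f, hf, rfl⟩

theorem continuous_plane : Continuous (GrassProd.plane (k := k) (n := n) (N := N) (N' := N')) := by
  refine continuous_induced_rng.2 (continuous_projective_iff.2 fun d f hf => ?_)
  have hf' : (rename Sum.inl f : MvPolynomial (_ ⊕ Fin (N' + 1)) k).IsWeightedHomogeneous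
      (biweight _ _) (d, 0) := by
    rw [f.as_sum, map_sum]
    refine (weightedHomogeneousSubmodule k _ _).sum_mem fun m hm => ?_
    rw [rename_monomial, mem_weightedHomogeneousSubmodule]
    refine isWeightedHomogeneous_monomial _ _ _ ?_
    have h1 : m.degree = d := by
      rw [Finsupp.degree_eq_weight_one]
      exact hf (mem_support_iff.1 hm)
    rw [Finsupp.weight_apply, Finsupp.sum_mapDomain_index (by simp) (by intros; rw [add_smul]), ← h1]
    simp [Finsupp.sum, Finsupp.degree_apply, Prod.ext_iff, Prod.fst_sum, Prod.snd_sum]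
  convert isOpen_grassProd hf' using 1
  ext z
  simp [eval_rename]

theorem continuous_point : Continuous (GrassProd.point (k := k) (n := n) (N := N) (N' := N')) := by
  refine continuous_projective_iff.2 fun d f hf => ?_
  have hf' : (rename Sum.inr f : MvPolynomial ((Fin (n + 1) → Fin (N + 1)) ⊕ _)
      k).IsWeightedHomogeneous (biweight _ _) (0, d) := by
    rw [f.as_sum, map_sum]
    refine (weightedHomogeneousSubmodule k _ _).sum_mem fun m hm => ?_
    rw [rename_monomial, mem_weightedHomogeneousSubmodule]
    refine isWeightedHomogeneous_monomial _ _ _ ?_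
    have h1 : m.degree = d := by
      rw [Finsupp.degree_eq_weight_one]
      exact hf (mem_support_iff.1 hm)
    rw [Finsupp.weight_apply, Finsupp.sum_mapDomain_index (by simp) (by intros; rw [add_smul]), ← h1]
    simp [Finsupp.sum, Finsupp.degree_apply, Prod.ext_iff, Prod.fst_sum, Prod.snd_sum]
  convert isOpen_grassProd hf' using 1
  ext z
  simp [eval_rename]

theorem isOpen_chart (I : Fin (n + 1) → Fin (N + 1)) (j : Fin (N' + 1)) :
    IsOpen (chart (k := k) I j) :=
  ((Grassmannian.isOpen_minors_ne_zero I).preimage continuous_plane).inter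
    ((isOpen_rep_apply_ne_zero j).preimage continuous_point)

theorem iUnion_chart : ⋃ Ij : (Fin (n + 1) → Fin (N + 1)) × Fin (N' + 1),
    chart (k := k) Ij.1 Ij.2 = Set.univ := by
  rw [Set.eq_univ_iff_forall]
  intro z
  obtain ⟨I, hI⟩ := z.plane.exists_minors_apply_ne_zero
  obtain ⟨j, hj⟩ := exists_rep_apply_ne_zero z.point
  exact Set.mem_iUnion.2 ⟨(I, j), hI, hj⟩

/-- Maps to the product variety that are given by polynomials in affine coordinates are
continuous. -/
theorem continuous_grassProd_of_polynomial {T σ : Type*} [TopologicalSpace T]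
    {κ : T → AffSpace k σ} (hκ : Continuous κ)
    (g : (Fin (n + 1) → Fin (N + 1)) → MvPolynomial σ k) (l : Fin (N' + 1) → MvPolynomial σ k)
    (φ : T → GrassProd k n N N')
    (hg : ∀ t, ∃ h : (fun i => eval (κ t) (g i)) ≠ 0,
      (φ t).plane.plucker = Projectivization.mk k _ h)
    (hl : ∀ t, ∃ h : (fun i => eval (κ t) (l i)) ≠ 0, (φ t).point = Projectivization.mk k _ h) :
    Continuous φ := by
  rw [continuous_grassProd_iff]
  intro d e f hf
  convert (AffSpace.isOpen_ne f).preimage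
    ((AffSpace.continuous_polynomial (Sum.elim g l)).comp hκ) using 1
  ext t
  obtain ⟨h, ht⟩ := hg t
  obtain ⟨h', ht'⟩ := hl t
  rw [Set.mem_ofPred_eq, ht, ht', eval_rep_rep_ne_zero_iff hf]
  have : (fun i => eval (κ t) (Sum.elim g l i)) =
      Sum.elim (fun i => eval (κ t) (g i)) (fun i => eval (κ t) (l i)) := by
    funext i; cases i <;> rfl
  simp only [Set.mem_preimage, Function.comp, this]
  rfl

theorem chartCoord_injOn (I : Fin (n + 1) → Fin (N + 1)) (j : Fin (N' + 1)) :
    Set.InjOn (chartCoord (k := k) I j) (chart I j) := by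
  intro z hz w hw h
  have h1 : z.plane = w.plane := Grassmannian.graph_injective hz.1 hw.1
    (Matrix.ext fun a c => congrFun h (Sum.inl (a, c)))
  have h2 : projChart j z.point = projChart j w.point := funext fun l => congrFun h (Sum.inr l)
  refine GrassProd.ext h1 ?_
  rw [← mk_projChart hz.2, ← mk_projChart hw.2]
  congr 1

/-- The image of a chart is cut out by the equations that say that the constant coordinates have
their values. -/
theorem exists_chartCoord_eq {I : Fin (n + 1) → Fin (N + 1)} {j : Fin (N' + 1)}
    {x : ChartIndex n N N' → k} (h1 : ∀ a b, x (Sum.inl (a, I b)) = if a = b then 1 else 0)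
    (h2 : x (Sum.inr j) = 1) : ∃ z ∈ chart I j, chartCoord I j z = x := by
  have hB : (Matrix.of fun a c => x (Sum.inl (a, c))).submatrix id I = 1 := by
    ext a b
    rw [Matrix.one_apply]
    exact h1 a b
  have hv : (fun l => x (Sum.inr l)) ≠ 0 := fun h => by
    have := congrFun h j
    simp [h2] at this
  let W := Grassmannian.ofGraph _ hB
  have hdet : ((Matrix.of fun a c => x (Sum.inl (a, c))).submatrix id I).det ≠ 0 := by simp [hB]
  refine ⟨⟨W, Projectivization.mk k _ hv⟩,
    ⟨Grassmannian.minors_ne_zero_of_mem (Grassmannian.mem_ofGraph _ hB) hdet, ?_⟩, ?_⟩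
  · rw [rep_mk_apply_ne_zero_iff, h2]; exact one_ne_zero
  · funext i
    rcases i with ⟨a, c⟩ | l
    · exact congrFun (congrFun (Grassmannian.graph_eq_of_mem (Grassmannian.mem_ofGraph _ hB) hB) a) c
    · change projChart j (Projectivization.mk k _ hv) l = _
      simp only [projChart_mk, h2, div_one]

theorem isClosedEmbedding_chartCoord (I : Fin (n + 1) → Fin (N + 1)) (j : Fin (N' + 1)) :
    IsClosedEmbedding (fun z : chart (k := k) I j =>
      (chartCoord I j z.1 : AffSpace k (ChartIndex n N N'))) := by
  have hcont : Continuous (fun z : chart (k := k) I j =>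
      (chartCoord I j z.1 : AffSpace k (ChartIndex n N N'))) := by
    rw [AffSpace.continuous_iff]
    intro P
    obtain ⟨d, e, f, hf, h⟩ := exists_isBihomogeneous
      (fun ac : Fin (n + 1) × Fin (N + 1) => Function.update I ac.1 ac.2) I j P
    have hset : {z : chart (k := k) I j | eval (chartCoord I j z.1) P ≠ 0} = Subtype.val ⁻¹'
        {z | eval (Sum.elim z.plane.plucker.rep z.point.rep) f ≠ 0} := by
      ext z
      have h1 : z.1.plane.plucker.rep I ≠ 0 := Grassmannian.plucker_rep_ne_zero_iff.2 z.2.1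
      have h2 : chartCoord I j z.1 = Sum.elim (fun t : Fin (n + 1) × Fin (N + 1) =>
          z.1.plane.plucker.rep (Function.update I t.1 t.2) / z.1.plane.plucker.rep I)
          (fun l => z.1.point.rep l / z.1.point.rep j) := by
        rw [chartCoord]
        congr 1
        funext ac
        exact Grassmannian.graph_eq_projChart z.2.1 _ _
      rw [Set.mem_ofPred_eq, Set.mem_preimage, Set.mem_ofPred_eq, h _ _ h1 z.2.2, h2,
        mul_ne_zero_iff, and_iff_right (mul_ne_zero (pow_ne_zero _ h1) (pow_ne_zero _ z.2.2))]
    exact hset ▸ (isOpen_grassProd hf).preimage continuous_subtype_val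
  refine ⟨⟨⟨le_antisymm hcont.le_induced ?_⟩, ?_⟩, ?_⟩
  · change _ ≤ induced Subtype.val (generateFrom _)
    rw [induced_generateFrom_eq]
    refine le_generateFrom ?_
    rintro _ ⟨_, ⟨d, e, f, hf, rfl⟩, rfl⟩
    refine isOpen_induced_iff.2 ⟨_, AffSpace.isOpen_ne
      (bind₁ (Sum.elim minorPoly (fun l => X (Sum.inr l))) f), ?_⟩
    ext z
    have h1 : eval (chartCoord I j z.1)
        (bind₁ (Sum.elim minorPoly (fun l => X (Sum.inr l))) f) =
        eval (Sum.elim (fun J => eval (chartCoord I j z.1) (minorPoly J)) (projChart j z.1.point))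
          f := by
      rw [eval_bind₁_eq]
      congr 2
      funext i
      cases i with
      | inl J => rfl
      | inr l => simp [chartCoord]
    obtain ⟨h, hz⟩ := plucker_eq_minorPoly z.2
    rw [Set.mem_preimage, Set.mem_ofPred_eq, Set.mem_preimage, Set.mem_ofPred_eq, h1, hz]
    conv_rhs => rw [← mk_projChart z.2.2]
    rw [eval_rep_rep_ne_zero_iff hf]
  · exact fun z w h => Subtype.ext (chartCoord_injOn I j z.2 w.2 h)
  · have : Set.range (fun z : chart (k := k) I j =>
        (chartCoord I j z.1 : AffSpace k (ChartIndex n N N'))) =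
        (⋂ (a) (b), {x | eval x (X (Sum.inl (a, I b)) - C (if a = b then 1 else 0)) = 0}) ∩
          {x | eval x (X (Sum.inr j) - 1) = 0} := by
      ext x
      simp only [Set.mem_range, Set.mem_inter_iff, Set.mem_iInter, Set.mem_ofPred_eq, map_sub, eval_X,
        eval_C, map_one, sub_eq_zero]
      constructor
      · rintro ⟨z, rfl⟩
        exact ⟨Grassmannian.graph_apply_self z.2.1, projChart_self z.2.2⟩
      · rintro ⟨h1, h2⟩
        obtain ⟨z, hz, rfl⟩ := exists_chartCoord_eq h1 h2
        exact ⟨⟨z, hz⟩, rfl⟩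
    rw [this]
    exact (isClosed_iInter fun a => isClosed_iInter fun b => AffSpace.isClosed_eq _).inter
      (AffSpace.isClosed_eq _)

/-! ### Roots of the coordinates of the plane -/

section Roots

variable (p : ℕ) [hp : Fact p.Prime] [CharP k p] [PerfectRing k p]

/-- Taking `p`-th roots of some of the coordinates of an affine space is a homeomorphism for the
Zariski topology. -/
def rootHomeomorph (τ τ' : Type*) : AffSpace k (τ ⊕ τ') ≃ₜ AffSpace k (τ ⊕ τ') where
  toFun x := Sum.elim (fun t => (frobeniusEquiv k p).symm (x (Sum.inl t))) (fun l => x (Sum.inr l))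
  invFun x := Sum.elim (fun t => x (Sum.inl t) ^ p) (fun l => x (Sum.inr l))
  left_inv x := by
    funext i
    cases i with
    | inl t => exact frobenius_apply_frobeniusEquiv_symm k p _
    | inr l => rfl
  right_inv x := by
    funext i
    cases i with
    | inl t => exact frobeniusEquiv_symm_apply_frobenius k p _
    | inr l => rfl
  continuous_toFun := by
    -- `P` vanishes at the image of `x` if and only if `P ^ p` does, and `P ^ p` is a polynomial in `x`
    rw [AffSpace.continuous_iff]
    intro P
    convert AffSpace.isOpen_ne (bind₁ (Sum.elim (fun t => X (Sum.inl t))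
      (fun l => X (Sum.inr l) ^ p)) (map (frobenius k p) P)) using 1
    ext x
    rw [Set.mem_ofPred_eq, Set.mem_ofPred_eq, eval_bind₁_eq, ← pow_ne_zero_iff hp.out.ne_zero]
    have h := eval₂_comp_left (frobenius k p) (RingHom.id k) (Sum.elim
      (fun t => (frobeniusEquiv k p).symm (x (Sum.inl t))) (fun l => x (Sum.inr l))) P
    rw [← frobenius_def, eval_map]
    refine not_congr (Eq.congr_left (h.trans ?_))
    congr 1
    funext i
    cases i with
    | inl t => simp
    | inr l => simp [frobenius_def]
  continuous_invFun := by
    have h := AffSpace.continuous_polynomial (k := k) (Sum.elim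
      (fun t : τ => (X (Sum.inl t) ^ p : MvPolynomial (τ ⊕ τ') k)) (fun l => X (Sum.inr l)))
    convert h using 2 with x
    funext i
    cases i <;> simp

/-- The affine coordinates on a chart of the product variety, with the entries of the graph matrix
replaced by their `p`-th roots. -/
def rootCoord (I : Fin (n + 1) → Fin (N + 1)) (j : Fin (N' + 1)) (z : GrassProd k n N N') :
    ChartIndex n N N' → k :=
  rootHomeomorph p _ _ (chartCoord I j z)

theorem rootCoord_inl_pow (I : Fin (n + 1) → Fin (N + 1)) (j : Fin (N' + 1))
    (z : GrassProd k n N N') (a : Fin (n + 1)) (c : Fin (N + 1)) :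
    rootCoord p I j z (Sum.inl (a, c)) ^ p = z.plane.graph I a c :=
  frobenius_apply_frobeniusEquiv_symm k p _

theorem rootCoord_inr (I : Fin (n + 1) → Fin (N + 1)) (j l : Fin (N' + 1))
    (z : GrassProd k n N N') : rootCoord p I j z (Sum.inr l) = projChart j z.point l :=
  rfl

theorem isClosedEmbedding_rootCoord (I : Fin (n + 1) → Fin (N + 1)) (j : Fin (N' + 1)) :
    IsClosedEmbedding (fun z : chart (k := k) I j =>
      (rootCoord p I j z.1 : AffSpace k (ChartIndex n N N'))) :=
  (rootHomeomorph p _ _).isClosedEmbedding.comp (isClosedEmbedding_chartCoord I j)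

end Roots

end Charts

/-! ### Continuity of the graph of the Gauss map -/

section GaussGraph

variable {k : Type*} [Field k] {N : ℕ}

/-- The differentials may be evaluated at any representative of the point. -/
theorem mem_tangentSpace_mk_iff {X : Set (PSpace k N)} {u : Fin (N + 1) → k} (hu : u ≠ 0)
    (v : Fin (N + 1) → k) : v ∈ tangentSpace X (Projectivization.mk k u hu) ↔
      ∀ (d : ℕ) (f : MvPolynomial (Fin (N + 1)) k), f.IsHomogeneous d →
        (∀ z ∈ X, eval z.rep f = 0) → ∑ i, eval u (pderiv i f) * v i = 0 := by
  obtain ⟨c, hc⟩ := Projectivization.exists_smul_eq_mk_rep k u hu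
  refine forall₂_congr fun d f => forall₂_congr fun hf hX => ?_
  rw [← hc, Units.smul_def]
  have h : ∀ i, eval ((c : k) • u) (pderiv i f) = (c : k) ^ (d - 1) * eval u (pderiv i f) :=
    fun i => eval_smul_of_isHomogeneous hf.pderiv _ _
  simp only [h, mul_assoc, ← Finset.mul_sum]
  rw [mul_eq_zero, or_iff_right (pow_ne_zero _ c.ne_zero)]

theorem mem_tangentSpace_iff_projChart {X : Set (PSpace k N)} {i : Fin (N + 1)} {x : PSpace k N}
    (hx : x.rep i ≠ 0) (v : Fin (N + 1) → k) : v ∈ tangentSpace X x ↔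
      ∀ (d : ℕ) (f : MvPolynomial (Fin (N + 1)) k), f.IsHomogeneous d →
        (∀ z ∈ X, eval z.rep f = 0) → ∑ l, eval (projChart i x) (pderiv l f) * v l = 0 := by
  conv_lhs => rw [← mk_projChart hx]
  exact mem_tangentSpace_mk_iff _ v

/-- Near a smooth point, the tangent spaces have bases that are polynomial in affine coordinates:
the tangent space is cut out by differentials that, together with `n + 1` coordinate functions,
form an invertible matrix, and the basis consists of columns of the adjugate matrix. -/
theorem exists_local_frame {n : ℕ} {X : Set (PSpace k N)} {x₀ : PSpace k N}
    (hx₀ : x₀ ∈ smoothLocus n X) {i : Fin (N + 1)} (hi : x₀.rep i ≠ 0) :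
    ∃ (D : MvPolynomial (Fin (N + 1)) k)
      (E : Matrix (Fin (n + 1)) (Fin (N + 1)) (MvPolynomial (Fin (N + 1)) k))
      (I : Fin (n + 1) → Fin (N + 1)), eval (projChart i x₀) D ≠ 0 ∧
      ∀ x ∈ smoothLocus n X, x.rep i ≠ 0 → eval (projChart i x) D ≠ 0 →
        (∀ a, (E.map (eval (projChart i x))) a ∈ tangentSpace X x) ∧
        ((E.map (eval (projChart i x))).submatrix id I).det ≠ 0 := by
  classical
  let W : Grassmannian k n N := gaussMap n X ⟨x₀, hx₀⟩
  obtain ⟨I, hI⟩ := W.exists_minors_apply_ne_zero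
  have hIinj : Function.Injective I := by
    intro a b hab
    have h1 := Grassmannian.graph_apply_self hI a b
    rw [← hab, Grassmannian.graph_apply_self hI, if_pos rfl] at h1
    by_contra hne
    simp [hne] at h1
  -- complete the coordinate functions with indices in `I` by differentials of equations of `X` to a
  -- basis of the linear forms
  let grad : {f : MvPolynomial (Fin (N + 1)) k // (∃ d, f.IsHomogeneous d) ∧
    ∀ z ∈ X, eval z.rep f = 0} → (Fin (N + 1) → k) := fun f l =>
      eval (projChart i x₀) (pderiv l f.1)
  let s : Set (Fin (N + 1) → k) := Set.range fun b => Pi.single (I b) 1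
  have hs : LinearIndepOn k id s := by
    have h : LinearIndependent k (fun b => (Pi.single (I b) 1 : Fin (N + 1) → k)) :=
      (Pi.linearIndependent_single_one (Fin (N + 1)) k).comp I hIinj
    exact h.linearIndepOn_id
  obtain ⟨b, hbt, hsb, hspan, hlin⟩ := exists_linearIndepOn_extension hs
    (Set.subset_union_left (t := Set.range grad))
  have htop : Submodule.span k (s ∪ Set.range grad) = ⊤ := by
    by_contra hne
    obtain ⟨f, hf, hker⟩ := Submodule.exists_le_ker_of_lt_top _ (lt_top_iff_ne_top.2 hne)
    let v : Fin (N + 1) → k := fun l => f (Pi.single l 1)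
    have hfv : ∀ w, f w = ∑ l, w l * v l := fun w => by
      conv_lhs => rw [pi_eq_sum_univ' w]
      simp [v]
    have hv : v ∈ W.toSubmodule := by
      refine (mem_tangentSpace_iff_projChart hi v).2 fun d g hg hgX => ?_
      have := hker (Submodule.subset_span (Or.inr ⟨⟨g, ⟨d, hg⟩, hgX⟩, rfl⟩))
      rw [LinearMap.mem_ker, hfv] at this
      exact this
    have hvI : v ∘ I = 0 := funext fun b =>
      hker (Submodule.subset_span (Or.inl ⟨b, rfl⟩))
    rw [Grassmannian.mem_iff hI, hvI, Matrix.zero_vecMul] at hv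
    refine hf (LinearMap.ext fun w => ?_)
    rw [hfv, hv]
    simp
  have hcard : Nonempty (Fin (N + 1) ≃ b) := by
    have hb : Submodule.span k (Set.range (fun x : b => (x : Fin (N + 1) → k))) = ⊤ := by
      rw [Subtype.range_coe, eq_top_iff, ← htop, Submodule.span_le]
      simpa using hspan
    let B := Module.Basis.mk hlin hb.ge
    exact ⟨(Pi.basisFun k (Fin (N + 1))).indexEquiv B⟩
  obtain ⟨e⟩ := hcard
  -- the members of the basis are values at `x₀` of rows of polynomials: constants or gradients
  have hrow : ∀ r, ∃ g : Fin (N + 1) → MvPolynomial (Fin (N + 1)) k,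
      (∀ l, eval (projChart i x₀) (g l) = (e r).1 l) ∧
      ((e r).1 ∈ s → ∀ l, g l = C ((e r).1 l)) ∧
      ((e r).1 ∉ s → ∃ (d : ℕ) (f : MvPolynomial (Fin (N + 1)) k), f.IsHomogeneous d ∧
          (∀ z ∈ X, eval z.rep f = 0) ∧ ∀ l, g l = pderiv l f) := by
    intro r
    by_cases hr : (e r).1 ∈ s
    · exact ⟨fun l => C ((e r).1 l), fun l => eval_C _, fun _ _ => rfl, fun h => (h hr).elim⟩
    · obtain ⟨f, hf⟩ := (hbt (e r).2).resolve_left hr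
      obtain ⟨d, hd⟩ := f.2.1
      exact ⟨fun l => pderiv l f.1, fun l => congrFun hf l, fun h => (hr h).elim,
        fun _ => ⟨d, f.1, hd, f.2.2, fun l => rfl⟩⟩
  choose g hg hgs hgS using hrow
  let M : Matrix (Fin (N + 1)) (Fin (N + 1)) (MvPolynomial (Fin (N + 1)) k) := Matrix.of g
  choose r hr using fun c => (⟨e.symm ⟨_, hsb ⟨c, rfl⟩⟩, by simp⟩ :
    ∃ r, (e r).1 = (Pi.single (I c) 1 : Fin (N + 1) → k))
  have hrinj : Function.Injective r := by
    intro a b hab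
    have h1 := hr a
    rw [hab, hr b] at h1
    by_contra hne
    have := congrFun h1 (I a)
    simp [hIinj.ne hne] at this
  have hdetx : ∀ u : Fin (N + 1) → k, eval u M.det = (M.map (eval u)).det := fun u =>
    RingHom.map_det _ _
  have hadj : ∀ u : Fin (N + 1) → k, M.adjugate.map (eval u) = (M.map (eval u)).adjugate :=
    fun u => RingHom.map_adjugate _ _
  have hsrow : ∀ (u : Fin (N + 1) → k) (ρ : Fin (N + 1)) (c : Fin (n + 1)),
      (e ρ).1 = Pi.single (I c) 1 → ∀ v : Fin (N + 1) → k,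
        ∑ l, (M.map (eval u)) ρ l * v l = v (I c) := by
    intro u ρ c hc v
    have h1 : ∀ l, (M.map (eval u)) ρ l = (Pi.single (I c) 1 : Fin (N + 1) → k) l := by
      intro l
      change eval u (g ρ l) = _
      rw [hgs ρ (hc ▸ ⟨c, rfl⟩), eval_C, hc]
    simp only [h1, Pi.single_apply, ite_mul, one_mul, zero_mul]
    rw [Finset.sum_ite_eq' Finset.univ (I c), if_pos (Finset.mem_univ _)]
  -- the columns of the adjugate that belong to the coordinate functions are a basis of the common
  -- kernel of the other rows
  refine ⟨M.det, Matrix.of fun c l => M.adjugate l (r c), I, ?_, fun x hx hxi hD => ?_⟩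
  · rw [hdetx]
    have h1 : LinearIndependent k (M.map (eval (projChart i x₀))).row := by
      have h2 : (M.map (eval (projChart i x₀))).row = (fun y : b => y.1) ∘ e := by
        funext ρ l
        exact hg ρ l
      rw [h2]
      exact LinearIndependent.comp hlin _ e.injective
    exact ((Matrix.isUnit_iff_isUnit_det _).1
      (Matrix.linearIndependent_rows_iff_isUnit.1 h1)).ne_zero
  · rw [hdetx] at hD
    set Mx := M.map (eval (projChart i x)) with hMx
    let E : Matrix (Fin (n + 1)) (Fin (N + 1)) k := fun c l => Mx.adjugate l (r c)
    have hE : (Matrix.of fun c l => M.adjugate l (r c)).map (eval (projChart i x)) = E := by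
      ext c l
      exact congrFun (congrFun (hadj (projChart i x)) l) (r c)
    rw [hE]
    have hME : ∀ ρ c, ∑ l, Mx ρ l * E c l = if ρ = r c then Mx.det else 0 := by
      intro ρ c
      have := congrFun (congrFun (Matrix.mul_adjugate Mx) ρ) (r c)
      rw [Matrix.mul_apply, Matrix.smul_apply, Matrix.one_apply] at this
      simpa using this
    constructor
    -- the tangent space is contained in the kernel of the gradients among the rows, and the two have
    -- the same dimension
    · let K : Submodule k (Fin (N + 1) → k) :=
        { carrier := {v | ∀ ρ, (e ρ).1 ∉ s → ∑ l, Mx ρ l * v l = 0}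
          zero_mem' := fun ρ _ => by simp
          add_mem' := fun {v w} hv hw ρ hρ => by
            simp [mul_add, Finset.sum_add_distrib, hv ρ hρ, hw ρ hρ]
          smul_mem' := fun c v hv ρ hρ => by
            have := hv ρ hρ
            simp only [Pi.smul_apply, smul_eq_mul, mul_left_comm _ c, ← Finset.mul_sum, this,
              mul_zero] }
      have hle : tangentSpace X x ≤ K := by
        intro v hv ρ hρ
        obtain ⟨d, f, hf, hX, hfg⟩ := hgS ρ hρ
        have h1 := (mem_tangentSpace_iff_projChart hxi v).1 hv d f hf hX
        simp only [← hfg] at h1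
        exact h1
      have hK : Module.finrank k K ≤ n + 1 := by
        have hinj : Function.Injective ((LinearMap.funLeft k k I).comp K.subtype) := by
          rw [injective_iff_map_eq_zero]
          intro v hv
          have h1 : Mx.mulVec v.1 = 0 := by
            funext ρ
            by_cases hρ : (e ρ).1 ∈ s
            · obtain ⟨c, hc⟩ := hρ
              exact (hsrow _ ρ c hc.symm v.1).trans (congrFun hv c)
            · exact v.2 ρ hρ
          exact Subtype.ext (Matrix.eq_zero_of_mulVec_eq_zero hD h1)
        simpa using LinearMap.finrank_le_finrank_of_injective hinj
      have hTK : tangentSpace X x = K :=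
        Submodule.eq_of_le_of_finrank_le hle (hx.2.symm ▸ hK)
      intro c
      rw [hTK]
      intro ρ hρ
      rw [hME, if_neg]
      rintro rfl
      exact hρ ((hr c).symm ▸ ⟨c, rfl⟩)
    · have h1 : E.submatrix id I = Mx.det • 1 := by
        ext a c
        rw [Matrix.smul_apply, Matrix.one_apply, Matrix.submatrix_apply, id,
          ← hsrow (projChart i x) (r c) c (hr c) (E a), hME]
        by_cases hac : a = c
        · simp [hac]
        · rw [if_neg fun h => hac (hrinj h).symm, if_neg hac, smul_zero]
      rw [h1, Matrix.det_smul, Matrix.det_one, mul_one]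
      exact pow_ne_zero _ hD

/-- A smooth point together with its tangent space, as a point of the product variety. -/
def gaussGraph (n : ℕ) (X : Set (PSpace k N)) (x : smoothLocus n X) : GrassProd k n N N :=
  ⟨gaussMap n X x, x.1⟩

/-- The Gauss map is continuous on the smooth locus, and so is its graph as a map to the product
variety. -/
theorem continuous_gaussGraph (n : ℕ) (X : Set (PSpace k N)) : Continuous (gaussGraph n X) := by
  rw [continuous_iff_continuousAt]
  intro x₀
  obtain ⟨i, hi⟩ := exists_rep_apply_ne_zero x₀.1
  obtain ⟨D, E, I, hD, hE⟩ := exists_local_frame x₀.2 hi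
  let C : Set (PSpace k N) := {x | x.rep i ≠ 0}
  have hC : IsOpen C := isOpen_rep_apply_ne_zero i
  let O : Set (PSpace k N) := Subtype.val '' {x : C | eval (projChart i x.1) D ≠ 0}
  have hO : IsOpen O := hC.isOpenMap_subtype_val _
    ((AffSpace.isOpen_ne D).preimage (continuous_projChart i))
  have hOC : ∀ x ∈ O, x.rep i ≠ 0 ∧ eval (projChart i x) D ≠ 0 := by
    rintro _ ⟨x, hx, rfl⟩
    exact ⟨x.2, hx⟩
  have hxO : x₀ ∈ (Subtype.val ⁻¹' O : Set (smoothLocus n X)) := ⟨⟨x₀.1, hi⟩, hD, rfl⟩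
  suffices h : ContinuousOn (gaussGraph n X) (Subtype.val ⁻¹' O) from
    h.continuousAt ((hO.preimage continuous_subtype_val).mem_nhds hxO)
  rw [continuousOn_iff_continuous_domRestrict]
  have hκ : Continuous (fun x : (Subtype.val ⁻¹' O : Set (smoothLocus n X)) =>
      (projChart i x.1.1 : AffSpace k (Fin (N + 1)))) := by
    have h1 : Continuous (fun x : (Subtype.val ⁻¹' O : Set (smoothLocus n X)) =>
        (⟨x.1.1, (hOC _ x.2).1⟩ : C)) :=
      (continuous_subtype_val.comp continuous_subtype_val).subtype_mk _
    exact (continuous_projChart i).comp h1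
  refine continuous_grassProd_of_polynomial hκ (fun J => (E.submatrix id J).det)
    MvPolynomial.X _ ?_ ?_
  · intro x
    obtain ⟨hmem, hdet⟩ := hE x.1.1 x.1.2 (hOC _ x.2).1 (hOC _ x.2).2
    obtain ⟨h, hx⟩ := Grassmannian.plucker_eq (W := gaussMap n X x.1) hmem hdet
    have h1 : (fun J : Fin (n + 1) → Fin (N + 1) => eval (projChart i x.1.1) (E.submatrix id J).det) =
        fun J => ((E.map (eval (projChart i x.1.1))).submatrix id J).det := by
      funext J
      rw [RingHom.map_det]
      rfl
    exact ⟨h1 ▸ h, hx.trans (by congr 1; exact h1.symm)⟩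
  · intro x
    have h1 : (fun l => eval (projChart i x.1.1) (MvPolynomial.X l)) = projChart i x.1.1 := by
      funext l; simp
    exact ⟨h1.symm ▸ projChart_ne_zero (hOC _ x.2).1,
      (mk_projChart (hOC _ x.2).1).symm.trans (by congr 1; exact h1.symm)⟩

end GaussGraph

/-! ### Varieties swept out by families of linear subspaces -/

/-- The chain rule for differentials. -/
theorem D_aeval {k L τ : Type*} [Field k] [Field L] [Algebra k L] [Fintype τ] (z : τ → L)
    (f : MvPolynomial τ k) :
    D k L (aeval z f) = ∑ c, aeval z (pderiv c f) • D k L (z c) := by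
  classical
  induction f using MvPolynomial.induction_on with
  | C a => simp
  | add f g hf hg => simp [hf, hg, add_smul, Finset.sum_add_distrib]
  | mul_X f i hf =>
    simp only [map_mul, aeval_X, Derivation.leibniz, hf, pderiv_X, map_add, smul_eq_mul, add_smul,
      Finset.sum_add_distrib, Finset.smul_sum, mul_smul]
    congr 1
    rw [Finset.sum_eq_single i (fun c _ hc => by simp [hc.symm])
      (fun h => (h (Finset.mem_univ _)).elim)]
    simp

/-- A family, parametrized by an affine variety `T` with generic point `ξ`, of linear subspaces
`W t` of dimension `n + 1` that are graphs over the coordinates in `I`, with a vector in each of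
them. The entries of the graph matrix of `W t` are the `p`-th powers of the values of the polynomials
`root a c`, and the vector has the coordinates `coeff a` with respect to the basis that consists of
the rows of this matrix. The nonconstant coefficients have linearly independent differentials at the
generic point, and the coefficients and the entries of the graph matrix generate the function
field. -/
structure TangentFamily (p : ℕ) (k : Type*) [Field k] {n N : ℕ} (I : Fin (n + 1) → Fin (N + 1))
    (σ : Type*) (T : Type*) [TopologicalSpace T] (L : Type*) [Field L] [Algebra k L] where
  coord : T → AffSpace k σ
  isClosedEmbedding : IsClosedEmbedding coord
  ξ : σ → L
  isGeneric : IsGeneric coord ξ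
  trdeg_eq : Algebra.trdeg k L = n
  coeff : Fin (n + 1) → MvPolynomial σ k
  root : Fin (n + 1) → Fin (N + 1) → MvPolynomial σ k
  eval_coeff_zero : ∀ t, eval (coord t) (coeff 0) = 1
  eval_root : ∀ t a b, eval (coord t) (root a (I b)) ^ p = if a = b then 1 else 0
  linearIndependent : LinearIndependent L fun i : Fin n => D k L (aeval ξ (coeff i.succ))
  eq_top : ∀ K : IntermediateField k L, (∀ i : Fin n, aeval ξ (coeff i.succ) ∈ K) →
    (∀ a c, aeval ξ (root a c) ^ p ∈ K) → K = ⊤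

namespace TangentFamily

variable {p : ℕ} {k : Type u} [Field k] {n N : ℕ} {I : Fin (n + 1) → Fin (N + 1)}
  {σ : Type} {T : Type*} [TopologicalSpace T] {L : Type u} [Field L] [Algebra k L]

variable (P : TangentFamily p k I σ T L)

/-- The graph matrix of the subspace with parameter `t`. -/
def graph (t : T) : Matrix (Fin (n + 1)) (Fin (N + 1)) k :=
  Matrix.of fun a c => eval (P.coord t) (P.root a c) ^ p

/-- The coordinates of the vector of the family, as polynomials. -/
def vecPoly (c : Fin (N + 1)) : MvPolynomial σ k := ∑ a, P.coeff a * P.root a c ^ p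

/-- The vector of the family with parameter `t`. -/
def vec (t : T) : Fin (N + 1) → k := fun c => eval (P.coord t) (P.vecPoly c)

/-- The vector of the family at the generic point. -/
def genVec : Fin (N + 1) → L := fun c => aeval P.ξ (P.vecPoly c)

theorem graph_submatrix (t : T) : (P.graph t).submatrix id I = 1 := by
  ext a b
  rw [Matrix.one_apply]
  exact P.eval_root t a b

theorem vec_apply (t : T) (c : Fin (N + 1)) :
    P.vec t c = ∑ a, eval (P.coord t) (P.coeff a) * P.graph t a c := by
  simp [vec, vecPoly, graph]

theorem vec_apply_I (t : T) (b : Fin (n + 1)) : P.vec t (I b) = eval (P.coord t) (P.coeff b) := by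
  simp [vec_apply, graph, P.eval_root]

theorem vec_apply_zero (t : T) : P.vec t (I 0) = 1 := by
  rw [vec_apply_I, P.eval_coeff_zero]

theorem vec_ne_zero (t : T) : P.vec t ≠ 0 := fun h => by
  simpa [vec_apply_zero] using congrFun h (I 0)

theorem injective_index (P : TangentFamily p k I σ T L) [Nonempty T] : Function.Injective I := by
  obtain ⟨t⟩ := (inferInstance : Nonempty T)
  intro a b hab
  have h1 := P.eval_root t a b
  rw [← hab, P.eval_root, if_pos rfl] at h1
  by_contra hne
  simp [hne] at h1

theorem aeval_coeff_zero : aeval P.ξ (P.coeff 0) = 1 := by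
  have := (P.isGeneric (P.coeff 0 - 1)).2 fun t => by simp [P.eval_coeff_zero]
  simpa [sub_eq_zero] using this

theorem aeval_root (a b : Fin (n + 1)) :
    aeval P.ξ (P.root a (I b)) ^ p = if a = b then 1 else 0 := by
  have := (P.isGeneric (P.root a (I b) ^ p - C (if a = b then 1 else 0))).2 fun t => by
    simp [P.eval_root]
  rw [map_sub, map_pow, sub_eq_zero] at this
  rw [this]
  split_ifs <;> simp

theorem genVec_apply_I (b : Fin (n + 1)) : P.genVec (I b) = aeval P.ξ (P.coeff b) := by
  simp [genVec, vecPoly, P.aeval_root]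

theorem genVec_eq (c : Fin (N + 1)) : P.genVec c = aeval P.ξ (P.root 0 c) ^ p +
    ∑ i : Fin n, aeval P.ξ (P.coeff i.succ) * aeval P.ξ (P.root i.succ c) ^ p := by
  simp [genVec, vecPoly, Fin.sum_univ_succ, P.aeval_coeff_zero]

/-- Polynomial relations hold at the generic vector if and only if they hold at all vectors of the
family. -/
theorem aeval_genVec_eq_zero_iff (f : MvPolynomial (Fin (N + 1)) k) :
    aeval P.genVec f = 0 ↔ ∀ t, eval (P.vec t) f = 0 := by
  have h := P.isGeneric (bind₁ P.vecPoly f)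
  rw [aeval_bind₁] at h
  simp only [eval_bind₁_eq] at h
  exact h

/-- The differentials of the entries of the graph matrix vanish, since these are `p`-th powers. -/
theorem D_genVec [CharP k p] (c : Fin (N + 1)) : D k L (P.genVec c) =
    ∑ i : Fin n, aeval P.ξ (P.root i.succ c) ^ p • D k L (aeval P.ξ (P.coeff i.succ)) := by
  have : CharP L p := charP_of_injective_algebraMap (algebraMap k L).injective p
  rw [genVec_eq]
  simp only [map_add, map_sum, Derivation.leibniz, D_eq_zero_of_eq_pow, smul_zero, zero_add]

/-- The rows of the graph matrix other than the first are tangent vectors of the cone over the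
generic vector. -/
theorem sum_pderiv_mul_root [CharP k p] {f : MvPolynomial (Fin (N + 1)) k}
    (hf : aeval P.genVec f = 0) (i : Fin n) :
    ∑ c, aeval P.genVec (pderiv c f) * aeval P.ξ (P.root i.succ c) ^ p = 0 := by
  have h := D_aeval P.genVec f
  rw [hf, map_zero] at h
  simp only [D_genVec, Finset.smul_sum, smul_smul] at h
  rw [Finset.sum_comm] at h
  simp only [← Finset.sum_smul] at h
  exact Fintype.linearIndependent_iff.1 P.linearIndependent _ h.symm i

variable [PerfectField k] [Algebra.EssFiniteType k L]

/-- The function field is separable over the field generated by the coefficients, which are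
coordinates of the generic vector. -/
theorem isSeparable_adjoin :
    Algebra.IsSeparable (IntermediateField.adjoin k (P.genVec '' Set.range I)) L := by
  obtain ⟨hfin, hrank⟩ := finrank_kaehler_eq_trdeg P.trdeg_eq
  refine isSeparable_of_span_D_eq_top (span_D_range_eq_top (by simpa using hrank)
    P.linearIndependent) _ ?_
  rintro _ ⟨i, rfl⟩
  change aeval P.ξ (P.coeff i.succ) ∈ _
  rw [← P.genVec_apply_I]
  exact IntermediateField.subset_adjoin _ _ ⟨_, ⟨_, rfl⟩, rfl⟩

/-- A polynomial relation that expresses the coordinate with index `c` of the generic vector through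
the coordinates in `I`, which is separable. -/
theorem exists_relation (c : Fin (N + 1)) (hc : c ∉ Set.range I) :
    ∃ Q : MvPolynomial (Fin (N + 1)) k, aeval P.genVec Q = 0 ∧ aeval P.genVec (pderiv c Q) ≠ 0 ∧
      ∀ j ∉ Set.range I, j ≠ c → pderiv j Q = 0 := by
  have := P.isSeparable_adjoin
  exact exists_separable_relation P.genVec (Set.range I) c hc

theorem sum_eq_of_pderiv_eq_zero {K : Type*} [Field K] (hI : Function.Injective I)
    {c : Fin (N + 1)} (hc : c ∉ Set.range I) (g w : Fin (N + 1) → K)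
    (hg : ∀ j ∉ Set.range I, j ≠ c → g j = 0) :
    ∑ j, g j * w j = g c * w c + ∑ b, g (I b) * w (I b) := by
  classical
  have h1 : ∑ b, g (I b) * w (I b) = ∑ j ∈ Finset.univ.image I, g j * w j := by
    rw [Finset.sum_image fun a _ b _ h => hI h]
  rw [h1, ← Finset.sum_insert (f := fun j => g j * w j) (by simpa using hc)]
  refine (Finset.sum_subset (Finset.subset_univ _) fun j _ hj => ?_).symm
  rw [Finset.mem_insert, not_or] at hj
  rw [hg j (by simpa using hj.2) hj.1, zero_mul]

/-- The coordinates of the generic vector generate the function field: the separable relations give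
the entries of the graph matrix. -/
theorem adjoin_genVec [CharP k p] [Nonempty T] : IntermediateField.adjoin k (Set.range P.genVec) = ⊤ := by
  set K := IntermediateField.adjoin k (Set.range P.genVec) with hK
  have hmem : ∀ f, aeval P.genVec f ∈ K := fun f => by
    refine IntermediateField.algebra_adjoin_le_adjoin k _ ?_
    rw [Algebra.adjoin_range_eq_range_aeval]
    exact ⟨f, rfl⟩
  have hvec : ∀ c, P.genVec c ∈ K := fun c => IntermediateField.subset_adjoin _ _ ⟨c, rfl⟩
  have hcoeff : ∀ a, aeval P.ξ (P.coeff a) ∈ K := fun a => P.genVec_apply_I a ▸ hvec _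
  have hsucc : ∀ (i : Fin n) c, aeval P.ξ (P.root i.succ c) ^ p ∈ K := by
    intro i c
    by_cases hc : c ∈ Set.range I
    · obtain ⟨b, rfl⟩ := hc
      rw [P.aeval_root]
      split_ifs
      · exact one_mem _
      · exact zero_mem _
    · obtain ⟨Q, hQ, hQc, hQj⟩ := P.exists_relation c hc
      have h1 := P.sum_pderiv_mul_root hQ i
      rw [sum_eq_of_pderiv_eq_zero P.injective_index hc _ _
        (fun j hj hjc => by rw [hQj j hj hjc, map_zero])] at h1
      simp only [P.aeval_root] at h1
      simp only [mul_ite, mul_one, mul_zero, Finset.sum_ite_eq, Finset.mem_univ, if_true] at h1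
      -- the gradient of the relation `Q` is orthogonal to the row with index `i.succ`
      have h2 : aeval P.ξ (P.root i.succ c) ^ p =
          -aeval P.genVec (pderiv (I i.succ) Q) / aeval P.genVec (pderiv c Q) := by
        rw [eq_div_iff hQc]
        linear_combination h1
      rw [h2]
      exact div_mem (neg_mem (hmem _)) (hmem _)
  refine P.eq_top K (fun i => hcoeff _) fun a c => ?_
  induction a using Fin.cases with
  | succ i => exact hsucc i c
  | zero =>
    have h1 : aeval P.ξ (P.root 0 c) ^ p = P.genVec c -
        ∑ i : Fin n, aeval P.ξ (P.coeff i.succ) * aeval P.ξ (P.root i.succ c) ^ p := by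
      rw [P.genVec_eq]; ring
    rw [h1]
    exact sub_mem (hvec c) (sum_mem fun i _ => mul_mem (hcoeff _) (hsucc i c))

/-- The coordinates on the parameter space are rational functions of the vector, with a common
denominator `v`; outside the zeros of `v` there are relations that show that the vectors of the
family lie on a variety whose tangent spaces are at most those of the family. -/
theorem exists_inverse [CharP k p] [Nonempty T] [Finite σ] :
    ∃ (v : MvPolynomial (Fin (N + 1)) k) (ρ : σ → MvPolynomial (Fin (N + 1)) k),
      aeval P.genVec v ≠ 0 ∧
      (∀ t i, eval (P.vec t) (ρ i) = eval (P.vec t) v * P.coord t i) ∧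
      ∀ c ∉ Set.range I, ∃ Q : MvPolynomial (Fin (N + 1)) k, (∀ t, eval (P.vec t) Q = 0) ∧
        (∀ j ∉ Set.range I, j ≠ c → pderiv j Q = 0) ∧
        ∀ t, eval (P.vec t) v ≠ 0 → eval (P.vec t) (pderiv c Q) ≠ 0 := by
  classical
  have := Fintype.ofFinite σ
  obtain ⟨v, -, hv, h⟩ := exists_common_denominator P.genVec Set.univ P.ξ (fun i => by
    rw [Set.image_univ, P.adjoin_genVec]; trivial)
  choose q hq hqv using h
  choose Q hQ hQc hQj using P.exists_relation
  -- `R` is included in the denominator so that the relations are separable where `v` does not vanish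
  let R : MvPolynomial (Fin (N + 1)) k :=
    ∏ c, if hc : c ∈ Set.range I then 1 else pderiv c (Q c hc)
  have hR : aeval P.genVec R ≠ 0 := by
    rw [map_prod]
    refine Finset.prod_ne_zero_iff.2 fun c _ => ?_
    split_ifs with hc
    · simp
    · exact hQc c hc
  refine ⟨v * R, fun i => q i * R, ?_, fun t i => ?_, fun c hc => ⟨Q c hc,
    (P.aeval_genVec_eq_zero_iff _).1 (hQ c hc), hQj c hc, fun t ht => ?_⟩⟩
  · rw [map_mul]
    exact mul_ne_zero hv hR
  · have h1 : aeval P.ξ (bind₁ P.vecPoly (q i) - bind₁ P.vecPoly v * X i) = 0 := by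
      rw [map_sub, map_mul, aeval_bind₁, aeval_bind₁, aeval_X]
      exact sub_eq_zero.2 (hqv i)
    have h2 := (P.isGeneric _).1 h1 t
    rw [map_sub, map_mul, eval_bind₁_eq, eval_bind₁_eq, eval_X, sub_eq_zero] at h2
    rw [map_mul, map_mul]
    have h3 : eval (P.vec t) (q i) = eval (P.vec t) v * P.coord t i := h2
    rw [h3]
    ring
  · rw [map_mul] at ht
    have h1 := right_ne_zero_of_mul ht
    rw [map_prod, Finset.prod_ne_zero_iff] at h1
    have h2 := h1 c (Finset.mem_univ c)
    rwa [dif_neg hc] at h2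

end TangentFamily

namespace TangentFamily

variable {p : ℕ} {k : Type u} [Field k] {n N : ℕ} {I : Fin (n + 1) → Fin (N + 1)}
  {σ : Type} {T : Type*} [TopologicalSpace T] {L : Type u} [Field L] [Algebra k L]

variable (P : TangentFamily p k I σ T L)

/-- The point of projective space given by the vector with parameter `t`. -/
def point (t : T) : PSpace k N := Projectivization.mk k (P.vec t) (P.vec_ne_zero t)

/-- The variety swept out by the family: the closure of the set of its points. -/
def variety : Set (PSpace k N) := closure (Set.range P.point)

theorem point_mem_variety (t : T) : P.point t ∈ P.variety := subset_closure ⟨t, rfl⟩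

theorem continuous_point : Continuous P.point :=
  continuous_projective_of_polynomial P.isClosedEmbedding.continuous P.vecPoly _
    fun t => ⟨P.vec_ne_zero t, rfl⟩

theorem isVariety_variety [IrreducibleSpace T] : IsVariety P.variety where
  isClosed := isClosed_closure
  isIrreducible := by
    refine IsIrreducible.closure ?_
    rw [← Set.image_univ]
    exact (IrreducibleSpace.isIrreducible_univ T).image _ P.continuous_point.continuousOn

theorem projChart_point (t : T) : projChart (I 0) (P.point t) = P.vec t := by
  rw [point, projChart_mk, vec_apply_zero]
  simp

theorem point_rep_ne_zero (t : T) : (P.point t).rep (I 0) ≠ 0 := by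
  rw [point, rep_mk_apply_ne_zero_iff, vec_apply_zero]
  exact one_ne_zero

theorem eval_rep_eq_zero_of_mem_variety {d : ℕ} {f : MvPolynomial (Fin (N + 1)) k}
    (hf : f.IsHomogeneous d) (h : ∀ t, eval (P.vec t) f = 0) {z : PSpace k N}
    (hz : z ∈ P.variety) : eval z.rep f = 0 := by
  have hcl : IsClosed {z : PSpace k N | eval z.rep f ≠ 0}ᶜ :=
    (isOpen_eval_rep_ne_zero hf).isClosed_compl
  have hsub : Set.range P.point ⊆ {z : PSpace k N | eval z.rep f ≠ 0}ᶜ := by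
    rintro _ ⟨t, rfl⟩
    rw [Set.mem_compl_iff, Set.mem_ofPred_eq, not_not]
    exact (eval_rep_mk_eq_zero_iff hf _).2 (h t)
  exact not_not.1 (closure_minimal hsub hcl hz)

theorem eval_vec_eq_zero {d : ℕ} {f : MvPolynomial (Fin (N + 1)) k} (hf : f.IsHomogeneous d)
    (h : ∀ z ∈ P.variety, eval z.rep f = 0) (t : T) : eval (P.vec t) f = 0 :=
  (eval_rep_mk_eq_zero_iff hf (P.vec_ne_zero t)).1 (h _ (P.point_mem_variety t))

theorem eval_homogenizeAt_eq_zero {f : MvPolynomial (Fin (N + 1)) k}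
    (h : ∀ t, eval (P.vec t) f = 0) {z : PSpace k N} (hz : z ∈ P.variety) :
    eval z.rep (homogenizeAt (I 0) f.totalDegree f) = 0 :=
  P.eval_rep_eq_zero_of_mem_variety (homogenizeAt_isHomogeneous _ le_rfl)
    (fun t => (aeval_homogenizeAt_of_eq_one (K := k) _ _ f (P.vec_apply_zero t)).trans (h t)) hz

theorem eval_projChart_eq_zero {f : MvPolynomial (Fin (N + 1)) k}
    (h : ∀ t, eval (P.vec t) f = 0) {z : PSpace k N} (hz : z ∈ P.variety)
    (hz0 : z.rep (I 0) ≠ 0) : eval (projChart (I 0) z) f = 0 := by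
  have h1 := P.eval_homogenizeAt_eq_zero h hz
  have h2 : eval z.rep (homogenizeAt (I 0) f.totalDegree f) =
      z.rep (I 0) ^ f.totalDegree * eval (projChart (I 0) z) f :=
    aeval_homogenizeAt (K := k) (I 0) le_rfl hz0
  rw [h2] at h1
  exact (mul_eq_zero.1 h1).resolve_left (pow_ne_zero _ hz0)

/-- The dimension of the variety swept out by the family is the transcendence degree of the field
generated by the generic vector. -/
theorem topologicalKrullDim_variety [CharP k p] [Algebra.EssFiniteType k L] [IsAlgClosed k]
    [IrreducibleSpace T] :
    topologicalKrullDim P.variety = n := by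
  have : IrreducibleSpace P.variety :=
    Subtype.irreducibleSpace P.isVariety_variety.isIrreducible
  let U : Fin (N + 1) → Set P.variety := fun i => {x | x.1 ∈ {y : PSpace k N | y.rep i ≠ 0}}
  let κ : ∀ i, U i → AffSpace k (Fin (N + 1)) := fun i x => projChart i x.1.1
  have hκ : ∀ i, IsClosedEmbedding (κ i) := fun i =>
    isClosedEmbedding_restrict (isClosedEmbedding_projChart i) isClosed_closure
  obtain ⟨t₀⟩ := (inferInstance : Nonempty T)
  rw [topologicalKrullDim_eq_of_charts (U := U)
    (fun i => (isOpen_rep_apply_ne_zero i).preimage continuous_subtype_val)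
    (by
      rw [Set.eq_univ_iff_forall]
      intro x
      obtain ⟨i, hi⟩ := exists_rep_apply_ne_zero x.1
      exact Set.mem_iUnion.2 ⟨i, hi⟩) hκ (i := I 0)
    ⟨⟨P.point t₀, P.point_mem_variety t₀⟩, P.point_rep_ne_zero t₀⟩]
  have hgen : IsGeneric (κ (I 0)) P.genVec := by
    intro f
    rw [P.aeval_genVec_eq_zero_iff]
    constructor
    · intro h x
      exact P.eval_projChart_eq_zero h x.1.2 x.2
    · intro h t
      have := h ⟨⟨P.point t, P.point_mem_variety t⟩, P.point_rep_ne_zero t⟩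
      change eval (projChart (I 0) (P.point t)) f = 0 at this
      rwa [P.projChart_point] at this
  obtain ⟨s, hs, hs'⟩ := hgen.topologicalKrullDim_eq (hκ _) P.adjoin_genVec
  rw [hs, Nat.cast_injective (hs'.symm.trans P.trdeg_eq)]

/-- The points of the variety at which the coordinates of the parameter space can be computed belong
to the family. -/
theorem exists_vec_eq {v : MvPolynomial (Fin (N + 1)) k} {ρ : σ → MvPolynomial (Fin (N + 1)) k}
    (hρ : ∀ t i, eval (P.vec t) (ρ i) = eval (P.vec t) v * P.coord t i) {x : PSpace k N}
    (hx : x ∈ P.variety) (hx0 : x.rep (I 0) ≠ 0) (hxv : eval (projChart (I 0) x) v ≠ 0) :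
    ∃ t, P.vec t = projChart (I 0) x ∧
      ∀ i, P.coord t i = eval (projChart (I 0) x) (ρ i) / eval (projChart (I 0) x) v := by
  set u := projChart (I 0) x with hu
  -- the candidate for the parameter has the coordinates `ρ i / v`; equations of the parameter space
  -- hold there, since with cleared denominators they are equations of the variety
  have hclear : ∀ f : MvPolynomial σ k, ∃ (d : ℕ) (Q : MvPolynomial (Fin (N + 1)) k),
      eval u Q = eval u v ^ d * eval (fun i => eval u (ρ i) / eval u v) f ∧
      ∀ t, eval (P.vec t) v ≠ 0 → eval (P.vec t) Q = eval (P.vec t) v ^ d * eval (P.coord t) f := by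
    intro f
    obtain ⟨d, Q, hQ⟩ := exists_clear_denominators v ρ f
    refine ⟨d, Q, hQ k u hxv, fun t ht => (hQ k (P.vec t) ht).trans ?_⟩
    have h1 : (fun i => aeval (P.vec t) (ρ i) / aeval (P.vec t) v) = P.coord t := by
      funext i
      change eval (P.vec t) (ρ i) / eval (P.vec t) v = _
      rw [hρ, mul_div_cancel_left₀ _ ht]
    rw [h1]
    rfl
  have hmem : (fun i => eval u (ρ i) / eval u v : AffSpace k σ) ∈ Set.range P.coord := by
    refine AffSpace.mem_of_isClosed P.isClosedEmbedding.isClosed_range fun f hf => ?_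
    obtain ⟨d, Q, hQu, hQ⟩ := hclear f
    have h1 : eval u (v * Q) = 0 := P.eval_projChart_eq_zero (fun t => by
      by_cases ht : eval (P.vec t) v = 0
      · rw [map_mul, ht, zero_mul]
      · rw [map_mul, hQ t ht, hf _ ⟨t, rfl⟩, mul_zero, mul_zero]) hx hx0
    rw [map_mul, hQu] at h1
    exact (mul_eq_zero.1 ((mul_eq_zero.1 h1).resolve_left hxv)).resolve_left (pow_ne_zero _ hxv)
  obtain ⟨t, ht⟩ := hmem
  refine ⟨t, funext fun c => ?_, fun i => congrFun ht i⟩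
  obtain ⟨d, Q, hQu, hQ⟩ := hclear (P.vecPoly c)
  have h1 : eval u (v * (Q - v ^ d * X c)) = 0 := P.eval_projChart_eq_zero (fun t => by
      by_cases ht : eval (P.vec t) v = 0
      · rw [map_mul, ht, zero_mul]
      · rw [map_mul, map_sub, hQ t ht, map_mul, map_pow, eval_X]
        simp [vec]) hx hx0
  rw [map_mul, map_sub, hQu, map_mul, map_pow, eval_X, ← ht] at h1
  have h2 := (mul_eq_zero.1 h1).resolve_left hxv
  rw [← mul_sub] at h2
  exact sub_eq_zero.1 ((mul_eq_zero.1 h2).resolve_left (pow_ne_zero _ hxv))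

/-- All the rows of the graph matrix are tangent to the variety swept out by the family: the first
one is a combination of the other ones and of the vector of the family, which is tangent to the cone
by Euler's identity. -/
theorem graph_mem_tangentSpace [CharP k p] (t : T) (a : Fin (n + 1)) :
    P.graph t a ∈ tangentSpace P.variety (P.point t) := by
  rw [point, mem_tangentSpace_mk_iff]
  intro d f hf hX
  have hf0 := P.eval_vec_eq_zero hf hX
  have hsucc : ∀ i : Fin n, ∑ c, eval (P.vec t) (pderiv c f) * P.graph t i.succ c = 0 := by
    intro i
    have h1 : aeval P.ξ (∑ c, bind₁ P.vecPoly (pderiv c f) * P.root i.succ c ^ p) = 0 := by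
      simp only [map_sum, map_mul, map_pow, aeval_bind₁]
      exact P.sum_pderiv_mul_root ((P.aeval_genVec_eq_zero_iff f).2 hf0) i
    have h2 := (P.isGeneric _).1 h1 t
    simp only [map_sum, map_mul, map_pow, eval_bind₁_eq] at h2
    exact h2
  induction a using Fin.cases with
  | succ i => exact hsucc i
  | zero =>
    have h1 := congrArg (eval (P.vec t)) hf.sum_X_mul_pderiv
    simp only [map_sum, map_mul, eval_X, map_nsmul, hf0, smul_zero] at h1
    have h2 : ∀ c, P.graph t 0 c = P.vec t c -
        ∑ i : Fin n, eval (P.coord t) (P.coeff i.succ) * P.graph t i.succ c := by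
      intro c
      rw [P.vec_apply, Fin.sum_univ_succ, P.eval_coeff_zero]
      ring
    have h3 : ∑ c, eval (P.vec t) (pderiv c f) * P.graph t 0 c =
        ∑ c, P.vec t c * eval (P.vec t) (pderiv c f) -
          ∑ i : Fin n, eval (P.coord t) (P.coeff i.succ) *
            ∑ c, eval (P.vec t) (pderiv c f) * P.graph t i.succ c := by
      simp only [h2, mul_sub, Finset.sum_sub_distrib, Finset.mul_sum]
      congr 1
      · exact Finset.sum_congr rfl fun c _ => mul_comm _ _
      · rw [Finset.sum_comm]
        exact Finset.sum_congr rfl fun i _ => Finset.sum_congr rfl fun c _ => mul_left_comm _ _ _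
    rw [h3, h1]
    simp [hsucc]

/-- The tangent space at a general point of the variety is the subspace of the family. -/
theorem mem_tangentSpace_iff [CharP k p] {v : MvPolynomial (Fin (N + 1)) k}
    (hv : ∀ c ∉ Set.range I, ∃ Q : MvPolynomial (Fin (N + 1)) k, (∀ t, eval (P.vec t) Q = 0) ∧
        (∀ j ∉ Set.range I, j ≠ c → pderiv j Q = 0) ∧
        ∀ t, eval (P.vec t) v ≠ 0 → eval (P.vec t) (pderiv c Q) ≠ 0)
    {t : T} (ht : eval (P.vec t) v ≠ 0) (w : Fin (N + 1) → k) :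
    w ∈ tangentSpace P.variety (P.point t) ↔ w = Matrix.vecMul (w ∘ I) (P.graph t) := by
  have hle : ∀ c : Fin (n + 1) → k, Matrix.vecMul c (P.graph t) ∈
      tangentSpace P.variety (P.point t) := fun c => by
    rw [Matrix.vecMul_eq_sum]
    exact Submodule.sum_mem _ fun a _ => Submodule.smul_mem _ _ (P.graph_mem_tangentSpace t a)
  refine ⟨fun hw => ?_, fun h => h ▸ hle _⟩
  have hI : Function.Injective I := by
    have : Nonempty T := ⟨t⟩
    exact P.injective_index
  -- modulo the subspace of the family, a tangent vector vanishes in the coordinates with indices in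
  -- `I`, and the separable relations show that it vanishes in the others
  set w' := w - Matrix.vecMul (w ∘ I) (P.graph t) with hw'
  have hw'I : ∀ b, w' (I b) = 0 := fun b => by
    have h1 : Matrix.vecMul (w ∘ I) (P.graph t) (I b) =
        Matrix.vecMul (w ∘ I) ((P.graph t).submatrix id I) b := rfl
    rw [hw', Pi.sub_apply, h1, P.graph_submatrix, Matrix.vecMul_one]
    exact sub_self _
  have hw'mem : w' ∈ tangentSpace P.variety (P.point t) := Submodule.sub_mem _ hw (hle _)
  have hzero : w' = 0 := by
    funext c
    by_cases hc : c ∈ Set.range I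
    · obtain ⟨b, rfl⟩ := hc
      exact hw'I b
    · obtain ⟨Q, hQ, hQj, hQc⟩ := hv c hc
      rw [point, mem_tangentSpace_mk_iff] at hw'mem
      have h1 := hw'mem _ _ (homogenizeAt_isHomogeneous (I 0) (le_refl Q.totalDegree))
        fun z hz => P.eval_homogenizeAt_eq_zero hQ hz
      have hpd : ∀ j ≠ I 0, eval (P.vec t) (pderiv j (homogenizeAt (I 0) Q.totalDegree Q)) =
          eval (P.vec t) (pderiv j Q) := fun j hj =>
        aeval_pderiv_homogenizeAt (K := k) (I 0) _ Q (P.vec_apply_zero t) hj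
      rw [sum_eq_of_pderiv_eq_zero hI hc] at h1
      · simp only [hw'I, mul_zero, Finset.sum_const_zero, add_zero] at h1
        rw [hpd c fun h => hc ⟨0, h.symm⟩] at h1
        exact (mul_eq_zero.1 h1).resolve_left (hQc t ht)
      · intro j hj hjc
        rw [hpd j fun h => hj ⟨0, h.symm⟩, hQj j hj hjc, map_zero]
  rwa [hw', sub_eq_zero] at hzero

end TangentFamily

/-! ### The rational map to the family -/

/-- Maps that are given by rational functions of affine coordinates, with a common denominator `v`
that does not vanish, are regular. -/
theorem isRegularOn_of_polynomial {k : Type u} [Field k] {N : ℕ} {σ ι : Type*} [Finite ι]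
    {A : Set (PSpace k N)} {φ : PSpace k N → ℙ k (ι → k)} (i₀ : Fin (N + 1))
    (v : MvPolynomial (Fin (N + 1)) k) (ρ : σ → MvPolynomial (Fin (N + 1)) k)
    (g : ι → MvPolynomial σ k)
    (h : ∀ x ∈ A, x.rep i₀ ≠ 0 ∧ eval (projChart i₀ x) v ≠ 0 ∧
      ∃ hz : (fun i => eval (fun s => eval (projChart i₀ x) (ρ s) / eval (projChart i₀ x) v)
        (g i)) ≠ 0, φ x = Projectivization.mk k _ hz) : IsRegularOn A φ := by
  have := Fintype.ofFinite ι
  choose d Q hQ using fun i => exists_clear_denominators v ρ (g i)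
  -- the components are brought to the same degree in `v` and then to the same homogeneous degree
  let Q' : ι → MvPolynomial (Fin (N + 1)) k := fun i => v ^ (∑ j, d j - d i) * Q i
  let E := ∑ i, (Q' i).totalDegree
  refine fun x _ => ⟨Set.univ, isOpen_univ, trivial, E, fun i => homogenizeAt i₀ E (Q' i),
    fun i => homogenizeAt_isHomogeneous _
      (Finset.single_le_sum (f := fun i => (Q' i).totalDegree) (fun _ _ => Nat.zero_le _)
        (Finset.mem_univ i)), fun z hz => ?_⟩
  obtain ⟨hz0, hzv, hne, hφ⟩ := h z hz.1
  have h1 : ∀ i, eval z.rep (homogenizeAt i₀ E (Q' i)) =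
      (z.rep i₀ ^ E * eval (projChart i₀ z) v ^ (∑ j, d j)) *
        eval (fun s => eval (projChart i₀ z) (ρ s) / eval (projChart i₀ z) v) (g i) := by
    intro i
    have h2 : eval z.rep (homogenizeAt i₀ E (Q' i)) =
        z.rep i₀ ^ E * eval (projChart i₀ z) (Q' i) :=
      aeval_homogenizeAt (K := k) i₀ (Finset.single_le_sum (f := fun i => (Q' i).totalDegree)
        (fun _ _ => Nat.zero_le _) (Finset.mem_univ i)) hz0
    have h3 : eval (projChart i₀ z) (Q i) = eval (projChart i₀ z) v ^ d i *
      eval (fun s => eval (projChart i₀ z) (ρ s) / eval (projChart i₀ z) v) (g i) :=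
        hQ i k (projChart i₀ z) hzv
    have h4 : d i ≤ ∑ j, d j := Finset.single_le_sum (f := d) (fun _ _ => Nat.zero_le _)
      (Finset.mem_univ i)
    rw [h2, map_mul, map_pow, h3, ← mul_assoc (eval (projChart i₀ z) v ^ (_ - _)), ← pow_add,
      Nat.sub_add_cancel h4, mul_assoc]
  have hc : z.rep i₀ ^ E * eval (projChart i₀ z) v ^ (∑ j, d j) ≠ 0 :=
    mul_ne_zero (pow_ne_zero _ hz0) (pow_ne_zero _ hzv)
  refine ⟨fun h0 => hne (funext fun i => ?_), ?_⟩
  · have := congrFun h0 i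
    simp only [h1] at this
    exact (mul_eq_zero.1 this).resolve_left hc
  · rw [hφ, Projectivization.mk_eq_mk_iff']
    refine ⟨(z.rep i₀ ^ E * eval (projChart i₀ z) v ^ (∑ j, d j))⁻¹, funext fun i => ?_⟩
    simp only [Pi.smul_apply, smul_eq_mul, h1]
    rw [inv_mul_cancel_left₀ hc]

theorem isOpen_eval_projChart_ne_zero {k : Type*} [Field k] {N : ℕ} (i : Fin (N + 1))
    (v : MvPolynomial (Fin (N + 1)) k) :
    IsOpen {x : PSpace k N | x.rep i ≠ 0 ∧ eval (projChart i x) v ≠ 0} := by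
  have h := (isOpen_rep_apply_ne_zero (k := k) i).isOpenMap_subtype_val _
    ((AffSpace.isOpen_ne v).preimage (continuous_projChart i))
  convert h using 1
  ext x
  constructor
  · rintro ⟨h1, h2⟩; exact ⟨⟨x, h1⟩, h2, rfl⟩
  · rintro ⟨x, h2, rfl⟩; exact ⟨x.2, h2⟩

namespace TangentFamily

variable {p : ℕ} {k : Type u} [Field k] {n N N' : ℕ} {I : Fin (n + 1) → Fin (N + 1)}
  {σ : Type} {T : Type*} [TopologicalSpace T] {L : Type u} [Field L] [Algebra k L]

variable (P : TangentFamily p k I σ T L)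

/-- If the parameter space is identified with an open subset of a subvariety `F` of the product
variety such that the subspaces of the family are the planes, then the inverse of the
parametrization is a generically bijective rational map to `F`, and its composition with the projection
to the Grassmannian is the Gauss map. -/
theorem exists_ratMap [CharP k p] [PerfectField k] [Algebra.EssFiniteType k L]
    [Finite σ] [IrreducibleSpace T] {F V : Set (GrassProd k n N N')} {π : T → GrassProd k n N N'}
    (hπ : IsEmbedding π) (hV : IsOpen V) (hrange : Set.range π = F ∩ V)
    (hminors : ∀ t, (π t).plane.minors I ≠ 0) (hgraph : ∀ t, (π t).plane.graph I = P.graph t)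
    (g : Fin (N' + 1) → MvPolynomial σ k)
    (hg : ∀ t, ∃ h : (fun l => eval (P.coord t) (g l)) ≠ 0,
      (π t).point = Projectivization.mk k _ h) :
    ∃ h : RatMap P.variety F, ∃ (U : Set (PSpace k N)) (V' : Set (GrassProd k n N N')),
      IsOpen U ∧ IsOpen V' ∧ U ⊆ h.dom ∧ (P.variety ∩ U).Nonempty ∧ (F ∩ V').Nonempty ∧
      Set.BijOn h.toFun (P.variety ∩ U) (F ∩ V') ∧
      (∀ x ∈ P.variety ∩ U, tangentSpace P.variety x = (h.toFun x).plane.toSubmodule) ∧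
      ∀ x ∈ P.variety ∩ U, ∃ t, h.toFun x = π t ∧ P.point t = x := by
  classical
  obtain ⟨v, ρ, hv, hρ, hQ⟩ := P.exists_inverse
  obtain ⟨t₀, ht₀⟩ : ∃ t, eval (P.vec t) v ≠ 0 := by
    by_contra! h
    exact hv ((P.aeval_genVec_eq_zero_iff v).2 h)
  let U : Set (PSpace k N) := {x | x.rep (I 0) ≠ 0 ∧ eval (projChart (I 0) x) v ≠ 0}
  have hU : IsOpen U := isOpen_eval_projChart_ne_zero _ _
  have hpointU : ∀ t, eval (P.vec t) v ≠ 0 → P.point t ∈ P.variety ∩ U := fun t ht =>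
    ⟨P.point_mem_variety t, P.point_rep_ne_zero t, by rwa [P.projChart_point]⟩
  have hcoord : ∀ s t, P.vec s = P.vec t → eval (P.vec t) v ≠ 0 → s = t := by
    intro s t hst ht
    refine P.isClosedEmbedding.injective (funext fun i => ?_)
    have h1 := hρ s i
    rw [hst, hρ t i] at h1
    exact (mul_left_cancel₀ ht h1).symm
  -- the value `π t₀` at the points outside the family is irrelevant
  let toFun : PSpace k N → GrassProd k n N N' := fun x =>
    if h : ∃ t, P.vec t = projChart (I 0) x then π h.choose else π t₀
  have htoFun : ∀ t, eval (P.vec t) v ≠ 0 → toFun (P.point t) = π t := by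
    intro t ht
    have hex : ∃ s, P.vec s = projChart (I 0) (P.point t) := ⟨t, (P.projChart_point t).symm⟩
    have h1 : toFun (P.point t) = π hex.choose := dif_pos hex
    rw [h1, hcoord hex.choose t (hex.choose_spec.trans (P.projChart_point t)) ht]
  have hU' : ∀ x ∈ P.variety ∩ U, ∃ t, P.point t = x ∧ eval (P.vec t) v ≠ 0 ∧
      ∀ i, P.coord t i = eval (projChart (I 0) x) (ρ i) / eval (projChart (I 0) x) v := by
    rintro x ⟨hx, hx0, hxv⟩
    obtain ⟨t, ht, hti⟩ := P.exists_vec_eq hρ hx hx0 hxv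
    refine ⟨t, ?_, by rwa [ht], hti⟩
    rw [← mk_projChart hx0, point]
    congr 1
  have hregplane : IsRegularOn (P.variety ∩ U) fun x => (toFun x).plane.plucker := by
    refine isRegularOn_of_polynomial (I 0) v ρ (fun J => (Matrix.of fun a b =>
      P.root a (J b) ^ p : Matrix (Fin (n + 1)) (Fin (n + 1)) (MvPolynomial σ k)).det)
      fun x hx => ⟨hx.2.1, hx.2.2, ?_⟩
    obtain ⟨t, rfl, htv, hti⟩ := hU' x hx
    rw [← funext hti, htoFun t htv]
    have h1 : (fun J : Fin (n + 1) → Fin (N + 1) => eval (P.coord t) (Matrix.of fun a b =>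
        P.root a (J b) ^ p : Matrix (Fin (n + 1)) (Fin (n + 1)) (MvPolynomial σ k)).det) =
        fun J => ((P.graph t).submatrix id J).det := by
      funext J
      rw [RingHom.map_det]
      congr 1
      ext a b
      simp [graph]
    have hdet : ((P.graph t).submatrix id I).det ≠ 0 := by rw [P.graph_submatrix]; simp
    obtain ⟨h, hz⟩ := Grassmannian.plucker_eq (W := (π t).plane)
      (hgraph t ▸ (π t).plane.graph_mem I) hdet
    exact ⟨h1 ▸ h, hz.trans (by congr 1; exact h1.symm)⟩
  have hregpoint : IsRegularOn (P.variety ∩ U) fun x => (toFun x).point := by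
    refine isRegularOn_of_polynomial (I 0) v ρ g fun x hx => ⟨hx.2.1, hx.2.2, ?_⟩
    obtain ⟨t, rfl, htv, hti⟩ := hU' x hx
    rw [← funext hti, htoFun t htv]
    exact hg t
  have hne : (P.variety ∩ U).Nonempty := ⟨_, hpointU t₀ ht₀⟩
  have hmaps : Set.MapsTo toFun (P.variety ∩ U) F := by
    intro x hx
    obtain ⟨t, rfl, htv, -⟩ := hU' x hx
    rw [htoFun t htv]
    exact (hrange.subset ⟨t, rfl⟩).1
  have hopen : IsOpen {t | eval (P.vec t) v ≠ 0} :=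
    ((AffSpace.isOpen_ne v).preimage ((AffSpace.continuous_polynomial P.vecPoly).comp
      P.isClosedEmbedding.continuous))
  obtain ⟨O, hO, hOT⟩ := hπ.isInducing.isOpen_iff.1 hopen
  have hFV : ∀ z, z ∈ F ∩ (V ∩ O) ↔ ∃ t, eval (P.vec t) v ≠ 0 ∧ π t = z := by
    intro z
    constructor
    · rintro ⟨hzF, hzV, hzO⟩
      obtain ⟨t, rfl⟩ := hrange.superset ⟨hzF, hzV⟩
      exact ⟨t, hOT.subset hzO, rfl⟩
    · rintro ⟨t, ht, rfl⟩
      have h1 := hrange.subset ⟨t, rfl⟩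
      exact ⟨h1.1, h1.2, hOT.superset ht⟩
  refine ⟨⟨U, hU, hne, toFun, hmaps, hregplane, hregpoint⟩, U, V ∩ O, hU, hV.inter hO, subset_rfl, hne,
    ⟨π t₀, (hFV _).2 ⟨t₀, ht₀, rfl⟩⟩, ⟨?_, ?_, ?_⟩, ?_, ?_⟩
  · intro x hx
    obtain ⟨t, rfl, htv, -⟩ := hU' x hx
    exact (hFV _).2 ⟨t, htv, (htoFun t htv).symm⟩
  · intro x hx y hy hxy
    obtain ⟨s, rfl, hsv, -⟩ := hU' x hx
    obtain ⟨t, rfl, htv, -⟩ := hU' y hy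
    change toFun _ = toFun _ at hxy
    rw [htoFun s hsv, htoFun t htv] at hxy
    rw [hπ.injective hxy]
  · intro z hz
    obtain ⟨t, ht, rfl⟩ := (hFV z).1 hz
    exact ⟨P.point t, hpointU t ht, htoFun t ht⟩
  · intro x hx
    obtain ⟨t, rfl, htv, -⟩ := hU' x hx
    change _ = (toFun _).plane.toSubmodule
    rw [htoFun t htv]
    ext w
    rw [P.mem_tangentSpace_iff hQ htv, Grassmannian.mem_iff (hminors t), hgraph]
  · intro x hx
    obtain ⟨t, rfl, htv, -⟩ := hU' x hx
    exact ⟨t, htoFun t htv, rfl⟩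

end TangentFamily

/-! ### The closure of the image of the Gauss map -/

section GaussMapImage

variable {k : Type*} [Field k] {n N N' : ℕ} {X U : Set (PSpace k N)}
  {φ : PSpace k N → GrassProd k n N N'}

/-- A point whose tangent space has the expected dimension is smooth. -/
theorem mem_smoothLocus_of_eq {x : PSpace k N} (hx : x ∈ X) {W : Grassmannian k n N}
    (h : tangentSpace X x = W.toSubmodule) : x ∈ smoothLocus n X :=
  ⟨hx, by rw [h, W.finrank_eq]⟩

/-- A nonempty open subset of a variety is dense in the smooth locus. -/
theorem dense_smoothLocus (hX : IsIrreducible X) (hU : IsOpen U) (hne : (X ∩ U).Nonempty)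
    (hT : ∀ x ∈ X ∩ U, x ∈ smoothLocus n X) :
    Dense (Subtype.val ⁻¹' U : Set (smoothLocus n X)) := by
  rw [dense_iff_inter_open]
  rintro _ hO ⟨x, hxO⟩
  obtain ⟨O, hO', rfl⟩ := isOpen_induced_iff.1 hO
  obtain ⟨y, hyX, hyO, hyU⟩ := hX.2 O U hO' hU ⟨x.1, x.2.1, hxO⟩ hne
  exact ⟨⟨y, hT y ⟨hyX, hyU⟩⟩, hyO, hyU⟩

/-- The values of the Gauss map at all smooth points lie in `Y` by continuity, and they are dense in
`Y` as they contain the planes of an open subset of `F`. -/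
theorem closure_range_gaussMap (hX : IsIrreducible X) (hU : IsOpen U) (hne : (X ∩ U).Nonempty)
    {Y : Set (Grassmannian k n N)} (hY : IsClosed Y) {F V : Set (GrassProd k n N N')}
    (hF : IsIrreducible F) (hV : IsOpen V) (hneV : (F ∩ V).Nonempty)
    (hsurj : GrassProd.plane '' F = Y) (hφ : Set.BijOn φ (X ∩ U) (F ∩ V))
    (hT : ∀ x ∈ X ∩ U, tangentSpace X x = (φ x).plane.toSubmodule) :
    closure (Set.range (gaussMap n X)) = Y := by
  have hsm : ∀ x ∈ X ∩ U, x ∈ smoothLocus n X := fun x hx => mem_smoothLocus_of_eq hx.1 (hT x hx)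
  have hcont : Continuous (gaussMap n X) := continuous_plane.comp (continuous_gaussGraph n X)
  have heq : ∀ x (hx : x ∈ X ∩ U), gaussMap n X ⟨x, hsm x hx⟩ = (φ x).plane :=
    fun x hx => Grassmannian.ext (hT x hx)
  refine Set.Subset.antisymm (closure_minimal ?_ hY) ?_
  · have h1 : (Subtype.val ⁻¹' U : Set (smoothLocus n X)) ⊆ gaussMap n X ⁻¹' Y := by
      intro x hx
      have h2 := heq x.1 ⟨x.2.1, hx⟩
      rw [Set.mem_preimage, h2, ← hsurj]
      exact ⟨_, (hφ.mapsTo ⟨x.2.1, hx⟩).1, rfl⟩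
    have h2 := closure_minimal h1 (hY.preimage hcont)
    rw [(dense_smoothLocus hX hU hne hsm).closure_eq] at h2
    rintro _ ⟨x, rfl⟩
    exact h2 (Set.mem_univ x)
  · rw [← hsurj]
    have h1 : GrassProd.plane '' (F ∩ V) ⊆ Set.range (gaussMap n X) := by
      rintro _ ⟨z, hz, rfl⟩
      obtain ⟨x, hx, rfl⟩ := hφ.surjOn hz
      exact ⟨_, heq x hx⟩
    have h2 : F ⊆ closure (F ∩ V) := fun z hz => by
      rw [mem_closure_iff]
      intro O hO hzO
      obtain ⟨w, hwF, hwO, hwV⟩ := hF.2 O V hO hV ⟨z, hz, hzO⟩ hneV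
      exact ⟨w, hwO, hwF, hwV⟩
    exact (Set.image_mono h2).trans ((image_closure_subset_closure_image continuous_plane).trans
      (closure_mono h1))

end GaussMapImage

/-! ### Open subsets of general fibres -/

section Fibres

variable {k : Type u} [Field k] [IsAlgClosed k] {n N N' : ℕ}

/-- A nonempty open subset `V` of a variety is dense in the general fibres, in the affine charts:
an equation of the complement of `V` is a nonzerodivisor modulo the ideals of the general fibres. -/
theorem exists_open_subset_closure_chart {F V : Set (GrassProd k n N N')} (hF : IsVariety F)
    (hV : IsOpen V) (hne : (F ∩ V).Nonempty) (I : Fin (n + 1) → Fin (N + 1)) (j : Fin (N' + 1))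
    (hchart : (F ∩ chart I j).Nonempty) :
    ∃ O : Set (Grassmannian k n N), IsOpen O ∧ (GrassProd.plane '' F ∩ O).Nonempty ∧
      (∀ y ∈ O, y.minors I ≠ 0) ∧
      ∀ y ∈ O, ∀ q ∈ fibre F y, q.rep j ≠ 0 → q ∈ closure {q ∈ fibre F y | ⟨y, q⟩ ∈ V} := by
  classical
  let T : Set F := {x : F | x.1 ∈ chart I j}
  let κ : T → AffSpace k (ChartIndex n N N') := fun t => chartCoord I j t.1.1
  have hκ : IsClosedEmbedding κ :=
    isClosedEmbedding_restrict (isClosedEmbedding_chartCoord I j) hF.isClosed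
  have : IrreducibleSpace F := Subtype.irreducibleSpace hF.isIrreducible
  have hTopen : IsOpen T := (isOpen_chart I j).preimage continuous_subtype_val
  have hTne : T.Nonempty := by
    obtain ⟨z, hz, hz'⟩ := hchart
    exact ⟨⟨z, hz⟩, hz'⟩
  have : IrreducibleSpace T := Subtype.irreducibleSpace
    ⟨hTne, (PreirreducibleSpace.isPreirreducible_univ (X := F)).open_subset hTopen
      (Set.subset_univ _)⟩
  obtain ⟨L, _, _, ξ, hξ, htop, -⟩ := exists_isGeneric hκ.continuous
  -- an equation of the complement of `V`
  obtain ⟨h, hh, hhV⟩ : ∃ h : MvPolynomial (ChartIndex n N N') k, aeval ξ h ≠ 0 ∧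
      ∀ t : T, eval (κ t) h ≠ 0 → t.1.1 ∈ V := by
    obtain ⟨z, hzF, hzV, hzc⟩ := hF.isIrreducible.2 V _ hV (isOpen_chart I j) hne hchart
    have hopen : IsOpen {t : T | t.1.1 ∈ V} :=
      hV.preimage (continuous_subtype_val.comp continuous_subtype_val)
    obtain ⟨O, hO, hOV⟩ := hκ.isInducing.isOpen_iff.1 hopen
    obtain ⟨h, hz, hhO⟩ := AffSpace.exists_eval_ne_zero hO
      (show κ ⟨⟨z, hzF⟩, hzc⟩ ∈ O from hOV.superset hzV)
    exact ⟨h, fun h0 => hz ((hξ h).1 h0 _), fun t ht => hOV.subset (hhO _ ht)⟩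
  -- `B` is the coordinate ring of the (closure of the) set of planes, and `ker ev` the ideal of `F`
  -- over it
  let B : Subalgebra k L := (aeval (R := k) fun ac => ξ (Sum.inl ac)).range
  let b₀ : Fin (n + 1) × Fin (N + 1) → B := fun ac => ⟨ξ (Sum.inl ac), ⟨X ac, by simp⟩⟩
  let ev : MvPolynomial (Fin (N' + 1)) B →ₐ[B] L := aeval fun l => ξ (Sum.inr l)
  let lift : MvPolynomial (ChartIndex n N N') k →ₐ[k] MvPolynomial (Fin (N' + 1)) B :=
    aeval (Sum.elim (fun ac => C (b₀ ac)) X)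
  have hev : ∀ P, ev (lift P) = aeval ξ P := by
    intro P
    have : ((ev.restrictScalars k).comp lift) = aeval ξ := by
      ext i
      rcases i with ac | l
      · simp [ev, lift, b₀]
      · simp [ev, lift]
    exact DFunLike.congr_fun this P
  have hlift : Function.Surjective lift := by
    intro P
    induction P using MvPolynomial.induction_on with
    | C b =>
      obtain ⟨b, P, rfl⟩ := b
      refine ⟨rename Sum.inl P, ?_⟩
      have h1 : lift.comp (rename Sum.inl) = ((Algebra.ofId B
          (MvPolynomial (Fin (N' + 1)) B)).restrictScalars k).comp
          (aeval (R := k) fun ac => ξ (Sum.inl ac)).rangeRestrict := by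
        ext ac
        simp only [AlgHom.comp_apply, rename_X, lift, aeval_X, Sum.elim_inl,
          AlgHom.restrictScalars_apply, Algebra.ofId_apply, algebraMap_eq]
        have h2 : b₀ ac = (aeval (R := k) fun ac => ξ (Sum.inl ac)).rangeRestrict (X ac) :=
          Subtype.ext (aeval_X (fun ac => ξ (Sum.inl ac)) ac).symm
        rw [h2]
      exact DFunLike.congr_fun h1 P
    | add P Q hP hQ =>
      obtain ⟨P, rfl⟩ := hP
      obtain ⟨Q, rfl⟩ := hQ
      exact ⟨P + Q, map_add _ _ _⟩
    | mul_X P i hP =>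
      obtain ⟨P, rfl⟩ := hP
      exact ⟨P * X (Sum.inr i), by simp [lift]⟩
  have hprime : (RingHom.ker ev).IsPrime := RingHom.ker_isPrime _
  have hhI : lift h ∉ RingHom.ker ev := by
    rw [RingHom.mem_ker, hev]; exact hh
  obtain ⟨b, hb, hnzd⟩ := exists_generic_nonzerodivisor (k := k) (RingHom.ker ev) hhI
  obtain ⟨b, β, rfl⟩ := b
  refine ⟨{y | y.minors I ≠ 0 ∧ eval (fun ac => y.graph I ac.1 ac.2) β ≠ 0},
    Grassmannian.isOpen_eval_graph_ne_zero I β, ?_, fun y hy => hy.1, fun y hy q hq hqj => ?_⟩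
  · have h1 : aeval ξ (rename Sum.inl β) ≠ 0 := by
      rw [aeval_rename]
      exact fun h0 => hb (Subtype.ext h0)
    obtain ⟨t, ht⟩ := hξ.exists_eval_ne_zero h1
    rw [eval_rename] at ht
    exact ⟨_, ⟨t.1.1, t.1.2, rfl⟩, t.2.1, ht⟩
  · -- points of the fibre in the chart
    have hpt : ∀ q ∈ fibre F y, q.rep j ≠ 0 → ∃ t : T, t.1.1 = ⟨y, q⟩ ∧
        κ t = Sum.elim (fun ac => y.graph I ac.1 ac.2) (projChart j q) := fun q hq hqj =>
      ⟨⟨⟨_, hq⟩, hy.1, hqj⟩, rfl, rfl⟩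
    obtain ⟨t₀, ht₀, hκt₀⟩ := hpt q hq hqj
    -- the plane `y` as a homomorphism
    obtain ⟨yB, hyB⟩ : ∃ yB : B →ₐ[k] k, ∀ ac, yB (b₀ ac) = y.graph I ac.1 ac.2 := by
      refine ⟨AlgHom.liftOfSurjective (aeval (R := k) fun ac => ξ (Sum.inl ac)).rangeRestrict
        (AlgHom.rangeRestrict_surjective _) (aeval fun ac => y.graph I ac.1 ac.2) ?_, fun ac => ?_⟩
      · intro P hP
        rw [RingHom.mem_ker] at hP ⊢
        have h1 : aeval (fun ac => ξ (Sum.inl ac)) P = 0 := congrArg Subtype.val hP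
        have h2 : aeval ξ (rename Sum.inl P) = 0 := by rw [aeval_rename]; exact h1
        have h3 := (hξ _).1 h2 t₀
        rw [eval_rename, hκt₀] at h3
        exact h3
      · have h1 : b₀ ac = (aeval (R := k) fun ac => ξ (Sum.inl ac)).rangeRestrict (X ac) :=
          Subtype.ext (aeval_X (fun ac => ξ (Sum.inl ac)) ac).symm
        rw [h1, AlgHom.liftOfSurjective_apply, aeval_X]
    have hlift_eval : ∀ (P : MvPolynomial (ChartIndex n N N') k) (r : Fin (N' + 1) → k),
        eval r (map yB.toRingHom (lift P)) =
          eval (Sum.elim (fun ac => y.graph I ac.1 ac.2) r) P := by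
      intro P r
      have h1 : ∀ Q, eval r (map yB.toRingHom Q) = eval₂Hom yB.toRingHom r Q :=
        fun Q => eval_map _ _ _
      rw [h1]
      induction P using MvPolynomial.induction_on with
      | C c =>
        have h2 : lift (C c) = C (algebraMap k B c) := lift.commutes c
        rw [h2, coe_eval₂Hom, eval₂_C, eval_C]
        exact yB.commutes c
      | add P Q hP hQ => rw [map_add, map_add, map_add, hP, hQ]
      | mul_X P i hP =>
        rw [map_mul, map_mul, map_mul, hP, eval_X]
        congr 1
        rcases i with ac | l
        · simp only [lift, aeval_X, Sum.elim_inl, coe_eval₂Hom, eval₂_C]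
          exact hyB ac
        · simp only [lift, aeval_X, Sum.elim_inr, coe_eval₂Hom, eval₂_X]
    have hsurj : Function.Surjective yB.toRingHom := fun c => ⟨algebraMap k B c, yB.commutes c⟩
    have hyb : yB.toRingHom ⟨_, ⟨β, rfl⟩⟩ ≠ 0 := by
      have h1 : yB.comp (aeval (R := k) fun ac => ξ (Sum.inl ac)).rangeRestrict =
          aeval fun ac => y.graph I ac.1 ac.2 := by
        ext ac
        have h2 : (aeval (R := k) fun ac => ξ (Sum.inl ac)).rangeRestrict (X ac) = b₀ ac :=
          Subtype.ext (aeval_X (fun ac => ξ (Sum.inl ac)) ac)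
        rw [AlgHom.comp_apply, h2, hyB, aeval_X]
      exact fun h0 => hy.2 ((DFunLike.congr_fun h1 β).symm.trans h0)
    have hnzd' := hnzd yB.toRingHom hsurj hyb
    -- `J` is an ideal, not necessarily a radical one, whose zero locus is the fibre over `y`
    set J := (RingHom.ker ev).map (map yB.toRingHom) with hJ
    have hmemJ : ∀ P, aeval ξ P = 0 → map yB.toRingHom (lift P) ∈ J := fun P hP =>
      Ideal.mem_map_of_mem _ (by rw [RingHom.mem_ker, hev, hP])
    have hzero : ∀ r ∈ zeroLocus k J, ∃ t : T, t.1.1.plane = y ∧ κ t =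
        Sum.elim (fun ac => y.graph I ac.1 ac.2) r := by
      intro r hr
      obtain ⟨t, ht⟩ : (Sum.elim (fun ac => y.graph I ac.1 ac.2) r : AffSpace k _) ∈
          Set.range κ := by
        refine AffSpace.mem_of_isClosed hκ.isClosed_range fun P hP => ?_
        rw [← hlift_eval]
        exact hr _ (hmemJ P ((hξ P).2 fun t => hP _ ⟨t, rfl⟩))
      refine ⟨t, Grassmannian.graph_injective t.2.1 hy.1 (Matrix.ext fun a c => ?_), ht⟩
      exact congrFun ht (Sum.inl (a, c))
    have hq0 : projChart j q ∈ zeroLocus k J := by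
      rw [hJ, mem_zeroLocus_iff]
      intro g hg
      obtain ⟨g, hg', rfl⟩ := (Ideal.mem_map_iff_of_surjective _ (map_surjective _ hsurj)).1 hg
      obtain ⟨P, rfl⟩ := hlift g
      rw [RingHom.mem_ker, hev] at hg'
      have h1 := (hξ P).1 hg' t₀
      rw [hκt₀, ← hlift_eval] at h1
      exact h1
    rw [projective_isTopologicalBasis.mem_closure_iff]
    rintro _ ⟨d, f, hf, rfl⟩ hfq
    by_contra hcon
    have hvan : ∀ q' ∈ fibre F y, ⟨y, q'⟩ ∈ V → eval q'.rep f = 0 := by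
      intro q' hq' hV'
      by_contra hne
      exact hcon ⟨q', hne, hq', hV'⟩
    -- by the Nullstellensatz; `lift h` can then be cancelled modulo `J`
    have hrad : f * map yB.toRingHom (lift h) ∈ J.radical := by
      rw [← vanishingIdeal_zeroLocus_eq_radical (K := k), mem_vanishingIdeal_iff]
      intro r hr
      obtain ⟨t, hty, htr⟩ := hzero r hr
      change eval r _ = 0
      rw [map_mul, hlift_eval, ← htr, mul_eq_zero, or_iff_not_imp_right]
      intro hth
      have hmk : (⟨y, t.1.1.point⟩ : GrassProd k n N N') = t.1.1 := GrassProd.ext hty.symm rfl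
      have h1 := hvan t.1.1.point (by rw [fibre, Set.mem_ofPred_eq, hmk]; exact t.1.2)
        (by rw [hmk]; exact hhV t hth)
      have h2 : projChart j t.1.1.point = r := funext fun l => congrFun htr (Sum.inr l)
      rw [← h2]
      exact not_not.1 fun h3 => (eval_projChart t.2.2 hf).1 h3 h1
    obtain ⟨m, hm⟩ := hrad
    have hpow : ∀ i, map yB.toRingHom (lift h) ^ i * f ^ m ∈ J → f ^ m ∈ J := by
      intro i
      induction i with
      | zero => intro h; simpa using h
      | succ i ih => exact fun h => ih (hnzd' _ (by rwa [← mul_assoc, ← pow_succ']))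
    have h1 : eval (projChart j q) (f ^ m) = 0 :=
      hq0 _ (hpow m (by rwa [← mul_pow, mul_comm]))
    rw [map_pow] at h1
    exact (eval_projChart hqj hf).2 hfq (eq_zero_of_pow_eq_zero h1)

/-- A nonempty open subset of a variety is dense in the general fibres. -/
theorem exists_open_subset_closure {F V : Set (GrassProd k n N N')} (hF : IsVariety F)
    (hV : IsOpen V) (hne : (F ∩ V).Nonempty) :
    ∃ O : Set (Grassmannian k n N), IsOpen O ∧ (GrassProd.plane '' F ∩ O).Nonempty ∧
      ∀ y ∈ O, fibre F y ⊆ closure {q ∈ fibre F y | ⟨y, q⟩ ∈ V} := by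
  classical
  obtain ⟨z, hzF, hzV⟩ := hne
  obtain ⟨I, hI⟩ := z.plane.exists_minors_apply_ne_zero
  have hirr : IsIrreducible (GrassProd.plane '' F) :=
    hF.isIrreducible.image _ continuous_plane.continuousOn
  have hj : ∀ j : Fin (N' + 1), ∃ O : Set (Grassmannian k n N), IsOpen O ∧
      (GrassProd.plane '' F ∩ O).Nonempty ∧ (∀ y ∈ O, y.minors I ≠ 0) ∧
      ∀ y ∈ O, ∀ q ∈ fibre F y, q.rep j ≠ 0 → q ∈ closure {q ∈ fibre F y | ⟨y, q⟩ ∈ V} := by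
    intro j
    by_cases hc : (F ∩ chart I j).Nonempty
    · exact exists_open_subset_closure_chart hF hV ⟨z, hzF, hzV⟩ I j hc
    · refine ⟨_, Grassmannian.isOpen_minors_ne_zero I, ⟨_, ⟨z, hzF, rfl⟩, hI⟩, fun _ h => h, ?_⟩
      exact fun y hy q hq hqj => (hc ⟨⟨y, q⟩, hq, hy, hqj⟩).elim
  choose O hO hOne hOI hOq using hj
  refine ⟨⋂ j, O j, isOpen_iInter_of_finite hO, ?_, fun y hy q hq => ?_⟩
  · have h := isIrreducible_iff_sInter.1 hirr (Finset.univ.image O) (by simpa using hO)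
      (by simpa using hOne)
    simpa using h
  · obtain ⟨j, hj⟩ := exists_rep_apply_ne_zero q
    exact hOq j y (Set.mem_iInter.1 hy j) q hq hj

end Fibres

/-! ### Linear embeddings of projective spaces and fibres -/

section LinearEmbedding

variable {k : Type*} [Field k] {ι ι' : Type*} [Fintype ι]

/-- The substitution of linear forms in a homogeneous polynomial. -/
theorem eval_linearMap_isHomogeneous [DecidableEq ι] (φ : (ι → k) →ₗ[k] (ι' → k))
    {d : ℕ} {f : MvPolynomial ι' k} (hf : f.IsHomogeneous d) :
    ∃ g : MvPolynomial ι k, g.IsHomogeneous d ∧ ∀ v, eval v g = eval (φ v) f := by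
  refine ⟨bind₁ (fun l => ∑ i, C (φ (Pi.single i 1) l) * X i) f, ?_, fun v => ?_⟩
  · have h := hf.aeval (n := 1) (fun l : ι' => (∑ i, C (φ (Pi.single i 1) l) * X i :
      MvPolynomial ι k)) fun l => IsHomogeneous.sum _ _ _ fun i _ => isHomogeneous_C_mul_X _ _
    rwa [one_mul] at h
  · rw [eval_bind₁_eq]
    congr 2
    funext l
    conv_rhs => rw [pi_eq_sum_univ' v]
    simp [mul_comm]

/-- A linear embedding of projective spaces has a linear left inverse `ψ`; its image is the set of
fixed points of `φ ∘ ψ`. -/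
theorem isClosedEmbedding_projectivizationMap [Fintype ι'] [DecidableEq ι] [DecidableEq ι']
    (φ : (ι → k) →ₗ[k] (ι' → k)) (hφ : Function.Injective φ) :
    IsClosedEmbedding (Projectivization.map φ hφ) := by
  have hmk : ∀ x : ℙ k (ι → k), ∃ h : φ x.rep ≠ 0,
      Projectivization.map φ hφ x = Projectivization.mk k (φ x.rep) h := fun x => by
    refine ⟨fun h => x.rep_nonzero (hφ (h.trans (map_zero φ).symm)), ?_⟩
    conv_lhs => rw [← x.mk_rep]
    rfl
  obtain ⟨ψ, hψ⟩ := φ.exists_leftInverse_of_injective (LinearMap.ker_eq_bot.2 hφ)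
  have hψ' : ∀ v, ψ (φ v) = v := fun v => LinearMap.congr_fun hψ v
  refine ⟨⟨⟨le_antisymm ?_ ?_⟩, Projectivization.map_injective φ hφ⟩, ?_⟩
  · rw [← continuous_iff_le_induced, continuous_projective_iff]
    intro d f hf
    obtain ⟨g, hg, hgf⟩ := eval_linearMap_isHomogeneous φ hf
    convert isOpen_eval_rep_ne_zero hg using 1
    ext x
    obtain ⟨h, hx⟩ := hmk x
    rw [Set.mem_ofPred_eq, Set.mem_ofPred_eq, hx, eval_rep_mk_ne_zero_iff hf, hgf]
  · refine le_generateFrom ?_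
    rintro _ ⟨d, f, hf, rfl⟩
    obtain ⟨g, hg, hgf⟩ := eval_linearMap_isHomogeneous ψ hf
    refine isOpen_induced_iff.2 ⟨_, isOpen_eval_rep_ne_zero hg, ?_⟩
    ext x
    obtain ⟨h, hx⟩ := hmk x
    rw [Set.mem_preimage, Set.mem_ofPred_eq, Set.mem_ofPred_eq, hx, eval_rep_mk_ne_zero_iff hg, hgf,
      hψ']
  · have hrange : Set.range (Projectivization.map φ hφ) = ⋂ l, {x | eval x.rep
        (∑ i, C (φ (ψ (Pi.single i 1)) l) * X i - X l) ≠ 0}ᶜ := by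
      have heval : ∀ (v : ι' → k) l, eval v (∑ i, C (φ (ψ (Pi.single i 1)) l) * X i - X l) =
          φ (ψ v) l - v l := by
        intro v l
        have h1 : φ (ψ v) l = ∑ i, v i * φ (ψ (Pi.single i 1)) l := by
          conv_lhs => rw [pi_eq_sum_univ' v]
          simp
        simp [h1, mul_comm]
      ext x
      simp only [Set.mem_iInter, Set.mem_compl_iff, Set.mem_ofPred_eq, not_not, heval, sub_eq_zero]
      constructor
      · rintro ⟨y, rfl⟩ l
        obtain ⟨h, hy⟩ := hmk y
        obtain ⟨c, hc⟩ := Projectivization.exists_smul_eq_mk_rep k _ h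
        rw [hy, ← hc, Units.smul_def, map_smul, map_smul, hψ']
      · intro hx
        have h0 : ψ x.rep ≠ 0 := fun h0 => x.rep_nonzero (by rw [← funext hx, h0, map_zero])
        refine ⟨Projectivization.mk k _ h0, ?_⟩
        rw [Projectivization.map_mk]
        conv_rhs => rw [← x.mk_rep]
        congr 1
        exact funext hx
    rw [hrange]
    refine isClosed_iInter fun l => ?_
    rw [isClosed_compl_iff]
    exact isOpen_eval_rep_ne_zero ((IsHomogeneous.sum _ _ _ fun i _ => isHomogeneous_C_mul_X _ _).sub
      (isHomogeneous_X _ _))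

end LinearEmbedding

theorem isClosed_fibre {k : Type*} [Field k] {n N N' : ℕ} {F : Set (GrassProd k n N N')}
    (hF : IsClosed F) (y : Grassmannian k n N) : IsClosed (fibre F y) := by
  suffices h : Continuous fun q : PSpace k N' => (⟨y, q⟩ : GrassProd k n N N') from hF.preimage h
  rw [continuous_iff_continuousAt]
  intro q
  obtain ⟨j, hj⟩ := exists_rep_apply_ne_zero q
  suffices h : ContinuousOn (fun q : PSpace k N' => (⟨y, q⟩ : GrassProd k n N N'))
      {q | q.rep j ≠ 0} from h.continuousAt ((isOpen_rep_apply_ne_zero j).mem_nhds hj)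
  rw [continuousOn_iff_continuous_domRestrict]
  refine continuous_grassProd_of_polynomial (continuous_projChart j) (fun J => C (y.minors J))
    X _ (fun q => ?_) fun q => ?_
  · simp only [eval_C]
    exact ⟨y.minors_ne_zero, rfl⟩
  · simp only [eval_X]
    exact ⟨projChart_ne_zero q.2, (mk_projChart q.2).symm⟩

/-! ### Linear embeddings along families of linear subspaces -/

section Spread

variable {k : Type*} [Field k] {n N' : ℕ}

/-- The linear map that takes the coordinate with index `j` to the first coordinate and the other
coordinates, in their order, to the following ones, and then adds multiples `b i` of the first
coordinate. It is injective if `N' ≤ n`. -/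
def spread (j : Fin (N' + 1)) (b : Fin n → k) :
    (Fin (N' + 1) → k) →ₗ[k] (Fin (n + 1) → k) where
  toFun q := Fin.cons (q j) fun i =>
    (if h : (i : ℕ) < N' then q (j.succAbove ⟨i, h⟩) else 0) + b i * q j
  map_add' q q' := by
    funext a
    induction a using Fin.cases with
    | zero => simp
    | succ i => by_cases h : (i : ℕ) < N' <;> simp [h] <;> ring
  map_smul' c q := by
    funext a
    induction a using Fin.cases with
    | zero => simp
    | succ i => by_cases h : (i : ℕ) < N' <;> simp [h] <;> ring

/-- The left inverse of `spread`. -/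
def unspread (hN : N' ≤ n) (j : Fin (N' + 1)) (b : Fin n → k) (z : Fin (n + 1) → k) :
    Fin (N' + 1) → k :=
  j.insertNth (z 0) fun m => z (Fin.castLE hN m).succ - b (Fin.castLE hN m) * z 0

theorem unspread_spread (hN : N' ≤ n) (j : Fin (N' + 1)) (b : Fin n → k) (q : Fin (N' + 1) → k) :
    unspread hN j b (spread j b q) = q := by
  funext l
  rcases Fin.eq_self_or_eq_succAbove j l with rfl | ⟨m, rfl⟩
  · simp [unspread, spread]
  · simp [unspread, spread]

end Spread

section FibreEmbedding

variable {k : Type*} [Field k] (p : ℕ) [hp : Fact p.Prime] [CharP k p] [PerfectRing k p]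
  {n N N' : ℕ} (I : Fin (n + 1) → Fin (N + 1)) (j : Fin (N' + 1))
  (b : Fin n → Option (Fin (n + 1) × Fin (N + 1)))

/-- The multiples that are used in the linear embedding into the subspace `y`: zero or a `p`-th root
of an entry of its graph matrix, as prescribed by `b`. -/
def shift (y : Grassmannian k n N) (i : Fin n) : k :=
  (b i).elim 0 fun ac => (frobeniusEquiv k p).symm (y.graph I ac.1 ac.2)

/-- The linear embedding of `k^(N'+1)` into the subspace `y`. -/
def fibreEmbedding (y : Grassmannian k n N) : (Fin (N' + 1) → k) →ₗ[k] (Fin (N + 1) → k) :=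
  (y.graph I).vecMulLinear ∘ₗ spread j (shift p I b y)

theorem fibreEmbedding_apply (y : Grassmannian k n N) (q : Fin (N' + 1) → k) :
    fibreEmbedding p I j b y q = Matrix.vecMul (spread j (shift p I b y) q) (y.graph I) := rfl

variable {I}

theorem unspread_fibreEmbedding (hN : N' ≤ n) {y : Grassmannian k n N} (hy : y.minors I ≠ 0)
    (q : Fin (N' + 1) → k) :
    unspread hN j (shift p I b y) (fibreEmbedding p I j b y q ∘ I) = q := by
  have h : fibreEmbedding p I j b y q ∘ I =
      Matrix.vecMul (spread j (shift p I b y) q) ((y.graph I).submatrix id I) := rfl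
  rw [h, Grassmannian.graph_submatrix hy, Matrix.vecMul_one, unspread_spread]

theorem fibreEmbedding_injective (hN : N' ≤ n) {y : Grassmannian k n N} (hy : y.minors I ≠ 0) :
    Function.Injective (fibreEmbedding p I j b y) := fun q q' h => by
  rw [← unspread_fibreEmbedding p j b hN hy q, h, unspread_fibreEmbedding p j b hN hy]

/-- The polynomials that compute `shift` from the coordinates `rootCoord`. -/
def shiftPoly (i : Fin n) : MvPolynomial (ChartIndex n N N) k :=
  (b i).elim 0 fun ac => X (Sum.inl ac)

/-- The polynomials that compute, from the coordinates `rootCoord` of a plane and a point of it, the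
preimage of the point under the linear embedding. -/
def unspreadPoly (I : Fin (n + 1) → Fin (N + 1)) (hN : N' ≤ n) (l : Fin (N' + 1)) :
    MvPolynomial (ChartIndex n N N) k :=
  j.insertNth (α := fun _ => MvPolynomial (ChartIndex n N N) k) (X (Sum.inr (I 0))) (fun m =>
    X (Sum.inr (I (Fin.castLE hN m).succ)) - shiftPoly b (Fin.castLE hN m) * X (Sum.inr (I 0))) l

theorem eval_shiftPoly (i₁ : Fin (N + 1)) (z : GrassProd k n N N) (i : Fin n) :
    eval (rootCoord p I i₁ z) (shiftPoly b i) = shift p I b z.plane i := by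
  rw [shiftPoly, shift]
  cases b i with
  | none => simp
  | some ac => simp [rootCoord, rootHomeomorph, chartCoord]

theorem eval_unspreadPoly (hN : N' ≤ n) (i₁ : Fin (N + 1)) (z : GrassProd k n N N)
    (l : Fin (N' + 1)) : eval (rootCoord p I i₁ z) (unspreadPoly j b I hN l) =
      unspread hN j (shift p I b z.plane) (projChart i₁ z.point ∘ I) l := by
  rw [unspreadPoly, unspread]
  rcases Fin.eq_self_or_eq_succAbove j l with rfl | ⟨m, rfl⟩
  · simp [rootCoord_inr]
  · simp [rootCoord_inr, eval_shiftPoly]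

/-- The polynomials that compute the difference of a vector `w` and the image of its preimage under
the linear embedding. They vanish if `w` is in the image. -/
def residuePoly (I : Fin (n + 1) → Fin (N + 1)) (hN : N' ≤ n) (c : Fin (N + 1)) :
    MvPolynomial (ChartIndex n N N) k :=
  ∑ a, (Fin.cons (unspreadPoly j b I hN j) (fun i =>
    (if h : (i : ℕ) < N' then unspreadPoly j b I hN (j.succAbove ⟨i, h⟩) else 0) +
      shiftPoly b i * unspreadPoly j b I hN j) : Fin (n + 1) → MvPolynomial (ChartIndex n N N) k) a *
    X (Sum.inl (a, c)) ^ p - X (Sum.inr c)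

theorem eval_residuePoly (hN : N' ≤ n) (i₁ : Fin (N + 1)) (z : GrassProd k n N N)
    (c : Fin (N + 1)) : eval (rootCoord p I i₁ z) (residuePoly p j b I hN c) =
      fibreEmbedding p I j b z.plane
        (unspread hN j (shift p I b z.plane) (projChart i₁ z.point ∘ I)) c -
        projChart i₁ z.point c := by
  rw [residuePoly, map_sub, eval_X, rootCoord_inr, fibreEmbedding_apply, Matrix.vecMul, dotProduct,
    map_sum]
  congr 1
  refine Finset.sum_congr rfl fun a _ => ?_
  rw [map_mul, map_pow, eval_X, rootCoord_inl_pow]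
  congr 1
  induction a using Fin.cases with
  | zero => simp [spread, eval_unspreadPoly]
  | succ i =>
    by_cases h : (i : ℕ) < N' <;>
      simp [spread, eval_unspreadPoly, eval_shiftPoly, h]

theorem continuous_rootCoord {M : ℕ} {T : Type*} [TopologicalSpace T] {f : T → GrassProd k n N M}
    (hf : Continuous f) {i : Fin (M + 1)} (h : ∀ t, f t ∈ chart I i) :
    Continuous (fun t => (rootCoord p I i (f t) : AffSpace k (ChartIndex n N M))) := by
  have h1 : Continuous (fun t => (⟨f t, h t⟩ : chart (k := k) (N' := M) I i)) := hf.subtype_mk h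
  have h2 := (isClosedEmbedding_rootCoord (k := k) (N' := M) p I i).continuous
  have h3 := h2.comp h1
  change Continuous ((fun z : chart (k := k) (N' := M) I i => rootCoord p I i z.1) ∘
    fun t => ⟨f t, h t⟩)
  exact h3

/-- If the points of a nonempty open subset of a variety are the images of the points of a closed
family `F` under the linear embeddings into their tangent spaces, then all smooth points are such
images. -/
theorem gaussFibre_subset (hN : N' ≤ n) {X U : Set (PSpace k N)} (hX : IsIrreducible X)
    (hU : IsOpen U) (hne : (X ∩ U).Nonempty) {F : Set (GrassProd k n N N')} (hF : IsClosed F)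
    (h : ∀ x ∈ X ∩ U, ∃ z ∈ F, z.plane.minors I ≠ 0 ∧ tangentSpace X x = z.plane.toSubmodule ∧
      ∃ hz, x = Projectivization.mk k (fibreEmbedding p I j b z.plane z.point.rep) hz)
    {y : Grassmannian k n N} (hy : y.minors I ≠ 0) :
    gaussFibre n X y ⊆
      Projectivization.map (fibreEmbedding p I j b y) (fibreEmbedding_injective p j b hN hy) ''
        fibre F y := by
  rintro _ ⟨x₁, rfl, rfl⟩
  obtain ⟨i₁, hi₁⟩ := exists_rep_apply_ne_zero x₁.1
  have hsm : ∀ x ∈ X ∩ U, x ∈ smoothLocus n X := fun x hx => by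
    obtain ⟨z, -, -, hT, -⟩ := h x hx
    exact mem_smoothLocus_of_eq hx.1 hT
  let D : Set (smoothLocus n X) := gaussGraph n X ⁻¹' chart I i₁
  have hD : IsOpen D := (isOpen_chart I i₁).preimage (continuous_gaussGraph n X)
  have hdense : Dense {x : D | x.1.1 ∈ U} :=
    (dense_smoothLocus hX hU hne hsm).preimage hD.isOpenMap_subtype_val
  let κ : D → AffSpace k (ChartIndex n N N) := fun x => rootCoord p I i₁ (gaussGraph n X x.1)
  have hκ : Continuous κ := continuous_rootCoord p
    ((continuous_gaussGraph n X).comp continuous_subtype_val) fun x => x.2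
  let ψ : D → (Fin (N' + 1) → k) := fun x =>
    unspread hN j (shift p I b (gaussMap n X x.1)) (projChart i₁ x.1.1 ∘ I)
  -- on the open subset `U`, the preimage under the linear embedding is `z.point` up to a scalar
  have hUspec : ∀ x : D, x.1.1 ∈ U → fibreEmbedding p I j b (gaussMap n X x.1) (ψ x) =
      projChart i₁ x.1.1 ∧ ∃ h0 : ψ x ≠ 0,
        (⟨gaussMap n X x.1, Projectivization.mk k (ψ x) h0⟩ : GrassProd k n N N') ∈ F := by
    intro x hxU
    obtain ⟨z, hzF, hzI, hT, hz, hxz⟩ := h x.1.1 ⟨x.1.2.1, hxU⟩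
    have hplane : gaussMap n X x.1 = z.plane := Grassmannian.ext hT
    have hx1 : (x.1.1).rep i₁ ≠ 0 := x.2.2
    obtain ⟨c, hc, hcx⟩ : ∃ c : k, c ≠ 0 ∧ projChart i₁ x.1.1 =
        fibreEmbedding p I j b z.plane (c • z.point.rep) := by
      have h1 := hx1
      rw [hxz, rep_mk_apply_ne_zero_iff] at h1
      refine ⟨(fibreEmbedding p I j b z.plane z.point.rep i₁)⁻¹, inv_ne_zero h1, ?_⟩
      rw [hxz, projChart_mk, map_smul]
      funext l
      simp [div_eq_inv_mul]
    have hψ : ψ x = c • z.point.rep := by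
      simp only [ψ]
      rw [hplane, hcx, unspread_fibreEmbedding p j b hN hzI]
    refine ⟨by rw [hψ, hplane, hcx], ?_⟩
    have h0 : ψ x ≠ 0 := by
      rw [hψ]
      exact smul_ne_zero hc z.point.rep_nonzero
    refine ⟨h0, ?_⟩
    have h2 : (⟨gaussMap n X x.1, Projectivization.mk k (ψ x) h0⟩ : GrassProd k n N N') = z := by
      refine GrassProd.ext hplane ?_
      conv_rhs => rw [← z.point.mk_rep]
      rw [Projectivization.mk_eq_mk_iff']
      exact ⟨c, hψ.symm⟩
    rwa [h2]
  -- both assertions extend to `D` since they define closed subsets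
  have hres : ∀ x : D, fibreEmbedding p I j b (gaussMap n X x.1) (ψ x) = projChart i₁ x.1.1 := by
    intro x
    have hcl : IsClosed {x : D | ∀ c, eval (κ x) (residuePoly p j b I hN c) = 0} := by
      have : {x : D | ∀ c, eval (κ x) (residuePoly p j b I hN c) = 0} =
          ⋂ c, κ ⁻¹' {w | eval w (residuePoly p j b I hN c) = 0} := by
        ext; simp
      rw [this]
      exact isClosed_iInter fun c => (AffSpace.isClosed_eq _).preimage hκ
    have hsub : {x : D | x.1.1 ∈ U} ⊆
        {x : D | ∀ c, eval (κ x) (residuePoly p j b I hN c) = 0} := by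
      intro x hx c
      simp only [κ]
      rw [eval_residuePoly]
      exact sub_eq_zero.2 (congrFun (hUspec x hx).1 c)
    have h1 := closure_minimal hsub hcl
    rw [hdense.closure_eq] at h1
    have h2 := h1 (Set.mem_univ x)
    funext c
    have h3 := h2 c
    simp only [κ] at h3
    rw [eval_residuePoly] at h3
    exact sub_eq_zero.1 h3
  have hψ0 : ∀ x : D, ψ x ≠ 0 := fun x h0 => by
    have h1 := hres x
    rw [h0, map_zero] at h1
    exact projChart_ne_zero (i₀ := i₁) (x := x.1.1) x.2.2 h1.symm
  let Ψ : D → GrassProd k n N N' := fun x =>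
    ⟨gaussMap n X x.1, Projectivization.mk k (ψ x) (hψ0 x)⟩
  have hΨ : Continuous Ψ := by
    refine continuous_grassProd_of_polynomial hκ (fun J => (Matrix.of fun a l =>
      MvPolynomial.X (Sum.inl (a, J l)) ^ p : Matrix (Fin (n + 1)) (Fin (n + 1))
        (MvPolynomial (ChartIndex n N N) k)).det)
      (unspreadPoly j b I hN) _ (fun x => ?_) fun x => ?_
    · have h1 : (fun J : Fin (n + 1) → Fin (N + 1) => eval (κ x) (Matrix.of fun a l =>
          MvPolynomial.X (Sum.inl (a, J l)) ^ p : Matrix (Fin (n + 1)) (Fin (n + 1))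
          (MvPolynomial (ChartIndex n N N) k)).det) =
          fun J => (((gaussMap n X x.1).graph I).submatrix id J).det := by
        funext J
        rw [RingHom.map_det]
        congr 1
        ext a l
        simp only [RingHom.mapMatrix_apply, Matrix.map_apply, Matrix.of_apply, map_pow, eval_X,
          Matrix.submatrix_apply, id, κ]
        exact rootCoord_inl_pow p I i₁ _ a (J l)
      have hI : (gaussMap n X x.1).minors I ≠ 0 := x.2.1
      have hdet : (((gaussMap n X x.1).graph I).submatrix id I).det ≠ 0 := by
        rw [Grassmannian.graph_submatrix hI]; simp
      obtain ⟨h, hz⟩ := Grassmannian.plucker_eq ((gaussMap n X x.1).graph_mem I) hdet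
      exact ⟨h1 ▸ h, hz.trans (by congr 1; exact h1.symm)⟩
    · have h1 : (fun l => eval (κ x) (unspreadPoly j b I hN l)) = ψ x := by
        funext l
        exact eval_unspreadPoly p j b hN i₁ _ l
      exact ⟨h1 ▸ hψ0 x, by simp only [Ψ, h1]⟩
  have hΨF : ∀ x : D, Ψ x ∈ F := by
    intro x
    have hsub : {x : D | x.1.1 ∈ U} ⊆ Ψ ⁻¹' F := fun x hx => by
      obtain ⟨h0, hmem⟩ := (hUspec x hx).2
      exact hmem
    have h1 := closure_minimal hsub (hF.preimage hΨ)
    rw [hdense.closure_eq] at h1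
    exact h1 (Set.mem_univ x)
  let x : D := ⟨x₁, hy, hi₁⟩
  refine ⟨Projectivization.mk k (ψ x) (hψ0 x), hΨF x, ?_⟩
  rw [Projectivization.map_mk]
  conv_rhs => rw [← mk_projChart hi₁]
  congr 1
  exact hres x

end FibreEmbedding

/-! ### Families from charts of the product variety -/

/-- The tangent family with coefficients `α i / α₀`, over the principal open subset on which `α₀` does
not vanish. -/
def TangentFamily.ofFractions {p : ℕ} {k : Type u} [Field k] {n N : ℕ}
    {I : Fin (n + 1) → Fin (N + 1)} {σ : Type*} {T : Type*} [TopologicalSpace T] {L : Type u} [Field L]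
    [Algebra k L] {κ : T → AffSpace k σ} (hκ : IsClosedEmbedding κ) {ξ : σ → L}
    (hξ : IsGeneric κ ξ) (htr : Algebra.trdeg k L = n)
    (root : Fin (n + 1) → Fin (N + 1) → MvPolynomial σ k)
    (hroot : ∀ t a b, eval (κ t) (root a (I b)) ^ p = if a = b then 1 else 0)
    {α₀ : MvPolynomial σ k} (hα₀ : aeval ξ α₀ ≠ 0) (α : Fin n → MvPolynomial σ k)
    (hli : LinearIndependent L fun i => D k L (aeval ξ (α i) / aeval ξ α₀))
    (hgen : ∀ K : IntermediateField k L, (∀ i, aeval ξ (α i) / aeval ξ α₀ ∈ K) →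
      (∀ a c, aeval ξ (root a c) ^ p ∈ K) → K = ⊤) :
    TangentFamily p k I (Option σ) {t : T // eval (κ t) α₀ ≠ 0} L :=
  have hcoeff : ∀ i, aeval (fun s : Option σ => s.elim (aeval ξ α₀)⁻¹ ξ)
      (rename some (α i) * X none) = aeval ξ (α i) / aeval ξ α₀ := fun i => by
    rw [map_mul, aeval_rename, aeval_X, div_eq_mul_inv]
    rfl
  have hroot' : ∀ a c, aeval (fun s : Option σ => s.elim (aeval ξ α₀)⁻¹ ξ)
      (rename some (root a c)) = aeval ξ (root a c) := fun a c => by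
    rw [aeval_rename]
    rfl
  { coord := fun t s => s.elim (eval (κ t) α₀)⁻¹ (κ t)
    isClosedEmbedding := isClosedEmbedding_principalOpen hκ α₀
    ξ := fun s => s.elim (aeval ξ α₀)⁻¹ ξ
    isGeneric := hξ.principalOpen hα₀
    trdeg_eq := htr
    coeff := Fin.cons 1 fun i => rename some (α i) * X none
    root := fun a c => rename some (root a c)
    eval_coeff_zero := fun t => by simp
    eval_root := fun t a b => by
      rw [eval_rename]
      exact hroot t a b
    linearIndependent := by
      simp only [Fin.cons_succ, hcoeff]
      exact hli
    eq_top := fun K h1 h2 => by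
      simp only [Fin.cons_succ, hcoeff] at h1
      simp only [hroot'] at h2
      exact hgen K h1 h2 }

section ChartPoints

variable {k : Type u} [Field k] {n N N' : ℕ}

/-- The part of a subset of the product variety that lies in a chart. -/
abbrev chartPoints (F : Set (GrassProd k n N N')) (I : Fin (n + 1) → Fin (N + 1))
    (j : Fin (N' + 1)) : Set F := {x | x.1 ∈ chart I j}

theorem irreducibleSpace_chartPoints {F : Set (GrassProd k n N N')} {I : Fin (n + 1) → Fin (N + 1)}
    {j : Fin (N' + 1)} (hF : IsIrreducible F) (hne : (F ∩ chart I j).Nonempty) :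
    IrreducibleSpace (chartPoints F I j) := by
  have : IrreducibleSpace F := Subtype.irreducibleSpace hF
  obtain ⟨z, hz, hz'⟩ := hne
  exact Subtype.irreducibleSpace ⟨⟨⟨z, hz⟩, hz'⟩,
    (PreirreducibleSpace.isPreirreducible_univ (X := F)).open_subset
      ((isOpen_chart I j).preimage continuous_subtype_val) (Set.subset_univ _)⟩

variable [IsAlgClosed k] (p : ℕ) [hp : Fact p.Prime] [CharP k p]

/-- The coordinates `rootCoord` on the part of `F` in a chart. -/
abbrev chartPointCoord (F : Set (GrassProd k n N N')) (I : Fin (n + 1) → Fin (N + 1))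
    (j : Fin (N' + 1)) (t : chartPoints F I j) : AffSpace k (ChartIndex n N N') :=
  rootCoord p I j t.1.1

variable {F : Set (GrassProd k n N N')} {I : Fin (n + 1) → Fin (N + 1)} {j : Fin (N' + 1)}

theorem isClosedEmbedding_chartPointCoord (hF : IsClosed F) :
    IsClosedEmbedding (chartPointCoord p F I j) :=
  isClosedEmbedding_restrict (isClosedEmbedding_rootCoord p I j) hF

/-- A generic point of a variety of dimension `n`, in a chart and with `p`-th roots of the entries of
the graph matrix as coordinates. -/
theorem exists_isGeneric_chartPointCoord (hF : IsVariety F) (hdim : topologicalKrullDim F = n)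
    (hne : (F ∩ chart I j).Nonempty) :
    ∃ (L : Type u) (_ : Field L) (_ : Algebra k L) (ξ : ChartIndex n N N' → L),
      IsGeneric (chartPointCoord p F I j) ξ ∧ IntermediateField.adjoin k (Set.range ξ) = ⊤ ∧
      Algebra.EssFiniteType k L ∧ Algebra.trdeg k L = n := by
  have := irreducibleSpace_chartPoints hF.isIrreducible hne
  have hκ := isClosedEmbedding_chartPointCoord p (I := I) (j := j) hF.isClosed
  obtain ⟨L, _, _, ξ, hξ, htop, hess⟩ := exists_isGeneric hκ.continuous
  obtain ⟨s, hs, hs'⟩ := hξ.topologicalKrullDim_eq hκ htop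
  refine ⟨L, _, _, ξ, hξ, htop, hess, ?_⟩
  have : IrreducibleSpace F := Subtype.irreducibleSpace hF.isIrreducible
  obtain ⟨z, hz, hz'⟩ := hne
  have h1 := topologicalKrullDim_eq_of_charts (T := F)
    (U := fun Ij : (Fin (n + 1) → Fin (N + 1)) × Fin (N' + 1) => chartPoints F Ij.1 Ij.2)
    (fun Ij => (isOpen_chart _ _).preimage continuous_subtype_val)
    (by
      rw [Set.eq_univ_iff_forall]
      intro x
      obtain ⟨Ij, hIj⟩ := Set.mem_iUnion.1 (iUnion_chart.superset (Set.mem_univ x.1))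
      exact Set.mem_iUnion.2 ⟨Ij, hIj⟩)
    (κ := fun Ij => chartPointCoord p F Ij.1 Ij.2)
    (fun Ij => isClosedEmbedding_chartPointCoord p hF.isClosed) (i := (I, j)) ⟨⟨z, hz⟩, hz'⟩
  rw [hdim, hs] at h1
  rw [hs']
  exact_mod_cast h1.symm

/-- If the projection of `F` to the Grassmannian is not constant, then some entry of the graph matrix
is transcendental: a family of algebraic, hence constant, entries belongs to a single plane. -/
theorem exists_transcendental {L : Type u} [Field L] [Algebra k L] (hF : IsVariety F)
    (hne : (F ∩ chart I j).Nonempty) {ξ : ChartIndex n N N' → L}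
    (hξ : IsGeneric (chartPointCoord p F I j) ξ)
    (hdim : 1 ≤ topologicalKrullDim (GrassProd.plane '' F)) :
    ∃ ac, Transcendental k (ξ (Sum.inl ac)) := by
  by_contra! hcon
  have halg : ∀ ac, ∃ c : k, algebraMap k L c = ξ (Sum.inl ac) := fun ac => by
    have h1 : IsIntegral k (ξ (Sum.inl ac)) := (not_not.1 (hcon ac)).isIntegral
    exact minpoly.mem_range_of_degree_eq_one k _
      (IsAlgClosed.degree_eq_one_of_irreducible k (minpoly.irreducible h1))
  choose c hc using halg
  have hconst : ∀ t : chartPoints F I j, ∀ ac, rootCoord p I j t.1.1 (Sum.inl ac) = c ac := by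
    intro t ac
    have h1 := (hξ (X (Sum.inl ac) - C (c ac))).1 (by simp [hc]) t
    rw [map_sub, eval_X, eval_C, sub_eq_zero] at h1
    exact h1
  obtain ⟨z, hz, hz'⟩ := hne
  have hplane : ∀ w ∈ F ∩ chart I j, w.plane = z.plane := by
    intro w hw
    refine Grassmannian.graph_injective hw.2.1 hz'.1 (Matrix.ext fun a b => ?_)
    rw [← rootCoord_inl_pow p I j, ← rootCoord_inl_pow p I j, hconst ⟨⟨w, hw.1⟩, hw.2⟩,
      hconst ⟨⟨z, hz⟩, hz'⟩]
  have hall : ∀ w ∈ F, w.plane = z.plane := by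
    intro w hw
    by_contra hne
    obtain ⟨x, hxF, hx1, hx2⟩ := hF.isIrreducible.2 _ _
      ((Grassmannian.isClosed_singleton z.plane).isOpen_compl.preimage continuous_plane)
      (isOpen_chart I j) ⟨w, hw, hne⟩ ⟨z, hz, hz'⟩
    exact hx1 (hplane x ⟨hxF, hx2⟩)
  have hsub : Subsingleton (GrassProd.plane '' F) := by
    refine ⟨?_⟩
    rintro ⟨_, w, hw, rfl⟩ ⟨_, w', hw', rfl⟩
    exact Subtype.ext ((hall w hw).trans (hall w' hw').symm)
  have h0 : topologicalKrullDim (GrassProd.plane '' F) ≤ 0 := by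
    have : Subsingleton (IrreducibleCloseds (GrassProd.plane '' F)) := ⟨fun A B => by
      ext x
      obtain ⟨a, ha⟩ := A.isIrreducible.nonempty
      obtain ⟨b, hb⟩ := B.isIrreducible.nonempty
      exact ⟨fun _ => Subsingleton.elim b x ▸ hb, fun _ => Subsingleton.elim a x ▸ ha⟩⟩
    exact Order.krullDim_nonpos_of_subsingleton
  have := hdim.trans h0
  exact absurd this (by norm_num)

/-- The variety swept out by the vectors with coefficients `α i / α₀` in the planes of `F`, the planes
being its tangent spaces. The numerators `α i` and the denominator `α₀` are polynomials in the
coordinates `rootCoord`, so that the differentials of the entries of the graph matrix vanish. -/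
theorem exists_variety_of_fractions (hF : IsVariety F) (hne : (F ∩ chart I j).Nonempty)
    {L : Type u} [Field L] [Algebra k L] [Algebra.EssFiniteType k L] {ξ : ChartIndex n N N' → L}
    (hξ : IsGeneric (chartPointCoord p F I j) ξ) (htr : Algebra.trdeg k L = n)
    {α₀ : MvPolynomial (ChartIndex n N N') k} (hα₀ : aeval ξ α₀ ≠ 0)
    (α : Fin n → MvPolynomial (ChartIndex n N N') k)
    (hli : LinearIndependent L fun i => D k L (aeval ξ (α i) / aeval ξ α₀))
    (hgen : ∀ K : IntermediateField k L, (∀ i, aeval ξ (α i) / aeval ξ α₀ ∈ K) →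
      (∀ ac, ξ (Sum.inl ac) ^ p ∈ K) → K = ⊤) :
    ∃ (X : Set (PSpace k N)) (h : RatMap X F) (U : Set (PSpace k N))
      (V : Set (GrassProd k n N N')), IsVariety X ∧ topologicalKrullDim X = n ∧
      IsOpen U ∧ IsOpen V ∧ U ⊆ h.dom ∧ (X ∩ U).Nonempty ∧ (F ∩ V).Nonempty ∧
      Set.BijOn h.toFun (X ∩ U) (F ∩ V) ∧
      (∀ x ∈ X ∩ U, tangentSpace X x = (h.toFun x).plane.toSubmodule) ∧
      ∀ x ∈ X ∩ U, h.toFun x ∈ chart I j ∧ ∃ hz, x = Projectivization.mk k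
        (Matrix.vecMul (Fin.cons 1 fun i => eval (rootCoord p I j (h.toFun x)) (α i) /
          eval (rootCoord p I j (h.toFun x)) α₀) ((h.toFun x).plane.graph I)) hz := by
  have := irreducibleSpace_chartPoints hF.isIrreducible hne
  have hκ := isClosedEmbedding_chartPointCoord p (I := I) (j := j) hF.isClosed
  let P := TangentFamily.ofFractions (p := p) (I := I) hκ hξ htr
    (fun a c => MvPolynomial.X (Sum.inl (a, c)))
    (fun t a b => by
      rw [eval_X]
      exact (rootCoord_inl_pow p I j t.1.1 a (I b)).trans
        (Grassmannian.graph_apply_self t.2.1 a b)) hα₀ α hli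
    (fun K h1 h2 => hgen K h1 fun ac => by simpa using h2 ac.1 ac.2)
  let T := {t : chartPoints F I j // eval (chartPointCoord p F I j t) α₀ ≠ 0}
  let π : T → GrassProd k n N N' := fun t => t.1.1.1
  have hTopen : IsOpen {t : chartPoints F I j | eval (chartPointCoord p F I j t) α₀ ≠ 0} :=
    (AffSpace.isOpen_ne α₀).preimage hκ.continuous
  have hTne : ∃ t : chartPoints F I j, eval (chartPointCoord p F I j t) α₀ ≠ 0 :=
    hξ.exists_eval_ne_zero hα₀
  have : IrreducibleSpace T := Subtype.irreducibleSpace ⟨hTne,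
    (PreirreducibleSpace.isPreirreducible_univ (X := chartPoints F I j)).open_subset hTopen
      (Set.subset_univ _)⟩
  have hπ : IsEmbedding π :=
    IsEmbedding.subtypeVal.comp (IsEmbedding.subtypeVal.comp IsEmbedding.subtypeVal)
  obtain ⟨O, hO, hOT⟩ := (IsEmbedding.subtypeVal (X := GrassProd k n N N') (p := (· ∈ F))).comp
    (IsEmbedding.subtypeVal (p := (· ∈ chartPoints F I j))) |>.isInducing.isOpen_iff.1 hTopen
  have hrange : Set.range π = F ∩ (chart I j ∩ O) := by
    ext z
    constructor
    · rintro ⟨t, rfl⟩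
      exact ⟨t.1.1.2, t.1.2, hOT.superset t.2⟩
    · rintro ⟨hzF, hzc, hzO⟩
      exact ⟨⟨⟨⟨z, hzF⟩, hzc⟩, hOT.subset hzO⟩, rfl⟩
  have hgraph : ∀ t, (π t).plane.graph I = P.graph t := by
    intro t
    ext a c
    change _ = eval (P.coord t) (rename some (MvPolynomial.X (Sum.inl (a, c)))) ^ p
    rw [eval_rename, eval_X]
    exact (rootCoord_inl_pow p I j t.1.1.1 a c).symm
  obtain ⟨h, U, V, hU, hV, hdom, hneU, hneV, hbij, hT, hpar⟩ := P.exists_ratMap hπ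
    ((isOpen_chart I j).inter hO) hrange (fun t => t.1.2.1) hgraph
    (fun l => MvPolynomial.X (some (Sum.inr l))) (fun t => by
      have h1 : (fun l => eval (P.coord t) (MvPolynomial.X (some (Sum.inr l)))) =
          projChart j (π t).point := by
        funext l
        rw [eval_X]
        rfl
      exact ⟨h1 ▸ projChart_ne_zero t.1.2.2,
        (mk_projChart t.1.2.2).symm.trans (by congr 1; exact h1.symm)⟩)
  refine ⟨P.variety, h, U, V, P.isVariety_variety, P.topologicalKrullDim_variety, hU, hV, hdom, hneU,
    hneV, hbij, hT, fun x hx => ?_⟩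
  obtain ⟨t, ht, rfl⟩ := hpar x hx
  rw [ht]
  refine ⟨t.1.2, ?_⟩
  have hvec : P.vec t = Matrix.vecMul (Fin.cons 1 fun i => eval (rootCoord p I j (π t)) (α i) /
      eval (rootCoord p I j (π t)) α₀) ((π t).plane.graph I) := by
    funext c
    rw [P.vec_apply, hgraph, Matrix.vecMul, dotProduct]
    refine Finset.sum_congr rfl fun a _ => ?_
    congr 1
    induction a using Fin.cases with
    | zero => exact P.eval_coeff_zero t
    | succ i =>
      change eval (P.coord t) (rename some (α i) * MvPolynomial.X none) = _
      rw [map_mul, eval_rename, eval_X, Fin.cons_succ, div_eq_mul_inv]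
      rfl
  exact ⟨hvec ▸ P.vec_ne_zero t, by rw [TangentFamily.point]; congr 1⟩

end ChartPoints

/-! ### The two choices of coefficients -/

section Choices

variable {k : Type u} [Field k] [IsAlgClosed k] {n N N' : ℕ} {F : Set (GrassProd k n N N')}

/-- The family in the case without a condition on the fibres: the coefficients are obtained from a
transcendental `p`-th root of an entry of the graph matrix. -/
theorem exists_variety (p : ℕ) [hp : Fact p.Prime] [CharP k p] (hF : IsVariety F)
    (hdimF : topologicalKrullDim F = n) (hdim : 1 ≤ topologicalKrullDim (GrassProd.plane '' F)) :
    ∃ (X : Set (PSpace k N)) (h : RatMap X F) (U : Set (PSpace k N))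
      (V : Set (GrassProd k n N N')), IsVariety X ∧ topologicalKrullDim X = n ∧
      IsOpen U ∧ IsOpen V ∧ U ⊆ h.dom ∧ (X ∩ U).Nonempty ∧ (F ∩ V).Nonempty ∧
      Set.BijOn h.toFun (X ∩ U) (F ∩ V) ∧
      ∀ x ∈ X ∩ U, tangentSpace X x = (h.toFun x).plane.toSubmodule := by
  obtain ⟨z, hz⟩ := hF.isIrreducible.nonempty
  obtain ⟨⟨I, j⟩, hIj⟩ := Set.mem_iUnion.1 (iUnion_chart.superset (Set.mem_univ z))
  obtain ⟨L, _, _, ξ, hξ, htop, _, htr⟩ :=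
    exists_isGeneric_chartPointCoord p hF hdimF ⟨z, hz, hIj⟩
  obtain ⟨a, hli, hgen⟩ := exists_coordinates_of_transcendental p htr (fun ac => ξ (Sum.inl ac))
    (exists_transcendental p hF ⟨z, hz, hIj⟩ hξ hdim)
  obtain ⟨α₀, -, hα₀, h⟩ := exists_common_denominator ξ Set.univ a (fun i => by
    rw [Set.image_univ, htop]; trivial)
  choose α _ hα using h
  have ha : ∀ i, aeval ξ (α i) / aeval ξ α₀ = a i := fun i => by
    rw [hα, mul_div_cancel_left₀ _ hα₀]
  obtain ⟨X, h, U, V, hX, hdX, hU, hV, hdom, hneU, hneV, hbij, hT, -⟩ :=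
    exists_variety_of_fractions p hF ⟨z, hz, hIj⟩ hξ htr hα₀ α (by simpa only [ha] using hli)
      (fun K h1 h2 => hgen K (by simpa only [ha] using h1) h2)
  exact ⟨X, h, U, V, hX, hdX, hU, hV, hdom, hneU, hneV, hbij, hT⟩

/-- Up to a scalar, the linear embedding of the coordinates of a point is the combination of the rows
of the graph matrix with the shifted affine coordinates as coefficients. -/
theorem vecMul_eq_smul_fibreEmbedding (p : ℕ) [hp : Fact p.Prime] [CharP k p]
    {I : Fin (n + 1) → Fin (N + 1)} {j : Fin (N' + 1)}
    (b : Fin n → Option (Fin (n + 1) × Fin (N + 1))) {w : GrassProd k n N N'}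
    (hw : w.point.rep j ≠ 0) {c : Fin n → k}
    (hc : ∀ i : Fin n, c i = (if h : (i : ℕ) < N' then projChart j w.point (j.succAbove ⟨i, h⟩)
      else 0) + shift p I b w.plane i) :
    Matrix.vecMul (Fin.cons 1 c : Fin (n + 1) → k) (w.plane.graph I) =
      (w.point.rep j)⁻¹ • fibreEmbedding p I j b w.plane w.point.rep := by
  have hspread : (Fin.cons 1 c : Fin (n + 1) → k) =
      spread j (shift p I b w.plane) (projChart j w.point) := by
    funext a
    induction a using Fin.cases with
    | zero => exact (projChart_self hw).symm
    | succ i =>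
      have h2 : spread j (shift p I b w.plane) (projChart j w.point) i.succ =
          (if h : (i : ℕ) < N' then projChart j w.point (j.succAbove ⟨i, h⟩) else 0) +
            shift p I b w.plane i * projChart j w.point j := rfl
      rw [h2, projChart_self hw, mul_one, Fin.cons_succ, hc]
  rw [hspread, ← fibreEmbedding_apply, ← map_smul]
  congr 1
  funext l
  simp [projChart, div_eq_inv_mul]

/-- The family in the case of fibres in a projective space of dimension at most `n`: the coefficients
are the affine coordinates of the point, completed by zeros, up to the addition of `p`-th roots of
entries of the graph matrix, so that the points of the family over a subspace `y` are the images of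
the points of the fibre under a linear embedding. -/
theorem exists_variety_of_le (p : ℕ) [hp : Fact p.Prime] [CharP k p] (hN : N' ≤ n)
    (hF : IsVariety F) (hdimF : topologicalKrullDim F = n) :
    ∃ (I : Fin (n + 1) → Fin (N + 1)) (j : Fin (N' + 1))
      (b : Fin n → Option (Fin (n + 1) × Fin (N + 1)))
      (X : Set (PSpace k N)) (h : RatMap X F) (U : Set (PSpace k N))
      (V : Set (GrassProd k n N N')), IsVariety X ∧ topologicalKrullDim X = n ∧
      IsOpen U ∧ IsOpen V ∧ U ⊆ h.dom ∧ (X ∩ U).Nonempty ∧ (F ∩ V).Nonempty ∧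
      Set.BijOn h.toFun (X ∩ U) (F ∩ V) ∧
      (∀ x ∈ X ∩ U, tangentSpace X x = (h.toFun x).plane.toSubmodule) ∧
      ∀ x ∈ X ∩ U, (h.toFun x).plane.minors I ≠ 0 ∧ ∃ hz, x = Projectivization.mk k
        (fibreEmbedding p I j b (h.toFun x).plane (h.toFun x).point.rep) hz := by
  obtain ⟨z, hz⟩ := hF.isIrreducible.nonempty
  obtain ⟨⟨I, j⟩, hIj⟩ := Set.mem_iUnion.1 (iUnion_chart.superset (Set.mem_univ z))
  obtain ⟨L, _, _, ξ, hξ, htop, _, htr⟩ :=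
    exists_isGeneric_chartPointCoord p hF hdimF ⟨z, hz, hIj⟩
  have hξj : ξ (Sum.inr j) = 1 := by
    have h1 := (hξ (X (Sum.inr j) - 1)).2 fun t => by
      rw [map_sub, eval_X, map_one, sub_eq_zero]
      exact projChart_self t.2.2
    simpa [sub_eq_zero] using h1
  -- the affine coordinates of the point, without the one that is `1`, completed by zeros
  let s : Fin n → L := fun i =>
    if h : (i : ℕ) < N' then ξ (Sum.inr (j.succAbove ⟨i, h⟩)) else 0
  have hs : IntermediateField.adjoin k (Set.range s ∪ Set.range fun ac => ξ (Sum.inl ac)) = ⊤ := by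
    rw [eq_top_iff, ← htop, IntermediateField.adjoin_le_iff]
    rintro _ ⟨i, rfl⟩
    rcases i with ac | l
    · exact IntermediateField.subset_adjoin _ _ (Or.inr ⟨ac, rfl⟩)
    · rcases Fin.eq_self_or_eq_succAbove j l with rfl | ⟨m, rfl⟩
      · rw [hξj]
        exact one_mem _
      · refine IntermediateField.subset_adjoin _ _ (Or.inl ⟨Fin.castLE hN m, ?_⟩)
        simp [s]
  obtain ⟨b, hli, hgen⟩ := exists_coordinates_add p htr (fun ac => ξ (Sum.inl ac)) s hs
  let α : Fin n → MvPolynomial (ChartIndex n N N') k := fun i =>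
    (if h : (i : ℕ) < N' then MvPolynomial.X (Sum.inr (j.succAbove ⟨i, h⟩)) else 0) +
      (b i).elim 0 fun ac => MvPolynomial.X (Sum.inl ac)
  have hα : ∀ i, aeval ξ (α i) / aeval ξ (1 : MvPolynomial (ChartIndex n N N') k) =
      s i + (b i).elim 0 fun ac => ξ (Sum.inl ac) := by
    intro i
    rw [map_one, div_one, map_add]
    congr 1
    · by_cases h : (i : ℕ) < N' <;> simp [s, h]
    · cases b i <;> simp
  have hcoeff : ∀ (w : GrassProd k n N N') (i : Fin n), w.point.rep j ≠ 0 →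
      eval (rootCoord p I j w) (α i) / eval (rootCoord p I j w) 1 =
        (if h : (i : ℕ) < N' then projChart j w.point (j.succAbove ⟨i, h⟩) else 0) +
          shift p I b w.plane i := by
    intro w i hw
    rw [map_one, div_one, map_add]
    congr 1
    · by_cases h : (i : ℕ) < N' <;> simp [h, rootCoord_inr]
    · rw [shift]
      cases b i with
      | none => simp
      | some ac => simp [rootCoord, rootHomeomorph, chartCoord]
  obtain ⟨X, h, U, V, hX, hdX, hU, hV, hdom, hneU, hneV, hbij, hT, hpar⟩ :=
    exists_variety_of_fractions p hF ⟨z, hz, hIj⟩ hξ htr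
      (α₀ := (1 : MvPolynomial (ChartIndex n N N') k)) (by rw [map_one]; exact one_ne_zero) α
      (by simpa only [hα] using hli) (fun K h1 h2 => hgen K (by simpa only [hα] using h1) h2)
  refine ⟨I, j, b, X, h, U, V, hX, hdX, hU, hV, hdom, hneU, hneV, hbij, hT, fun x hx => ?_⟩
  obtain ⟨hchart, hne, hx'⟩ := hpar x hx
  have hvec := vecMul_eq_smul_fibreEmbedding p b hchart.2 (hcoeff (h.toFun x) · hchart.2)
  refine ⟨hchart.1, fun h0 => (h.toFun x).point.rep_nonzero (fibreEmbedding_injective p j b hN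
    hchart.1 (h0.trans (map_zero _).symm)), hx'.trans ?_⟩
  exact (Projectivization.mk_eq_mk_iff' k _ _ _ _).2 ⟨_, hvec.symm⟩

/-- The closures of the general fibres of the Gauss map are the images of the fibres of the family
under the linear embeddings. -/
theorem exists_open_projectivelyEquivalent (p : ℕ) [hp : Fact p.Prime] [CharP k p] (hN : N' ≤ n)
    (hF : IsVariety F)
    {I : Fin (n + 1) → Fin (N + 1)} {j : Fin (N' + 1)}
    {b : Fin n → Option (Fin (n + 1) × Fin (N + 1))} {X U : Set (PSpace k N)}
    {V : Set (GrassProd k n N N')} {φ : PSpace k N → GrassProd k n N N'} (hX : IsIrreducible X)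
    (hU : IsOpen U) (hV : IsOpen V) (hneU : (X ∩ U).Nonempty) (hneV : (F ∩ V).Nonempty)
    (hφ : Set.BijOn φ (X ∩ U) (F ∩ V))
    (hT : ∀ x ∈ X ∩ U, tangentSpace X x = (φ x).plane.toSubmodule)
    (hpar : ∀ x ∈ X ∩ U, (φ x).plane.minors I ≠ 0 ∧ ∃ hz, x = Projectivization.mk k
        (fibreEmbedding p I j b (φ x).plane (φ x).point.rep) hz) :
    ∃ O : Set (Grassmannian k n N), IsOpen O ∧ (GrassProd.plane '' F ∩ O).Nonempty ∧
      ∀ y ∈ O, ProjectivelyEquivalent (fibre F y) (closure (gaussFibre n X y)) := by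
  classical
  obtain ⟨O, hO, hOne, hOF⟩ := exists_open_subset_closure hF hV hneV
  have hirr : IsIrreducible (GrassProd.plane '' F) :=
    hF.isIrreducible.image _ continuous_plane.continuousOn
  refine ⟨O ∩ {y | y.minors I ≠ 0}, hO.inter (Grassmannian.isOpen_minors_ne_zero I), ?_,
    fun y hy => ⟨fibreEmbedding p I j b y, fibreEmbedding_injective p j b hN hy.2, ?_⟩⟩
  · refine hirr.2 _ _ hO (Grassmannian.isOpen_minors_ne_zero I) hOne ?_
    obtain ⟨x, hx⟩ := hneU
    exact ⟨_, ⟨φ x, (hφ.mapsTo hx).1, rfl⟩, (hpar x hx).1⟩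
  have hemb := isClosedEmbedding_projectivizationMap (fibreEmbedding p I j b y)
    (fibreEmbedding_injective p j b hN hy.2)
  -- one inclusion holds for all smooth points, the other one uses the density of `V` in the fibre
  refine Set.Subset.antisymm ?_ (closure_minimal
    (gaussFibre_subset p j b hN hX hU hneU hF.isClosed (fun x hx => ⟨φ x, (hφ.mapsTo hx).1,
      (hpar x hx).1, hT x hx, (hpar x hx).2⟩) hy.2)
    (hemb.isClosedMap _ (isClosed_fibre hF.isClosed y)))
  refine (Set.image_mono (hOF y hy.1)).trans
    ((image_closure_subset_closure_image hemb.continuous).trans (closure_mono ?_))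
  rintro _ ⟨q, ⟨hq, hqV⟩, rfl⟩
  obtain ⟨x, hx, hxq⟩ := hφ.surjOn ⟨hq, hqV⟩
  have hplane : (φ x).plane = y := by rw [hxq]
  refine ⟨⟨x, mem_smoothLocus_of_eq hx.1 (hT x hx)⟩,
    Grassmannian.ext ((hT x hx).trans (by rw [hplane])), ?_⟩
  obtain ⟨-, hz, hxz⟩ := hpar x hx
  change x = _
  rw [hxz]
  conv_rhs => rw [← q.mk_rep]
  rw [Projectivization.map_mk]
  simp only [hxq]

end Choices

end GaussFamily

end

theorem theorem1p3 {k : Type*} [Field k] [IsAlgClosed k] (p : ℕ) [CharP k p] (hp : 0 < p)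
    (n N N' : ℕ)
    (Y : Set (GaussFamily.Grassmannian k n N)) (hY : GaussFamily.IsVariety Y)
    (hdimY : 1 ≤ topologicalKrullDim Y)
    (F : Set (GaussFamily.GrassProd k n N N')) (hF : GaussFamily.IsVariety F)
    (hdimF : topologicalKrullDim F = n)
    (hsurj : GaussFamily.GrassProd.plane '' F = Y) :
    ∃ (X : Set (GaussFamily.PSpace k N)) (h : GaussFamily.RatMap X F),
      GaussFamily.IsVariety X ∧ topologicalKrullDim X = n ∧
      h.GenericallyBijective ∧ h.GaussMapEqFstComp ∧
      closure (Set.range (GaussFamily.gaussMap n X)) = Y ∧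
      (N' ≤ n → ∃ V : Set (GaussFamily.Grassmannian k n N), IsOpen V ∧ (Y ∩ V).Nonempty ∧
        ∀ y ∈ Y ∩ V, GaussFamily.ProjectivelyEquivalent (GaussFamily.fibre F y)
          (closure (GaussFamily.gaussFibre n X y))) := by
  have : Fact p.Prime := ⟨(CharP.char_is_prime_or_zero k p).resolve_right hp.ne'⟩
  subst hsurj
  by_cases hN : N' ≤ n
  · obtain ⟨I, j, b, X, h, U, V, hX, hdX, hU, hV, hdom, hneU, hneV, hbij, hT, hpar⟩ :=
      GaussFamily.exists_variety_of_le p hN hF hdimF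
    refine ⟨X, h, hX, hdX, ⟨U, V, hU, hV, hdom, hneU, hneV, hbij⟩, ⟨U, hU, hdom, hneU, fun x hx =>
      ⟨GaussFamily.mem_smoothLocus_of_eq hx.1 (hT x hx), GaussFamily.Grassmannian.ext (hT x hx)⟩⟩,
      GaussFamily.closure_range_gaussMap hX.isIrreducible hU hneU hY.isClosed hF.isIrreducible hV
        hneV rfl hbij hT, fun _ => ?_⟩
    obtain ⟨O, hO, hne, h⟩ := GaussFamily.exists_open_projectivelyEquivalent p hN hF
      hX.isIrreducible hU hV hneU hneV hbij hT hpar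
    exact ⟨O, hO, hne, fun y hy => h y hy.2⟩
  · obtain ⟨X, h, U, V, hX, hdX, hU, hV, hdom, hneU, hneV, hbij, hT⟩ :=
      GaussFamily.exists_variety p hF hdimF hdimY
    exact ⟨X, h, hX, hdX, ⟨U, V, hU, hV, hdom, hneU, hneV, hbij⟩, ⟨U, hU, hdom, hneU, fun x hx =>
      ⟨GaussFamily.mem_smoothLocus_of_eq hx.1 (hT x hx), GaussFamily.Grassmannian.ext (hT x hx)⟩⟩,
      GaussFamily.closure_range_gaussMap hX.isIrreducible hU hneU hY.isClosed hF.isIrreducible hV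
        hneV rfl hbij hT, fun h => (hN h).elim⟩
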